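/- There is a deterministic algorithm for weighted metric $k$-means with near-optimal running time. Precisely: there are a program $P$ and constants $b, c \in \mathbb N$ and $C_1, C_2 \in \mathbb R$ such that the following holds for all integers $1 \le k \le n$, every metric space $(V,d)$ with $n$ points and every weight function $w : V \to \mathbb R_{\ge 0}$. For nonempty $S \subseteq V$ put $$\mathrm{cost}(S) := \sum_{x \in V} w(x)\, d(x,S)^2, \qquad d(x,S) := \min_{y \in S} d(x,y), \qquad \mathrm{OPT}_k := \min_{\emptyset \ne S \subseteq V,\ |S| \le k} \mathrm{cost}(S),$$ and let $\Delta$ be the aspect ratio of $V$, i.e. the largest distance divided by the smallest nonzero distance ($\Delta := 1$ if $n = 1$). Given $n$, $k$ and query access to $d$ and $w$ (with the points numbered arbitrarily), $P$ halts after at most $$C_1 \cdot n k \cdot (1 + \log (n\Delta))^{c} = \tilde O(nk)$$ steps and returns a nonempty set $S \subseteq V$ with $|S| \le k$ and $$\mathrm{cost}(S) \le C_2 \cdot \max\{1, \log^2(n/k)\} \cdot \mathrm{OPT}_k ,$$ i.e. an $O(\log^2(n/k))$-approximate solution (where $O(\log^2(n/k))$ is read as $O(1)$ when $n/k$ is bounded).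 The model of computation is the deterministic word/real RAM: $P$ is one fixed structured program (assignments, sequencing, branching and while-loops) over finitely many variables and arrays, initially zero except that two variables hold $n$ and $k$. They hold machine words, which are natural numbers below $(n+2)^b$ with addition and multiplication modulo $(n+2)^b$, truncated subtraction, integer division with remainder and comparison, or real numbers with exact addition, subtraction, multiplication, division and comparison (natural-number constants, conversion of words to reals, no rounding and no conversion of reals to words). Arrays are indexed by words. Every operation, comparison, memory access, and query of a distance $d(x,y)$ or a weight $w(x)$ takes one step. -/

import Mathlib

open scoped NNReal

namespace KMeans

/-! ## Weighted metric `k`-means -/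

/-- `cost(S) = ∑ₓ w(x) d(x, S)²`. For nonempty `S`, `Metric.infDist x S` is the distance from `x`
to its nearest point in the finite set `S`; the empty set is never used as a solution below. -/
noncomputable def cost {V : Type*} [Fintype V] [MetricSpace V] (w : V → ℝ≥0) (S : Finset V) : ℝ :=
  ∑ x, (w x : ℝ) * Metric.infDist x (S : Set V) ^ 2

/-- The minimum cost of a solution with at least one and at most `k` centres. -/
noncomputable def opt {V : Type*} [Fintype V] [MetricSpace V] (w : V → ℝ≥0) (k : ℕ) : ℝ :=
  ⨅ S : {S : Finset V // S.Nonempty ∧ S.card ≤ k}, cost w S.1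

/-- The aspect ratio: the largest distance divided by the smallest nonzero distance. The maximum
with `1` only matters for a space with a single point, where both distances are missing. -/
noncomputable def aspectRatio (V : Type*) [MetricSpace V] : ℝ :=
  max 1 (Metric.diam (Set.univ : Set V) / Set.infsep (Set.univ : Set V))

/-! ## Deterministic algorithms: structured programs on a word/real RAM

A program has finitely many scalar variables and arrays, each numbered by a natural number, holding
either machine words or real numbers. Words are natural numbers below a bound `M`, which will be
polynomial in the number of points, and word arithmetic is modulo `M`. Reals can be added,
subtracted, multiplied, divided and compared, but there is no rounding and no way to convert a real
to a word. The metric and the weights are read by queries. Each elementary operation, query, memory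
access and test takes one unit of time. -/

/-- The input of a program: the number `n` of points, the number `k` of centres, the distances and
the weights of the points `0, …, n - 1`. -/
structure Input where
  n : ℕ
  k : ℕ
  d : ℕ → ℕ → ℝ
  w : ℕ → ℝ

/-- The memory: word variables, word arrays, real variables, real arrays. -/
structure State where
  wvar : ℕ → ℕ
  warr : ℕ → ℕ → ℕ
  rvar : ℕ → ℝ
  rarr : ℕ → ℕ → ℝ

/-- Store `v` in word variable `x`. -/
def State.setW (s : State) (x v : ℕ) : State :=
  { s with wvar := Function.update s.wvar x v }

/-- Store `v` in entry `i` of word array `a`. -/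
def State.setWArr (s : State) (a i v : ℕ) : State :=
  { s with warr := Function.update s.warr a (Function.update (s.warr a) i v) }

/-- Store `v` in real variable `x`. -/
def State.setR (s : State) (x : ℕ) (v : ℝ) : State :=
  { s with rvar := Function.update s.rvar x v }

/-- Store `v` in entry `i` of real array `a`. -/
def State.setRArr (s : State) (a i : ℕ) (v : ℝ) : State :=
  { s with rarr := Function.update s.rarr a (Function.update (s.rarr a) i v) }

/-- Word expressions. -/
inductive WExp where
  | lit (c : ℕ)
  | var (x : ℕ)
  | get (a : ℕ) (i : WExp)
  | add (e f : WExp)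
  | sub (e f : WExp)
  | mul (e f : WExp)
  | div (e f : WExp)
  | mod (e f : WExp)

/-- Real expressions. -/
inductive RExp where
  | lit (c : ℕ)
  | var (x : ℕ)
  | get (a : ℕ) (i : WExp)
  | ofWord (i : WExp)
  | dist (i j : WExp)
  | weight (i : WExp)
  | add (e f : RExp)
  | sub (e f : RExp)
  | mul (e f : RExp)
  | div (e f : RExp)

/-- Tests. -/
inductive Test where
  | wle (e f : WExp)
  | rle (e f : RExp)
  | neg (p : Test)
  | conj (p q : Test)

/-- Programs. -/
inductive Prog where
  | skip
  | setW (x : ℕ) (e : WExp)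
  | setWArr (a : ℕ) (i e : WExp)
  | setR (x : ℕ) (e : RExp)
  | setRArr (a : ℕ) (i : WExp) (e : RExp)
  | seq (p q : Prog)
  | branch (b : Test) (p q : Prog)
  | loop (b : Test) (p : Prog)

/-- The time to evaluate a word expression. -/
def WExp.time : WExp → ℕ
  | lit _ => 1
  | var _ => 1
  | get _ i => i.time + 1
  | add e f => e.time + f.time + 1
  | sub e f => e.time + f.time + 1
  | mul e f => e.time + f.time + 1
  | div e f => e.time + f.time + 1
  | mod e f => e.time + f.time + 1

/-- The time to evaluate a real expression. -/
def RExp.time : RExp → ℕ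
  | lit _ => 1
  | var _ => 1
  | get _ i => i.time + 1
  | ofWord i => i.time + 1
  | dist i j => i.time + j.time + 1
  | weight i => i.time + 1
  | add e f => e.time + f.time + 1
  | sub e f => e.time + f.time + 1
  | mul e f => e.time + f.time + 1
  | div e f => e.time + f.time + 1

/-- The time to evaluate a test. -/
def Test.time : Test → ℕ
  | wle e f => e.time + f.time + 1
  | rle e f => e.time + f.time + 1
  | neg p => p.time + 1
  | conj p q => p.time + q.time + 1

/-- The value of a word expression, for word arithmetic modulo `M`. -/
def WExp.eval (M : ℕ) (s : State) : WExp → ℕ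
  | lit c => c % M
  | var x => s.wvar x
  | get a i => s.warr a (i.eval M s)
  | add e f => (e.eval M s + f.eval M s) % M
  | sub e f => e.eval M s - f.eval M s
  | mul e f => (e.eval M s * f.eval M s) % M
  | div e f => e.eval M s / f.eval M s
  | mod e f => e.eval M s % f.eval M s

/-- The value of a real expression. -/
noncomputable def RExp.eval (I : Input) (M : ℕ) (s : State) : RExp → ℝ
  | lit c => c
  | var x => s.rvar x
  | get a i => s.rarr a (i.eval M s)
  | ofWord i => (i.eval M s : ℝ)
  | dist i j => I.d (i.eval M s) (j.eval M s)
  | weight i => I.w (i.eval M s)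
  | add e f => e.eval I M s + f.eval I M s
  | sub e f => e.eval I M s - f.eval I M s
  | mul e f => e.eval I M s * f.eval I M s
  | div e f => e.eval I M s / f.eval I M s

/-- The truth value of a test. -/
def Test.Holds (I : Input) (M : ℕ) (s : State) : Test → Prop
  | wle e f => e.eval M s ≤ f.eval M s
  | rle e f => e.eval I M s ≤ f.eval I M s
  | neg p => ¬ p.Holds I M s
  | conj p q => p.Holds I M s ∧ q.Holds I M s

/-- `Run I M p s s' t`: started in state `s`, the program `p` halts in state `s'` after time `t`. -/
inductive Run (I : Input) (M : ℕ) : Prog → State → State → ℕ → Prop where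
  | skip (s : State) : Run I M .skip s s 1
  | setW (x : ℕ) (e : WExp) (s : State) :
      Run I M (.setW x e) s
        (s.setW x (e.eval M s)) (e.time + 1)
  | setWArr (a : ℕ) (i e : WExp) (s : State) :
      Run I M (.setWArr a i e) s
        (s.setWArr a (i.eval M s) (e.eval M s)) (i.time + e.time + 1)
  | setR (x : ℕ) (e : RExp) (s : State) :
      Run I M (.setR x e) s
        (s.setR x (e.eval I M s)) (e.time + 1)
  | setRArr (a : ℕ) (i : WExp) (e : RExp) (s : State) :
      Run I M (.setRArr a i e) s
        (s.setRArr a (i.eval M s) (e.eval I M s)) (i.time + e.time + 1)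
  | seq {p q : Prog} {s s₁ s₂ : State} {t₁ t₂ : ℕ} :
      Run I M p s s₁ t₁ → Run I M q s₁ s₂ t₂ → Run I M (.seq p q) s s₂ (t₁ + t₂)
  | branch_true {b : Test} {p q : Prog} {s s' : State} {t : ℕ} :
      b.Holds I M s → Run I M p s s' t → Run I M (.branch b p q) s s' (b.time + 1 + t)
  | branch_false {b : Test} {p q : Prog} {s s' : State} {t : ℕ} :
      ¬ b.Holds I M s → Run I M q s s' t → Run I M (.branch b p q) s s' (b.time + 1 + t)
  | loop_done {b : Test} {p : Prog} {s : State} :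
      ¬ b.Holds I M s → Run I M (.loop b p) s s (b.time + 1)
  | loop_step {b : Test} {p : Prog} {s s₁ s₂ : State} {t₁ t₂ : ℕ} :
      b.Holds I M s → Run I M p s s₁ t₁ → Run I M (.loop b p) s₁ s₂ t₂ →
        Run I M (.loop b p) s s₂ (b.time + 1 + t₁ + t₂)

/-- At the start word variable `0` holds `n`, word variable `1` holds `k`, all else is zero. -/
noncomputable def start (I : Input) : State where
  wvar := fun x => if x = 0 then I.n else if x = 1 then I.k else 0
  warr := fun _ _ => 0
  rvar := fun _ => 0
  rarr := fun _ _ => 0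

/-- The input that describes the weighted metric space `V`, whose points are numbered by `e`.
Queries about indices that are not below `n` return zero. -/
noncomputable def Input.ofSpace {V : Type*} {n : ℕ} [MetricSpace V] (e : Fin n ≃ V) (w : V → ℝ≥0)
    (k : ℕ) : Input where
  n := n
  k := k
  d := fun i j => if h : i < n ∧ j < n then dist (e ⟨i, h.1⟩) (e ⟨j, h.2⟩) else 0
  w := fun i => if h : i < n then (w (e ⟨i, h⟩) : ℝ) else 0

/-- The set of centres returned in state `s`: the points whose entry in word array `0` is
nonzero. -/
def output {V : Type*} {n : ℕ} [Fintype V] (e : Fin n ≃ V) (s : State) : Finset V :=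
  Finset.univ.filter fun v => s.warr 0 (e.symm v) ≠ 0

end KMeans

namespace KMeans

/-! ## Weighted `k`-means on indices -/

/-! The algorithm thins the points out to at most `2k` candidate centres and then solves the problem
with these candidates as facilities. Both stages rest on reverse greedy: delete again and again the
centre whose deletion raises the cost least. Let `S` be the current centres and `T` any solution
with fewer centres, and move `T` to the nearest points of `S`, giving `U ⊆ S`. A client at distance
`e` from `S` and `o` from `T` is within `e + 2o` of `U`. Deleting a centre outside `U` therefore
raises the squared distance of its own clients by at most `4eo + 4o² ≤ (2/θ)e² + (2θ+4)o²`, for any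
`θ > 0`, and averaging over the at least `|S| - |T|` centres outside `U` bounds the cheapest
deletion (`cost_erase_le`). While the surplus is at least `K`, each deletion thus multiplies the
bound by at most `exp(2/(θK))` and adds a term `(2θ+4)/K * cost(T)` (`Greedy.cost_le`).

Thinning (`level_spec`, `sparsify_spec`): at the start every point is a centre and the points, in
the order of their numbers, are cut into blocks of length `2k`. Neighbouring blocks are merged, and
each merged block, with at most `4k` centres, is reduced to at most `2k` by reverse greedy with the
clients of that block. The comparison solution is the global optimum, whose costs on the blocks add
up to `OPT`. The surplus is at least `k`, so one level multiplies the total cost by `exp(4/θ)` and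
adds `(4θ+8)OPT` before multiplying. The cost starts at `0` and there are at most `log₂(n/k)`
levels, so `θ = max(1, log₂(n/k))` gives `O(θ²)OPT`. This is the only source of the squared
logarithm.

Second stage (`finish_spec`): projecting the optimum shows that the candidates contain a solution
with at most `k` centres of cost at most `2cost(S) + 8OPT` (`exists_projection_cost`). A primal-dual
method of Jain-Vazirani type with opening cost `f` yields `Z` with `f|Z| + cost(Z)/9 ≤ cost(T) +
f|T|` (`DualCert.lmp`). As `f` is doubled, `|Z|` drops to at most `k` at some step. Either the
smaller of the two consecutive solutions is already good, or its deficit below `k` is at least the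
excess of the larger one, and then reverse greedy from the larger one, compared with the smaller
one, loses only a constant factor (`exists_good_multiplier`). Plain reverse greedy is within a
factor `56n²` of the best choice (`Greedy.cost_le_sq`), so `O(log n)` values of `f` suffice, and the
running time does not involve the aspect ratio at all.

Running time: every client keeps a tournament tree over the centres, so a deletion costs a logarithm
per client. In the primal-dual method every facility keeps a tree over the clients it has not
reached, and an amortised count charges the work to clients leaving trees, clients being frozen and
facilities being opened. Correctness and time are proved together with weakest preconditions whose
postconditions see the elapsed time. -/

/-- The distances and weights of an input come from a weighted metric space. -/
structure Input.IsMetric (I : Input) : Prop where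
  self : ∀ i, I.d i i = 0
  nonneg : ∀ i j, 0 ≤ I.d i j
  comm : ∀ i j, I.d i j = I.d j i
  tri : ∀ i j l, j < I.n → I.d i l ≤ I.d i j + I.d j l
  w_nonneg : ∀ i, 0 ≤ I.w i

/-- The squared distance from `x` to the nearest point of `S` (zero if `S` is empty). -/
noncomputable def sqDist (I : Input) (S : Finset ℕ) (x : ℕ) : ℝ :=
  if h : S.Nonempty then S.inf' h (fun y => I.d x y ^ 2) else 0

/-- The cost of the centres `S` for the clients `X`. -/
noncomputable def costOn (I : Input) (X S : Finset ℕ) : ℝ := ∑ x ∈ X, I.w x * sqDist I S x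

theorem sqDist_le {I : Input} {S : Finset ℕ} {y : ℕ} (hy : y ∈ S) (x : ℕ) :
    sqDist I S x ≤ I.d x y ^ 2 := by
  rw [sqDist, dif_pos ⟨y, hy⟩]
  exact Finset.inf'_le (fun y => I.d x y ^ 2) hy

theorem exists_sqDist {I : Input} {S : Finset ℕ} (hS : S.Nonempty) (x : ℕ) :
    ∃ y ∈ S, sqDist I S x = I.d x y ^ 2 := by
  rw [sqDist, dif_pos hS]
  exact Finset.exists_mem_eq_inf' hS (fun y => I.d x y ^ 2)

theorem sqDist_nonneg (I : Input) (S : Finset ℕ) (x : ℕ) : 0 ≤ sqDist I S x := by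
  by_cases h : S.Nonempty
  · obtain ⟨y, -, hy⟩ := exists_sqDist (I := I) h x
    rw [hy]; positivity
  · simp [sqDist, h]

theorem sqDist_anti {I : Input} {S S' : Finset ℕ} (h : S ⊆ S') (hS : S.Nonempty) (x : ℕ) :
    sqDist I S' x ≤ sqDist I S x := by
  obtain ⟨y, hy, e⟩ := exists_sqDist (I := I) hS x
  rw [e]; exact sqDist_le (h hy) x

theorem sqDist_eq {I : Input} {S : Finset ℕ} {y x : ℕ} (hy : y ∈ S)
    (h : ∀ z ∈ S, I.d x y ^ 2 ≤ I.d x z ^ 2) : sqDist I S x = I.d x y ^ 2 := by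
  refine le_antisymm (sqDist_le hy x) ?_
  obtain ⟨z, hz, e⟩ := exists_sqDist (I := I) ⟨y, hy⟩ x
  rw [e]; exact h z hz

theorem costOn_nonneg {I : Input} (hI : I.IsMetric) (X S : Finset ℕ) : 0 ≤ costOn I X S :=
  Finset.sum_nonneg fun x _ => mul_nonneg (hI.w_nonneg x) (sqDist_nonneg I S x)

theorem costOn_anti {I : Input} (hI : I.IsMetric) (X : Finset ℕ) {S S' : Finset ℕ} (h : S ⊆ S')
    (hS : S.Nonempty) : costOn I X S' ≤ costOn I X S :=
  Finset.sum_le_sum fun x _ => mul_le_mul_of_nonneg_left (sqDist_anti h hS x) (hI.w_nonneg x)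

/-- Moving the centres `T` to their nearest points in `S`. -/
theorem exists_projection {I : Input} (hI : I.IsMetric) {S T : Finset ℕ} (hS : S.Nonempty)
    (hT : T.Nonempty) (hTn : T ⊆ Finset.range I.n) :
    ∃ U ⊆ S, U.Nonempty ∧ U.card ≤ T.card ∧ ∀ x < I.n, ∃ u ∈ U, ∀ e o : ℝ, 0 ≤ e → 0 ≤ o →
      sqDist I S x = e ^ 2 → sqDist I T x = o ^ 2 → I.d x u ≤ e + 2 * o := by
  choose p hp hpe using fun t => exists_sqDist (I := I) hS t
  refine ⟨T.image p, ?_, hT.image p, Finset.card_image_le, ?_⟩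
  · intro u hu
    obtain ⟨t, -, rfl⟩ := Finset.mem_image.1 hu
    exact hp t
  · intro x hx
    obtain ⟨t, ht, hto⟩ := exists_sqDist (I := I) hT x
    refine ⟨p t, Finset.mem_image_of_mem p ht, fun e o he ho h1 h2 => ?_⟩
    obtain ⟨s, hs, hse⟩ := exists_sqDist (I := I) hS x
    have e1 : I.d x s = e := by
      have := hse.symm.trans h1
      exact (pow_left_inj₀ (hI.nonneg _ _) he two_ne_zero).1 this
    have e2 : I.d x t = o := by
      have := hto.symm.trans h2
      exact (pow_left_inj₀ (hI.nonneg _ _) ho two_ne_zero).1 this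
    have e3 : I.d t (p t) ≤ I.d t s := by
      have := (hpe t).symm.le.trans (sqDist_le hs t)
      exact (pow_le_pow_iff_left₀ (hI.nonneg _ _) (hI.nonneg _ _) two_ne_zero).1 this
    have t1 := hI.tri x t (p t) (Finset.mem_range.1 (hTn ht))
    have t2 := hI.tri t x s hx
    rw [hI.comm t x] at t2
    linarith

/-- The cost of the projection of `T` to `S`. -/
theorem exists_projection_cost {I : Input} (hI : I.IsMetric) {X S T : Finset ℕ} (hS : S.Nonempty)
    (hT : T.Nonempty) (hTn : T ⊆ Finset.range I.n) (hX : X ⊆ Finset.range I.n) :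
    ∃ U ⊆ S, U.Nonempty ∧ U.card ≤ T.card ∧ costOn I X U ≤ 2 * costOn I X S + 8 * costOn I X T := by
  obtain ⟨U, hU, hne, hc, h⟩ := exists_projection hI hS hT hTn
  refine ⟨U, hU, hne, hc, ?_⟩
  rw [costOn, costOn, costOn, Finset.mul_sum, Finset.mul_sum, ← Finset.sum_add_distrib]
  refine Finset.sum_le_sum fun x hx => ?_
  obtain ⟨u, hu, hd⟩ := h x (Finset.mem_range.1 (hX hx))
  obtain ⟨s, -, hs⟩ := exists_sqDist (I := I) hS x
  obtain ⟨t, -, ht⟩ := exists_sqDist (I := I) hT x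
  have := hd _ _ (hI.nonneg x s) (hI.nonneg x t) hs ht
  have h1 : sqDist I U x ≤ 2 * sqDist I S x + 8 * sqDist I T x := by
    rw [hs, ht]
    refine (sqDist_le hu x).trans ?_
    have := pow_le_pow_left₀ (hI.nonneg x u) this 2
    -- `(e + 2o)² + (e - 2o)² = 2e² + 8o²`.
    nlinarith [sq_nonneg (I.d x s - 2 * I.d x t)]
  have := mul_le_mul_of_nonneg_left h1 (hI.w_nonneg x)
  linarith

/-! ## Reverse greedy -/

/-- Removing the centre whose removal is cheapest, compared with any solution `T`. -/
theorem cost_erase_le {I : Input} (hI : I.IsMetric) {X S T : Finset ℕ} {c : ℕ}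
    (hX : X ⊆ Finset.range I.n) (hTn : T ⊆ Finset.range I.n) (hT : T.Nonempty)
    (hTS : T.card < S.card) (hc : c ∈ S)
    (hmin : ∀ s ∈ S, costOn I X (S.erase c) ≤ costOn I X (S.erase s)) {θ : ℝ} (hθ : 0 < θ) :
    ((S.card : ℝ) - T.card) * (costOn I X (S.erase c) - costOn I X S) ≤
      2 / θ * costOn I X S + (2 * θ + 4) * costOn I X T := by
  classical
  have hS : S.Nonempty := ⟨c, hc⟩
  have hTc : 1 ≤ T.card := hT.card_pos
  have hne : ∀ s ∈ S, (S.erase s).Nonempty := fun s hs => by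
    rw [← Finset.card_pos, Finset.card_erase_of_mem hs]; omega
  obtain ⟨U, hU, -, hUc, h⟩ := exists_projection hI hS hT hTn
  choose a ha hae using fun x => exists_sqDist (I := I) hS x
  set g : ℕ → ℝ := fun x => I.w x * (2 / θ * sqDist I S x + (2 * θ + 4) * sqDist I T x) with hg
  have g0 : ∀ x, 0 ≤ g x := fun x => by
    have := sqDist_nonneg I S x
    have := sqDist_nonneg I T x
    have := hI.w_nonneg x
    positivity
  -- Only the clients whose chosen nearest centre is `s` are affected, and they can move to `U`,
  -- which survives because `s ∉ U`.
  have key : ∀ s ∈ S \ U, costOn I X (S.erase s) - costOn I X S ≤ ∑ x ∈ X with a x = s, g x := by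
    intro s hs
    rw [Finset.mem_sdiff] at hs
    rw [costOn, costOn, ← Finset.sum_sub_distrib, Finset.sum_filter]
    refine Finset.sum_le_sum fun x hx => ?_
    rw [← mul_sub]
    split_ifs with hax
    · refine mul_le_mul_of_nonneg_left ?_ (hI.w_nonneg x)
      obtain ⟨u, hu, hd⟩ := h x (Finset.mem_range.1 (hX hx))
      obtain ⟨t, -, ht⟩ := exists_sqDist (I := I) hT x
      have hd := hd _ _ (hI.nonneg x (a x)) (hI.nonneg x t) (hae x) ht
      have h1 : sqDist I (S.erase s) x ≤ I.d x u ^ 2 :=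
        sqDist_le (Finset.mem_erase.2 ⟨fun h => hs.2 (by rwa [← h]), hU hu⟩) x
      have h2 := pow_le_pow_left₀ (hI.nonneg x u) hd 2
      rw [ht, hae x]
      set e := I.d x (a x)
      set o := I.d x t
      -- Weighted arithmetic-geometric mean; `θ` is left free, as the uses of the lemma need
      -- different trade-offs between the two terms.
      have h3 : 4 * e * o ≤ 2 / θ * e ^ 2 + 2 * θ * o ^ 2 := by
        have : 2 / θ * e ^ 2 + 2 * θ * o ^ 2 - 4 * e * o = 2 / θ * (e - θ * o) ^ 2 := by
          field_simp; ring
        have : 0 ≤ 2 / θ * (e - θ * o) ^ 2 := by positivity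
        linarith
      nlinarith
    · have : sqDist I (S.erase s) x ≤ sqDist I S x := by
        rw [hae x]; exact sqDist_le (Finset.mem_erase.2 ⟨hax, ha x⟩) x
      nlinarith [hI.w_nonneg x]
  -- The cheapest deletion is at most the average over `S \ U`, and every client is charged for only
  -- one centre.
  have h1 : ((S \ U).card : ℝ) * (costOn I X (S.erase c) - costOn I X S) ≤ ∑ x ∈ X, g x := by
    calc ((S \ U).card : ℝ) * (costOn I X (S.erase c) - costOn I X S)
        = ∑ _s ∈ S \ U, (costOn I X (S.erase c) - costOn I X S) := by
          rw [Finset.sum_const, nsmul_eq_mul]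
      _ ≤ ∑ s ∈ S \ U, ∑ x ∈ X with a x = s, g x := Finset.sum_le_sum fun s hs => by
          have := hmin s (Finset.mem_sdiff.1 hs).1
          linarith [key s hs]
      _ ≤ ∑ s ∈ S, ∑ x ∈ X with a x = s, g x :=
          Finset.sum_le_sum_of_subset_of_nonneg Finset.sdiff_subset
            fun _ _ _ => Finset.sum_nonneg fun x _ => g0 x
      _ = ∑ x ∈ X, g x := Finset.sum_fiberwise_of_maps_to (fun x _ => ha x) g
  have h2 : ∑ x ∈ X, g x = 2 / θ * costOn I X S + (2 * θ + 4) * costOn I X T := by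
    rw [costOn, costOn, Finset.mul_sum, Finset.mul_sum, ← Finset.sum_add_distrib]
    exact Finset.sum_congr rfl fun x _ => by rw [hg]; ring
  have h3 : (S.card : ℝ) - T.card ≤ (S \ U).card := by
    have : S.card ≤ (S \ U).card + T.card := by
      have := Finset.le_card_sdiff U S
      omega
    have : (S.card : ℝ) ≤ (S \ U).card + T.card := by exact_mod_cast this
    linarith
  have h4 := costOn_anti hI X (Finset.erase_subset c S) (hne c hc)
  rw [← h2]
  exact (mul_le_mul_of_nonneg_right h3 (by linarith)).trans h1

/-- `Greedy I X S S'`: reverse greedy with the clients `X` can reduce `S` to `S'`. -/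
inductive Greedy (I : Input) (X S : Finset ℕ) : Finset ℕ → Prop where
  | refl : Greedy I X S S
  | step {S' : Finset ℕ} {c : ℕ} : Greedy I X S S' → c ∈ S' →
      (∀ s ∈ S', costOn I X (S'.erase c) ≤ costOn I X (S'.erase s)) → Greedy I X S (S'.erase c)

theorem Greedy.subset {I : Input} {X S S' : Finset ℕ} (h : Greedy I X S S') : S' ⊆ S := by
  induction h with
  | refl => exact Finset.Subset.refl _
  | step _ _ _ ih => exact (Finset.erase_subset _ _).trans ih

/-- The assumption on the final set says that before every deletion the surplus over `T` is at least
`K`. With `u = 2/(θK)` and `v = (2θ+4)/K * cost(T)` each deletion obeys `c' ≤ (1 + u)c + v`, which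
is unrolled using `1 + u ≤ exp u`. -/
theorem Greedy.cost_le {I : Input} (hI : I.IsMetric) {X S S' T : Finset ℕ} (h : Greedy I X S S')
    (hX : X ⊆ Finset.range I.n) (hTn : T ⊆ Finset.range I.n) (hT : T.Nonempty) {K θ : ℝ}
    (hK : 0 < K) (hθ : 0 < θ) (hKS : K + T.card ≤ S'.card + 1) :
    costOn I X S' ≤ Real.exp (2 / (θ * K) * ((S.card : ℝ) - S'.card)) *
      (costOn I X S + ((S.card : ℝ) - S'.card) * ((2 * θ + 4) / K * costOn I X T)) := by
  induction h with
  | refl => simp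
  | @step S' c hg hc hmin ih =>
    have hcard := Finset.card_erase_add_one hc
    have hcard' : ((S'.erase c).card : ℝ) = S'.card - 1 := by
      rw [← hcard]; push_cast; ring
    rw [hcard'] at hKS ⊢
    have ih := ih (by linarith)
    have hlt : T.card < S'.card := by
      have : (T.card : ℝ) < S'.card := by linarith
      exact_mod_cast this
    have hne : (S'.erase c).Nonempty := by
      rw [← Finset.card_pos]
      have := hT.card_pos
      omega
    have h1 := cost_erase_le hI hX hTn hT hlt hc hmin hθ
    have h0 := costOn_anti hI X (Finset.erase_subset c S') hne
    have h2 : K * (costOn I X (S'.erase c) - costOn I X S') ≤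
        2 / θ * costOn I X S' + (2 * θ + 4) * costOn I X T :=
      (mul_le_mul_of_nonneg_right (by linarith) (by linarith)).trans h1
    set N : ℝ := (S.card : ℝ) - S'.card with hN
    have hN0 : 0 ≤ N := by
      have := Finset.card_le_card hg.subset
      have : (S'.card : ℝ) ≤ S.card := by exact_mod_cast this
      linarith
    have hN1 : (S.card : ℝ) - (S'.card - 1) = N + 1 := by rw [hN]; ring
    rw [hN1]
    set u := 2 / (θ * K) with hu
    set v := (2 * θ + 4) / K * costOn I X T with hv
    have hu0 : 0 < u := by positivity
    have hv0 : 0 ≤ v := by have := costOn_nonneg hI X T; positivity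
    have h3 : costOn I X (S'.erase c) ≤ (1 + u) * costOn I X S' + v := by
      have : costOn I X (S'.erase c) - costOn I X S' ≤
          (2 / θ * costOn I X S' + (2 * θ + 4) * costOn I X T) / K := by
        rw [le_div_iff₀ hK]; linarith
      have e : (2 / θ * costOn I X S' + (2 * θ + 4) * costOn I X T) / K = u * costOn I X S' + v := by
        rw [hu, hv]; field_simp
      linarith
    have hexp : 1 + u ≤ Real.exp u := by linarith [Real.add_one_le_exp u]
    have hc0 := costOn_nonneg hI X S
    have hB : 0 ≤ costOn I X S + N * v := by positivity
    have hE : 1 ≤ Real.exp (u * N) := Real.one_le_exp (by positivity)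
    have hE1 : 1 ≤ Real.exp u := Real.one_le_exp hu0.le
    calc costOn I X (S'.erase c) ≤ (1 + u) * costOn I X S' + v := h3
      _ ≤ Real.exp u * (Real.exp (u * N) * (costOn I X S + N * v)) + v := by
          have := mul_le_mul hexp ih (costOn_nonneg hI X S') (Real.exp_pos u).le
          linarith
      _ ≤ Real.exp u * (Real.exp (u * N) * (costOn I X S + N * v)) +
            Real.exp u * Real.exp (u * N) * v := by
          have : 1 * v ≤ Real.exp u * Real.exp (u * N) * v :=
            mul_le_mul_of_nonneg_right (one_le_mul_of_one_le_of_one_le hE1 hE) hv0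
          linarith
      _ = Real.exp (u * (N + 1)) * (costOn I X S + (N + 1) * v) := by
          rw [mul_add u, mul_one, Real.exp_add]; ring

/-! ## Lagrangian relaxation -/

/-- A certificate that the facilities `Z` arise from the primal-dual method for facilities `F` of
opening cost `f`: dual variables `α` and opening times `R`. -/
structure DualCert (I : Input) (F : Finset ℕ) (f : ℝ) (Z : Finset ℕ) (α R : ℕ → ℝ) : Prop where
  subset : Z ⊆ F
  feasible : ∀ i ∈ F, ∑ j ∈ Finset.range I.n, I.w j * max (α j - I.d i j ^ 2) 0 ≤ f
  tight : ∀ z ∈ Z, ∑ j ∈ Finset.range I.n, I.w j * max (α j - I.d z j ^ 2) 0 = f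
  bounded : ∀ z ∈ Z, ∀ j < I.n, α j ≤ max (R z) (I.d z j ^ 2)
  sep : ∀ z ∈ Z, ∀ z' ∈ Z, z ≠ z' → 4 * R z < I.d z z' ^ 2 ∨ 4 * R z' < I.d z z' ^ 2
  cover : ∀ j < I.n, ∃ z ∈ Z, I.d j z ^ 2 ≤ 9 * α j

/-- The primal-dual method preserves the Lagrange multiplier. -/
theorem DualCert.lmp {I : Input} (hI : I.IsMetric) {F Z T : Finset ℕ} {f : ℝ} {α R : ℕ → ℝ}
    (h : DualCert I F f Z α R) (hTF : T ⊆ F) (hT : T.Nonempty) :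
    f * Z.card + costOn I (Finset.range I.n) Z / 9 ≤
      costOn I (Finset.range I.n) T + f * T.card := by
  classical
  -- Weak duality: at its nearest centre in `T` a client offers at least `α j - sqDist I T j`, and
  -- no facility receives more than `f`.
  have ub : ∑ j ∈ Finset.range I.n, I.w j * α j ≤
      costOn I (Finset.range I.n) T + f * T.card := by
    have h1 : ∑ j ∈ Finset.range I.n, I.w j * (α j - sqDist I T j) ≤ f * T.card := by
      calc _ ≤ ∑ j ∈ Finset.range I.n, ∑ t ∈ T, I.w j * max (α j - I.d t j ^ 2) 0 := by
            refine Finset.sum_le_sum fun j _ => ?_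
            obtain ⟨t, ht, e⟩ := exists_sqDist (I := I) hT j
            refine le_trans ?_ (Finset.single_le_sum (f := fun t => I.w j * max (α j - I.d t j ^ 2) 0)
              (fun t _ => mul_nonneg (hI.w_nonneg j) (le_max_right _ _)) ht)
            refine mul_le_mul_of_nonneg_left ?_ (hI.w_nonneg j)
            rw [e, hI.comm j t]; exact le_max_left _ _
        _ = ∑ t ∈ T, ∑ j ∈ Finset.range I.n, I.w j * max (α j - I.d t j ^ 2) 0 := Finset.sum_comm
        _ ≤ ∑ _t ∈ T, f := Finset.sum_le_sum fun t ht => h.feasible t (hTF ht)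
        _ = f * T.card := by simp [mul_comm]
    have h2 : ∑ j ∈ Finset.range I.n, I.w j * (α j - sqDist I T j) =
        ∑ j ∈ Finset.range I.n, I.w j * α j - costOn I (Finset.range I.n) T := by
      rw [costOn, ← Finset.sum_sub_distrib]; exact Finset.sum_congr rfl fun j _ => by ring
    linarith
  -- Each client's `α j` pays for its share of the opening costs of `Z` and for a ninth of its
  -- connection cost.
  have lb : f * Z.card + costOn I (Finset.range I.n) Z / 9 ≤
      ∑ j ∈ Finset.range I.n, I.w j * α j := by
    have h1 : f * Z.card = ∑ j ∈ Finset.range I.n, ∑ z ∈ Z, I.w j * max (α j - I.d z j ^ 2) 0 := by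
      rw [Finset.sum_comm, Finset.sum_congr rfl fun z hz => h.tight z hz]; simp [mul_comm]
    rw [h1, costOn, Finset.sum_div, ← Finset.sum_add_distrib]
    refine Finset.sum_le_sum fun j hj => ?_
    have hj := Finset.mem_range.1 hj
    rw [← Finset.mul_sum, mul_div_assoc, ← mul_add]
    refine mul_le_mul_of_nonneg_left ?_ (hI.w_nonneg j)
    by_cases hz : ∃ z ∈ Z, I.d z j ^ 2 < α j
    · obtain ⟨z, hz, hlt⟩ := hz
      rw [Finset.sum_eq_single z]
      · have h2 := sqDist_le (I := I) hz j
        have h3 := sqDist_nonneg I Z j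
        rw [hI.comm j z] at h2
        rw [max_eq_left (by linarith)]
        linarith
      -- A client pays for at most one centre. If it paid for `z` and `z'`, both opening times would
      -- be at least `α j`, while `d(z, z')² ≤ 2(d(z, j)² + d(z', j)²) < 4 α j`, against `sep`.
      · intro z' hz' hne
        refine max_eq_right ?_
        by_contra hlt'
        push Not at hlt'
        have hlt' : I.d z' j ^ 2 < α j := by linarith
        have b1 : α j ≤ R z := (le_max_iff.1 (h.bounded z hz j hj)).resolve_right (by linarith)
        have b2 : α j ≤ R z' := (le_max_iff.1 (h.bounded z' hz' j hj)).resolve_right (by linarith)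
        have t := hI.tri z j z' hj
        rw [hI.comm j z'] at t
        have t2 := pow_le_pow_left₀ (hI.nonneg z z') t 2
        have t3 : (I.d z j + I.d z' j) ^ 2 ≤ 2 * (I.d z j ^ 2 + I.d z' j ^ 2) := by
          nlinarith [sq_nonneg (I.d z j - I.d z' j)]
        rcases h.sep z hz z' hz' (Ne.symm hne) with s | s <;> linarith
      · exact fun hn => absurd hz hn
    · push Not at hz
      rw [Finset.sum_eq_zero fun z hz' => max_eq_right (by linarith [hz z hz'])]
      obtain ⟨z, hz, hc⟩ := h.cover j hj
      have := sqDist_le (I := I) hz j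
      linarith
  exact lb.trans ub

/-- Reverse greedy from one of two consecutive solutions of the Lagrangian relaxation, or the
first small solution, is within a constant factor. -/
theorem exists_good_multiplier {I : Input} (hI : I.IsMetric) {F T : Finset ℕ} {k J : ℕ} {f₀ : ℝ}
    {Z Y : ℕ → Finset ℕ} (hF : F ⊆ Finset.range I.n) (hT : T ⊆ F) (hTne : T.Nonempty)
    (hTk : T.card ≤ k) (hf₀ : 0 < f₀) (hf₀k : f₀ * k ≤ costOn I (Finset.range I.n) T)
    (hJ : costOn I (Finset.range I.n) T < f₀ * 2 ^ J)
    (hcert : ∀ j ≤ J, ∃ α R, DualCert I F (f₀ * 2 ^ j) (Z j) α R) (hZ : ∀ j ≤ J, (Z j).Nonempty)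
    (hY : ∀ j ≤ J, Greedy I (Finset.range I.n) (Z j) (Y j))
    (hYc : ∀ j ≤ J, (Y j).card = min (Z j).card k) :
    ∃ j ≤ J, costOn I (Finset.range I.n) (Y j) ≤
      1400 * costOn I (Finset.range I.n) T := by
  classical
  set X := Finset.range I.n with hX
  set O := costOn I X T with hO
  have hO0 : 0 ≤ O := costOn_nonneg hI X T
  have lmp : ∀ j ≤ J, f₀ * 2 ^ j * (Z j).card + costOn I X (Z j) / 9 ≤ O + f₀ * 2 ^ j * k := by
    intro j hj
    obtain ⟨α, R, h⟩ := hcert j hj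
    have h1 := h.lmp hI hT hTne
    have : f₀ * 2 ^ j * (T.card : ℝ) ≤ f₀ * 2 ^ j * k :=
      mul_le_mul_of_nonneg_left (by exact_mod_cast hTk) (by positivity)
    linarith
  have same : ∀ j ≤ J, (Z j).card ≤ k → Y j = Z j := fun j hj hk =>
    Finset.eq_of_subset_of_card_le (hY j hj).subset (by rw [hYc j hj, min_eq_left hk])
  -- At the largest multiplier the opening cost exceeds the cost of `T`, so even one centre beyond
  -- `k` violates the Lagrangian bound.
  have hex : ∃ j, j ≤ J ∧ (Z j).card ≤ k := by
    refine ⟨J, le_rfl, ?_⟩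
    by_contra hlt
    push Not at hlt
    have h1 := lmp J le_rfl
    have h2 : (k : ℝ) + 1 ≤ (Z J).card := by exact_mod_cast hlt
    have h3 := costOn_nonneg hI X (Z J)
    have h4 : f₀ * 2 ^ J * ((k : ℝ) + 1) ≤ f₀ * 2 ^ J * (Z J).card :=
      mul_le_mul_of_nonneg_left h2 (by positivity)
    nlinarith
  obtain ⟨hj, hjk⟩ := Nat.find_spec hex
  have hmin := fun i => Nat.find_min hex (m := i)
  set j := Nat.find hex with hjdef
  have hZ0 := costOn_nonneg hI X (Z j)
  -- If the smallest multiplier already gives few centres, the term `f₀ * k` is at most the cost of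
  -- `T`, so the Lagrangian bound suffices.
  rcases Nat.eq_zero_or_pos j with h0 | hpos
  · refine ⟨j, hj, ?_⟩
    rw [same j hj hjk]
    have h1 := lmp j hj
    rw [h0] at h1 hZ0 ⊢
    have : 0 ≤ f₀ * 2 ^ 0 * ((Z 0).card : ℝ) := by positivity
    simp only [pow_zero, mul_one] at *
    linarith
  obtain ⟨i, hi⟩ : ∃ i, j = i + 1 := ⟨j - 1, by omega⟩
  have hiJ : i ≤ J := by omega
  have hik : k < (Z i).card := by
    by_contra hle
    exact hmin i (by omega) ⟨hiJ, by omega⟩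
  have l1 := lmp i hiJ
  have l2 := lmp j hj
  set f := f₀ * 2 ^ i with hf
  have hf2 : f₀ * 2 ^ j = 2 * f := by rw [hi, pow_succ, hf]; ring
  rw [hf2] at l2
  have hfpos : 0 < f := by positivity
  have hN : (1 : ℝ) ≤ (Z i).card - k := by
    have : (k : ℝ) + 1 ≤ (Z i).card := by exact_mod_cast hik
    linarith
  have hK : (0 : ℝ) ≤ k - (Z j).card := by
    have : ((Z j).card : ℝ) ≤ k := by exact_mod_cast hjk
    linarith
  have hYi : ((Y i).card : ℝ) = k := by rw [hYc i hiJ, min_eq_right hik.le]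
  have hZi0 := costOn_nonneg hI X (Z i)
  set N : ℝ := (Z i).card - k with hNdef
  set K : ℝ := k - (Z j).card with hKdef
  have hfN : f * N + costOn I X (Z i) / 9 ≤ O := by rw [hNdef]; nlinarith
  have hcj : costOn I X (Z j) / 9 ≤ O + 2 * f * K := by rw [hKdef]; nlinarith
  have hfN0 : 0 ≤ f * N := by positivity
  -- If the deficit `K` is at most the excess `N`, the larger solution's bound `f N ≤ O` controls
  -- the term `2 f K` of the smaller one. Otherwise there are `N ≤ K` deletions, each with slack `K
  -- + 1` over `Z j`.
  rcases le_total K N with hKN | hKN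
  · refine ⟨j, hj, ?_⟩
    rw [same j hj hjk]
    have : f * K ≤ f * N := mul_le_mul_of_nonneg_left hKN hfpos.le
    nlinarith
  · refine ⟨i, hiJ, ?_⟩
    have hZjF : Z j ⊆ F := by
      obtain ⟨α, R, h⟩ := hcert j hj; exact h.subset
    have hg := (hY i hiJ).cost_le hI (T := Z j) (K := K + 1) (θ := 1) (by rw [hX])
      (hZjF.trans hF) (hZ j hj) (by linarith) one_pos (by rw [hYi, hKdef]; linarith)
    rw [hYi] at hg
    have hKp : 0 < K + 1 := by linarith
    have hr : N / (K + 1) ≤ 1 := by rw [div_le_one hKp]; linarith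
    have hexp : Real.exp (2 / (1 * (K + 1)) * N) ≤ 8 := by
      have h1 : 2 / (1 * (K + 1)) * N ≤ 2 := by
        have : 2 / (1 * (K + 1)) * N = 2 * (N / (K + 1)) := by ring
        linarith
      have h2 : Real.exp 2 = Real.exp 1 * Real.exp 1 := by rw [← Real.exp_add]; norm_num
      have h3 := Real.exp_one_lt_d9
      have h4 := Real.exp_pos 1
      have h5 := Real.exp_le_exp.2 h1
      nlinarith
    -- `cost(Z j) ≤ 9 O + 18 f K`, together with `N ≤ K` and `f N ≤ O`, gives `6 * (9 + 18) = 162`.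
    have hmain : N * ((2 * 1 + 4) / (K + 1) * costOn I X (Z j)) ≤ 162 * O := by
      have e : N * ((2 * 1 + 4) / (K + 1) * costOn I X (Z j)) =
          6 * (N * costOn I X (Z j)) / (K + 1) := by field_simp; ring
      rw [e, div_le_iff₀ hKp]
      have a1 : N * costOn I X (Z j) ≤ 9 * (N * O) + 18 * (f * N) * K := by nlinarith
      have a2 : f * N * K ≤ O * K := mul_le_mul_of_nonneg_right (by linarith) hK
      have a3 : N * O ≤ K * O := mul_le_mul_of_nonneg_right hKN hO0
      have a4 : 162 * O * (K + 1) = 162 * (K * O) + 162 * O := by ring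
      have a5 : O * K = K * O := mul_comm _ _
      linarith
    have hsum : 0 ≤ costOn I X (Z i) + N * ((2 * 1 + 4) / (K + 1) * costOn I X (Z j)) := by
      positivity
    -- `8 * (9 + 162) = 1368`.
    have := mul_le_mul_of_nonneg_right hexp hsum
    linarith

/-! ## Notation for programs -/

infixl:65 " +ʷ " => WExp.add
infixl:65 " -ʷ " => WExp.sub
infixl:70 " *ʷ " => WExp.mul
infixl:70 " /ʷ " => WExp.div
infixl:65 " +ʳ " => RExp.add
infixl:65 " -ʳ " => RExp.sub
infixl:70 " *ʳ " => RExp.mul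
infixl:70 " /ʳ " => RExp.div
infixr:58 " ;; " => Prog.seq
infix:60 " ≔ʷ " => Prog.setW
infix:60 " ≔ʳ " => Prog.setR

/-- The test `e < f`. -/
def Test.wlt (e f : WExp) : Test := .neg (.wle f e)

/-- The test `e < f` for reals. -/
def Test.rlt (e f : RExp) : Test := .neg (.rle f e)

/-- The test `e ≠ 0`. -/
def Test.pos (e : WExp) : Test := .neg (.wle e (.lit 0))

/-- Disjunction of tests. -/
def Test.disj (p q : Test) : Test := .neg (.conj (.neg p) (.neg q))

/-- `for x in [lo, hi) do p`. -/
def Prog.forIn (x : ℕ) (lo hi : WExp) (p : Prog) : Prog :=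
  (x ≔ʷ lo) ;; .loop (.wlt (.var x) hi) (p ;; (x ≔ʷ (.var x +ʷ .lit 1)))

/-! ## Reading a modified state -/

section State
variable (s : State) (x y a b i v : ℕ) (r : ℝ)

@[simp] theorem State.setW_wvar : (s.setW x v).wvar y = if y = x then v else s.wvar y := by
  simp [State.setW, Function.update_apply]
@[simp] theorem State.setW_warr : (s.setW x v).warr = s.warr := rfl
@[simp] theorem State.setW_rvar : (s.setW x v).rvar = s.rvar := rfl
@[simp] theorem State.setW_rarr : (s.setW x v).rarr = s.rarr := rfl
@[simp] theorem State.setWArr_wvar : (s.setWArr a i v).wvar = s.wvar := rfl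
@[simp] theorem State.setWArr_warr : (s.setWArr a i v).warr b =
    if b = a then Function.update (s.warr a) i v else s.warr b := by
  simp only [State.setWArr, Function.update_apply]
@[simp] theorem State.setWArr_rvar : (s.setWArr a i v).rvar = s.rvar := rfl
@[simp] theorem State.setWArr_rarr : (s.setWArr a i v).rarr = s.rarr := rfl
@[simp] theorem State.setR_wvar : (s.setR x r).wvar = s.wvar := rfl
@[simp] theorem State.setR_warr : (s.setR x r).warr = s.warr := rfl
@[simp] theorem State.setR_rvar : (s.setR x r).rvar y = if y = x then r else s.rvar y := by
  simp [State.setR, Function.update_apply]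
@[simp] theorem State.setR_rarr : (s.setR x r).rarr = s.rarr := rfl
@[simp] theorem State.setRArr_wvar : (s.setRArr a i r).wvar = s.wvar := rfl
@[simp] theorem State.setRArr_warr : (s.setRArr a i r).warr = s.warr := rfl
@[simp] theorem State.setRArr_rvar : (s.setRArr a i r).rvar = s.rvar := rfl
@[simp] theorem State.setRArr_rarr : (s.setRArr a i r).rarr b =
    if b = a then Function.update (s.rarr a) i r else s.rarr b := by
  simp only [State.setRArr, Function.update_apply]

end State

attribute [simp] WExp.eval RExp.eval WExp.time RExp.time Test.time

section Holds
variable {I : Input} {M : ℕ} {s : State}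

@[simp] theorem Test.holds_wle {e f : WExp} :
    (Test.wle e f).Holds I M s ↔ e.eval M s ≤ f.eval M s := Iff.rfl
@[simp] theorem Test.holds_rle {e f : RExp} :
    (Test.rle e f).Holds I M s ↔ e.eval I M s ≤ f.eval I M s := Iff.rfl
@[simp] theorem Test.holds_neg {p : Test} : (Test.neg p).Holds I M s ↔ ¬ p.Holds I M s := Iff.rfl
@[simp] theorem Test.holds_conj {p q : Test} :
    (Test.conj p q).Holds I M s ↔ p.Holds I M s ∧ q.Holds I M s := Iff.rfl
@[simp] theorem Test.holds_disj {p q : Test} :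
    (Test.disj p q).Holds I M s ↔ p.Holds I M s ∨ q.Holds I M s := by
  simp only [Test.disj, Test.holds_neg, Test.holds_conj]; tauto
@[simp] theorem Test.holds_wlt {e f : WExp} :
    (Test.wlt e f).Holds I M s ↔ e.eval M s < f.eval M s := by simp [Test.wlt]
@[simp] theorem Test.holds_rlt {e f : RExp} :
    (Test.rlt e f).Holds I M s ↔ e.eval I M s < f.eval I M s := by simp [Test.rlt]
@[simp] theorem Test.holds_pos {e : WExp} : (Test.pos e).Holds I M s ↔ e.eval M s ≠ 0 := by
  simp [Test.pos]
@[simp] theorem Test.time_wlt {e f : WExp} : (Test.wlt e f).time = f.time + e.time + 2 := rfl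
@[simp] theorem Test.time_rlt {e f : RExp} : (Test.rlt e f).time = f.time + e.time + 2 := rfl
@[simp] theorem Test.time_pos {e : WExp} : (Test.pos e).time = e.time + 3 := rfl
@[simp] theorem Test.time_disj {p q : Test} : (Test.disj p q).time = p.time + q.time + 4 := by
  simp [Test.disj, Test.time]; omega

end Holds

/-! ## The parts of the memory that a program writes -/

/-- The program may write the word variable `x`. -/
def Prog.writesW (x : ℕ) : Prog → Bool
  | .setW y _ => x == y
  | .seq p q => p.writesW x || q.writesW x
  | .branch _ p q => p.writesW x || q.writesW x
  | .loop _ p => p.writesW x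
  | _ => false

/-- The program may write the word array `x`. -/
def Prog.writesWA (x : ℕ) : Prog → Bool
  | .setWArr y _ _ => x == y
  | .seq p q => p.writesWA x || q.writesWA x
  | .branch _ p q => p.writesWA x || q.writesWA x
  | .loop _ p => p.writesWA x
  | _ => false

/-- The program may write the real variable `x`. -/
def Prog.writesR (x : ℕ) : Prog → Bool
  | .setR y _ => x == y
  | .seq p q => p.writesR x || q.writesR x
  | .branch _ p q => p.writesR x || q.writesR x
  | .loop _ p => p.writesR x
  | _ => false

/-- The program may write the real array `x`. -/
def Prog.writesRA (x : ℕ) : Prog → Bool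
  | .setRArr y _ _ => x == y
  | .seq p q => p.writesRA x || q.writesRA x
  | .branch _ p q => p.writesRA x || q.writesRA x
  | .loop _ p => p.writesRA x
  | _ => false

/-- The states `s` and `s'` agree outside the part of the memory that `p` may write. -/
structure Frame (p : Prog) (s s' : State) : Prop where
  wvar : ∀ x, p.writesW x = false → s'.wvar x = s.wvar x
  warr : ∀ x, p.writesWA x = false → s'.warr x = s.warr x
  rvar : ∀ x, p.writesR x = false → s'.rvar x = s.rvar x
  rarr : ∀ x, p.writesRA x = false → s'.rarr x = s.rarr x

theorem Frame.refl (p : Prog) (s : State) : Frame p s s :=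
  ⟨fun _ _ => rfl, fun _ _ => rfl, fun _ _ => rfl, fun _ _ => rfl⟩

theorem Frame.trans {p : Prog} {s₁ s₂ s₃ : State} (h : Frame p s₁ s₂) (h' : Frame p s₂ s₃) :
    Frame p s₁ s₃ :=
  ⟨fun x hx => (h'.wvar x hx).trans (h.wvar x hx), fun x hx => (h'.warr x hx).trans (h.warr x hx),
    fun x hx => (h'.rvar x hx).trans (h.rvar x hx), fun x hx => (h'.rarr x hx).trans (h.rarr x hx)⟩

/-- The program `p` writes no more than `q`. -/
structure Prog.Sub (p q : Prog) : Prop where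
  w : ∀ x, q.writesW x = false → p.writesW x = false
  wa : ∀ x, q.writesWA x = false → p.writesWA x = false
  r : ∀ x, q.writesR x = false → p.writesR x = false
  ra : ∀ x, q.writesRA x = false → p.writesRA x = false

theorem Frame.mono {p q : Prog} {s s' : State} (h : Frame p s s') (hpq : p.Sub q) :
    Frame q s s' :=
  ⟨fun x hx => h.wvar x (hpq.w x hx), fun x hx => h.warr x (hpq.wa x hx),
    fun x hx => h.rvar x (hpq.r x hx), fun x hx => h.rarr x (hpq.ra x hx)⟩

theorem Prog.sub_seq_left (p q : Prog) : p.Sub (p ;; q) := by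
  constructor <;> intro x hx <;>
    simp_all [Prog.writesW, Prog.writesWA, Prog.writesR, Prog.writesRA]

theorem Prog.sub_seq_right (p q : Prog) : q.Sub (p ;; q) := by
  constructor <;> intro x hx <;>
    simp_all [Prog.writesW, Prog.writesWA, Prog.writesR, Prog.writesRA]

theorem Prog.sub_branch_left (b : Test) (p q : Prog) : p.Sub (.branch b p q) := by
  constructor <;> intro x hx <;>
    simp_all [Prog.writesW, Prog.writesWA, Prog.writesR, Prog.writesRA]

theorem Prog.sub_branch_right (b : Test) (p q : Prog) : q.Sub (.branch b p q) := by
  constructor <;> intro x hx <;>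
    simp_all [Prog.writesW, Prog.writesWA, Prog.writesR, Prog.writesRA]

theorem Prog.sub_loop (b : Test) (p : Prog) : p.Sub (.loop b p) :=
  ⟨fun _ h => h, fun _ h => h, fun _ h => h, fun _ h => h⟩

theorem Prog.Sub.trans {p q r : Prog} (h : p.Sub q) (h' : q.Sub r) : p.Sub r :=
  ⟨fun x hx => h.w x (h'.w x hx), fun x hx => h.wa x (h'.wa x hx),
    fun x hx => h.r x (h'.r x hx), fun x hx => h.ra x (h'.ra x hx)⟩

/-- This lets every specification omit the memory its program does not touch. The `writes` functions
are Boolean, so for concrete programs the side conditions hold by `rfl`. -/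
theorem Run.frame {I : Input} {M : ℕ} {p : Prog} {s s' : State} {t : ℕ} (h : Run I M p s s' t) :
    Frame p s s' := by
  induction h with
  | skip s => exact Frame.refl _ _
  | setW x e s =>
    refine ⟨fun y hy => ?_, fun _ _ => rfl, fun _ _ => rfl, fun _ _ => rfl⟩
    have : y ≠ x := by simpa [Prog.writesW] using hy
    simp [this]
  | setWArr a i e s =>
    refine ⟨fun _ _ => rfl, fun y hy => ?_, fun _ _ => rfl, fun _ _ => rfl⟩
    have : y ≠ a := by simpa [Prog.writesWA] using hy
    simp [this]
  | setR x e s =>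
    refine ⟨fun _ _ => rfl, fun _ _ => rfl, fun y hy => ?_, fun _ _ => rfl⟩
    have : y ≠ x := by simpa [Prog.writesR] using hy
    simp [this]
  | setRArr a i e s =>
    refine ⟨fun _ _ => rfl, fun _ _ => rfl, fun _ _ => rfl, fun y hy => ?_⟩
    have : y ≠ a := by simpa [Prog.writesRA] using hy
    simp [this]
  | @seq p q _ _ _ _ _ _ _ ih₁ ih₂ =>
    exact (ih₁.mono (Prog.sub_seq_left p q)).trans (ih₂.mono (Prog.sub_seq_right p q))
  | @branch_true b p q _ _ _ _ _ ih => exact ih.mono (Prog.sub_branch_left b p q)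
  | @branch_false b p q _ _ _ _ _ ih => exact ih.mono (Prog.sub_branch_right b p q)
  | loop_done => exact Frame.refl _ _
  | @loop_step b p _ _ _ _ _ _ _ _ ih₁ ih₂ => exact (ih₁.mono (Prog.sub_loop b p)).trans ih₂

/-! ## Weakest preconditions -/

/-- Started in `s`, the program `p` halts in a state `s'` after time `t` with `Q s' t`. -/
def WP (I : Input) (M : ℕ) (p : Prog) (Q : State → ℕ → Prop) (s : State) : Prop :=
  ∃ s' t, Run I M p s s' t ∧ Q s' t

section WP
variable {I : Input} {M : ℕ} {Q : State → ℕ → Prop} {s : State}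

theorem WP.mono {p : Prog} {Q' : State → ℕ → Prop} (h : WP I M p Q s)
    (hQ : ∀ s' t, Q s' t → Q' s' t) : WP I M p Q' s := by
  obtain ⟨s', t, hr, hq⟩ := h
  exact ⟨s', t, hr, hQ s' t hq⟩

/-- A program leaves alone what it does not write. -/
theorem WP.call {p : Prog} {Q' : State → ℕ → Prop} (h : WP I M p Q s)
    (hQ : ∀ s' t, Frame p s s' → Q s' t → Q' s' t) : WP I M p Q' s := by
  obtain ⟨s', t, hr, hq⟩ := h
  exact ⟨s', t, hr, hQ s' t hr.frame hq⟩

@[simp] theorem wp_skip : WP I M .skip Q s ↔ Q s 1 :=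
  ⟨fun ⟨_, _, hr, hq⟩ => by cases hr; exact hq, fun h => ⟨_, _, .skip s, h⟩⟩

@[simp] theorem wp_setW {x : ℕ} {e : WExp} :
    WP I M (x ≔ʷ e) Q s ↔ Q (s.setW x (e.eval M s)) (e.time + 1) :=
  ⟨fun ⟨_, _, hr, hq⟩ => by cases hr; exact hq, fun h => ⟨_, _, .setW x e s, h⟩⟩

@[simp] theorem wp_setWArr {a : ℕ} {i e : WExp} : WP I M (.setWArr a i e) Q s ↔
    Q (s.setWArr a (i.eval M s) (e.eval M s)) (i.time + e.time + 1) :=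
  ⟨fun ⟨_, _, hr, hq⟩ => by cases hr; exact hq, fun h => ⟨_, _, .setWArr a i e s, h⟩⟩

@[simp] theorem wp_setR {x : ℕ} {e : RExp} :
    WP I M (x ≔ʳ e) Q s ↔ Q (s.setR x (e.eval I M s)) (e.time + 1) :=
  ⟨fun ⟨_, _, hr, hq⟩ => by cases hr; exact hq, fun h => ⟨_, _, .setR x e s, h⟩⟩

@[simp] theorem wp_setRArr {a : ℕ} {i : WExp} {e : RExp} : WP I M (.setRArr a i e) Q s ↔
    Q (s.setRArr a (i.eval M s) (e.eval I M s)) (i.time + e.time + 1) :=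
  ⟨fun ⟨_, _, hr, hq⟩ => by cases hr; exact hq, fun h => ⟨_, _, .setRArr a i e s, h⟩⟩

@[simp] theorem wp_seq {p q : Prog} : WP I M (p ;; q) Q s ↔
    WP I M p (fun s₁ t₁ => WP I M q (fun s₂ t₂ => Q s₂ (t₁ + t₂)) s₁) s := by
  constructor
  · rintro ⟨_, _, hr, hq⟩
    cases hr with
    | seq h₁ h₂ => exact ⟨_, _, h₁, _, _, h₂, hq⟩
  · rintro ⟨_, _, h₁, _, _, h₂, hq⟩
    exact ⟨_, _, .seq h₁ h₂, hq⟩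

theorem wp_branch {b : Test} {p q : Prog}
    (h₁ : b.Holds I M s → WP I M p (fun s' t => Q s' (b.time + 1 + t)) s)
    (h₂ : ¬ b.Holds I M s → WP I M q (fun s' t => Q s' (b.time + 1 + t)) s) :
    WP I M (.branch b p q) Q s := by
  by_cases hb : b.Holds I M s
  · obtain ⟨s', t, hr, hq⟩ := h₁ hb
    exact ⟨s', _, .branch_true hb hr, hq⟩
  · obtain ⟨s', t, hr, hq⟩ := h₂ hb
    exact ⟨s', _, .branch_false hb hr, hq⟩

/-- Loops, with an invariant that sees the time spent so far and a measure that decreases. -/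
theorem wp_loop {b : Test} {p : Prog} (Inv : State → ℕ → Prop) (μ : State → ℕ)
    (h₀ : Inv s 0)
    (hstep : ∀ s₁ t, Frame p s s₁ → Inv s₁ t → b.Holds I M s₁ →
      WP I M p (fun s' t' => Inv s' (t + (b.time + 1) + t') ∧ μ s' < μ s₁) s₁)
    (hend : ∀ s₁ t, Frame p s s₁ → Inv s₁ t → ¬ b.Holds I M s₁ → Q s₁ (t + (b.time + 1))) :
    WP I M (.loop b p) Q s := by
  have main : ∀ m s₁ t, μ s₁ = m → Frame p s s₁ → Inv s₁ t →
      WP I M (.loop b p) (fun s' t' => Q s' (t + t')) s₁ := by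
    intro m
    induction m using Nat.strong_induction_on with
    | _ m ih =>
      intro s₁ t hm hf hI
      by_cases hb : b.Holds I M s₁
      · obtain ⟨s₂, t₂, hr, hI₂, hμ⟩ := hstep s₁ t hf hI hb
        obtain ⟨s₃, t₃, hr₃, hq⟩ := ih (μ s₂) (by omega) s₂ _ rfl (hf.trans hr.frame) hI₂
        refine ⟨s₃, _, .loop_step hb hr hr₃, ?_⟩
        have e : t + (b.time + 1 + t₂ + t₃) = t + (b.time + 1) + t₂ + t₃ := by ring
        show Q s₃ (t + (b.time + 1 + t₂ + t₃))
        rw [e]; exact hq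
      · exact ⟨s₁, _, .loop_done hb, hend s₁ t hf hI hb⟩
  obtain ⟨s', t', hr, hq⟩ := main (μ s) s 0 rfl (Frame.refl _ _) h₀
  exact ⟨s', t', hr, by simpa using hq⟩

/-- Loops over an interval, with an invariant that sees the time spent so far. -/
theorem wp_for {x : ℕ} {lo hi : WExp} {p : Prog} (a b : ℕ) (Inv : ℕ → State → ℕ → Prop)
    (ha : lo.eval M s = a) (hab : a ≤ b) (hM : b < M)
    (hhi : ∀ i s₁ t, Frame (.forIn x lo hi p) s s₁ → Inv i s₁ t →
      hi.eval M s₁ = b)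
    (h₀ : Inv a (s.setW x a) (lo.time + 1))
    (hstep : ∀ i s₁ t, Frame (.forIn x lo hi p) s s₁ → a ≤ i → i < b →
      s₁.wvar x = i → Inv i s₁ t →
      WP I M p (fun s' t' => s'.wvar x = i ∧
        Inv (i + 1) (s'.setW x (i + 1)) (t + t' + (hi.time + 8))) s₁)
    (hend : ∀ s₁ t, Frame (.forIn x lo hi p) s s₁ → s₁.wvar x = b → Inv b s₁ t →
      Q s₁ (t + (hi.time + 4))) :
    WP I M (.forIn x lo hi p) Q s := by
  rw [Prog.forIn, wp_seq, wp_setW, ha]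
  have fr0 : Frame (.forIn x lo hi p) s (s.setW x a) := by
    refine ⟨fun y hy => ?_, fun _ _ => rfl, fun _ _ => rfl, fun _ _ => rfl⟩
    have : y ≠ x := by
      simp only [Prog.forIn, Prog.writesW, Bool.or_eq_false_iff] at hy
      simpa using hy.1
    simp [this]
  refine wp_loop (fun s₁ t => ∃ i, a ≤ i ∧ i ≤ b ∧ s₁.wvar x = i ∧ Inv i s₁ (t + (lo.time + 1)))
    (fun s₁ => b - s₁.wvar x) ⟨a, le_rfl, hab, by simp, by simpa using h₀⟩ ?_ ?_
  · rintro s₁ t hf ⟨i, hai, hib, hx, hI⟩ hb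
    have hf := fr0.trans (hf.mono ((Prog.sub_loop (.wlt (.var x) hi) _).trans
      (Prog.sub_seq_right (x ≔ʷ lo) _)))
    have hlt : i < b := by simpa [hx, hhi i s₁ _ hf hI] using hb
    rw [wp_seq]
    refine (hstep i s₁ _ hf hai hlt hx hI).mono ?_
    rintro s' t' ⟨hx', hI'⟩
    have hM1 : 1 % M = 1 := Nat.mod_eq_of_lt (by omega)
    have hM2 : (i + 1) % M = i + 1 := Nat.mod_eq_of_lt (by omega)
    -- The test with its branch costs `hi.time + 4` and the increment `4`, which is the `hi.time +
    -- 8` per round.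
    simp only [wp_setW, WExp.eval, hx', hM1, hM2, WExp.time]
    refine ⟨⟨i + 1, by omega, by omega, by simp, ?_⟩, ?_⟩
    · convert hI' using 1
      simp; ring
    · simp [hx]; omega
  · rintro s₁ t hf ⟨i, hai, hib, hx, hI⟩ hb
    have hf := fr0.trans (hf.mono ((Prog.sub_loop (.wlt (.var x) hi) _).trans
      (Prog.sub_seq_right (x ≔ʷ lo) _)))
    have hge : b ≤ i := by simpa [hx, hhi i s₁ _ hf hI] using hb
    obtain rfl : i = b := by omega
    have := hend s₁ _ hf hx hI
    convert this using 1
    simp; ring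

/-- Loops over an interval whose body has bounded cost. -/
theorem wp_for_le {x : ℕ} {lo hi : WExp} {p : Prog} (a b c : ℕ) (Inv : ℕ → State → Prop)
    (ha : lo.eval M s = a) (hab : a ≤ b) (hM : b < M)
    (hhi : ∀ i s₁, Frame (.forIn x lo hi p) s s₁ → Inv i s₁ → hi.eval M s₁ = b)
    (h₀ : Inv a (s.setW x a))
    (hstep : ∀ i s₁, Frame (.forIn x lo hi p) s s₁ → a ≤ i → i < b →
      s₁.wvar x = i → Inv i s₁ →
      WP I M p (fun s' t' => t' ≤ c ∧ s'.wvar x = i ∧ Inv (i + 1) (s'.setW x (i + 1))) s₁)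
    (hend : ∀ s₁ t, Frame (.forIn x lo hi p) s s₁ → s₁.wvar x = b → Inv b s₁ →
      t ≤ (b - a) * (c + hi.time + 8) + lo.time + hi.time + 5 → Q s₁ t) :
    WP I M (.forIn x lo hi p) Q s := by
  refine wp_for a b
    (fun i s₁ t => Inv i s₁ ∧ t ≤ (i - a) * (c + hi.time + 8) + lo.time + 1) ha hab hM
    (fun i s₁ t hf h => hhi i s₁ hf h.1) ⟨h₀, by simp⟩ ?_ ?_
  · rintro i s₁ t hf hai hib hx ⟨hI, ht⟩
    refine (hstep i s₁ hf hai hib hx hI).mono ?_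
    rintro s' t' ⟨h1, h2, h3⟩
    refine ⟨h2, h3, ?_⟩
    have : (i + 1 - a) * (c + hi.time + 8) = (i - a) * (c + hi.time + 8) + (c + hi.time + 8) := by
      rw [show i + 1 - a = (i - a) + 1 by omega]; ring
    omega
  · rintro s₁ t hf hx ⟨hI, ht⟩
    exact hend s₁ _ hf hx hI (by omega)

end WP
/-! ## Tournament trees

The rows of word array `1` hold tournament trees. Row `ρ` starts at index `ρ * (2 * n)`. A tree with
`q` leaves has the inner nodes `1, …, q - 1` and the leaves `q, …, 2 * q - 1`; the children of `v`
are `2 * v` and `2 * v + 1`. The leaf `q + j` holds `j + 1` if `j` is live and `0` otherwise, and an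
inner node holds the better of its children, where `j + 1` stands for the point `el j`, and points
nearer to the reference point `x` are better. -/

/-- The entry `a` of a tournament tree is at least as good as the entry `b`. -/
def Beats (I : Input) (el : ℕ → ℕ) (x a b : ℕ) : Prop :=
  b = 0 ∨ (a ≠ 0 ∧ I.d x (el (a - 1)) ≤ I.d x (el (b - 1)))

theorem Beats.refl (I : Input) (el : ℕ → ℕ) (x a : ℕ) : Beats I el x a a := by
  by_cases h : a = 0
  · exact Or.inl h
  · exact Or.inr ⟨h, le_rfl⟩

theorem Beats.trans {I : Input} {el : ℕ → ℕ} {x a b c : ℕ} (h : Beats I el x a b)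
    (h' : Beats I el x b c) : Beats I el x a c := by
  rcases h' with h' | ⟨hb, h'⟩
  · exact Or.inl h'
  · rcases h with h | ⟨ha, h⟩
    · exact absurd h hb
    · exact Or.inr ⟨ha, h.trans h'⟩

/-- The entry `c` is the better of `a` and `b`. -/
def Wins (I : Input) (el : ℕ → ℕ) (x c a b : ℕ) : Prop :=
  (c = a ∨ c = b) ∧ Beats I el x c a ∧ Beats I el x c b

/-- `T` is a tournament tree with `q` leaves for the reference point `x`. -/
structure IsTree (I : Input) (el T : ℕ → ℕ) (x q : ℕ) (live : Finset ℕ) : Prop where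
  leaf : ∀ j < q, T (q + j) = if j ∈ live then j + 1 else 0
  win : ∀ v, 1 ≤ v → v < q → Wins I el x (T v) (T (2 * v)) (T (2 * v + 1))

/-- Climb from `v` to its parent `v / 2`, which beats both of its children. -/
theorem IsTree.root_beats {I : Input} {el T : ℕ → ℕ} {x q : ℕ} {live : Finset ℕ}
    (h : IsTree I el T x q live) (v : ℕ) (hv : 1 ≤ v) (hvq : v < 2 * q) :
    Beats I el x (T 1) (T v) := by
  induction v using Nat.strong_induction_on with
  | _ v ih =>
    rcases Nat.eq_or_lt_of_le hv with rfl | h1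
    · exact Beats.refl _ _ _ _
    · have hw := (h.win (v / 2) (by omega) (by omega)).2
      refine (ih (v / 2) (by omega) (by omega) (by omega)).trans ?_
      rcases Nat.mod_two_eq_zero_or_one v with hm | hm
      · have e : 2 * (v / 2) = v := by omega
        rw [e] at hw; exact hw.1
      · have e : 2 * (v / 2) + 1 = v := by omega
        rw [e] at hw; exact hw.2

/-- Descend to the child that supplied the entry. The index grows at every descent, and `m` bounds
how far it can still grow. -/
theorem IsTree.exists_leaf {I : Input} {el T : ℕ → ℕ} {x q : ℕ} {live : Finset ℕ}
    (h : IsTree I el T x q live) (m v : ℕ) (hm : 2 * q ≤ v + m) (hv : 1 ≤ v) (hvq : v < 2 * q) :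
    ∃ j < q, T v = T (q + j) := by
  induction m generalizing v with
  | zero => omega
  | succ m ih =>
    by_cases hlt : q ≤ v
    · exact ⟨v - q, by omega, by rw [show q + (v - q) = v by omega]⟩
    · rcases (h.win v hv (by omega)).1 with e | e <;> rw [e] <;>
        exact ih _ (by omega) (by omega) (by omega)

theorem IsTree.root_eq_zero {I : Input} {el T : ℕ → ℕ} {x q : ℕ} {live : Finset ℕ}
    (h : IsTree I el T x q live) (h0 : T 1 = 0) (j : ℕ) (hj : j < q) : j ∉ live := by
  intro hl
  rcases h.root_beats (q + j) (by omega) (by omega) with hb | hb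
  · rw [h.leaf j hj, if_pos hl] at hb; omega
  · exact hb.1 h0

theorem IsTree.root {I : Input} {el T : ℕ → ℕ} {x q : ℕ} {live : Finset ℕ}
    (h : IsTree I el T x q live) (hq : 1 ≤ q) (h0 : T 1 ≠ 0) :
    T 1 - 1 < q ∧ T 1 - 1 ∈ live ∧
      ∀ j < q, j ∈ live → I.d x (el (T 1 - 1)) ≤ I.d x (el j) := by
  obtain ⟨i, hi, e⟩ := h.exists_leaf (2 * q) 1 (by omega) le_rfl (by omega)
  rw [h.leaf i hi] at e
  split_ifs at e with hl
  · refine ⟨by omega, by rw [e]; simpa using hl, fun j hj hjl => ?_⟩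
    rcases h.root_beats (q + j) (by omega) (by omega) with hb | hb
    · rw [h.leaf j hj, if_pos hjl] at hb; omega
    · have := hb.2
      rw [h.leaf j hj, if_pos hjl] at this
      simpa using this
  · exact absurd e h0

/-- Row `ρ` of the table of tournament trees. -/
def row (I : Input) (s : State) (ρ v : ℕ) : ℕ := s.warr 1 (ρ * (2 * I.n) + v)

@[simp] theorem row_setW (I : Input) (s : State) (x v : ℕ) : row I (s.setW x v) = row I s := rfl

@[simp] theorem row_setR (I : Input) (s : State) (x : ℕ) (r : ℝ) :
    row I (s.setR x r) = row I s := rfl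

@[simp] theorem row_setRArr (I : Input) (s : State) (a i : ℕ) (r : ℝ) :
    row I (s.setRArr a i r) = row I s := rfl

theorem row_frame (I : Input) {s s' : State} (h : s'.warr 1 = s.warr 1) : row I s' = row I s := by
  funext ρ v
  rw [row, row, h]

theorem row_set_self (I : Input) (s : State) (ρ v c : ℕ) :
    row I (s.setWArr 1 (ρ * (2 * I.n) + v) c) ρ = Function.update (row I s ρ) v c := by
  funext u
  by_cases h : u = v
  · subst h; simp [row]
  · simp [row, h]

theorem row_set_ne (I : Input) (s : State) {ρ ρ' v v' : ℕ} (c : ℕ) (h : ρ' ≠ ρ)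
    (hv : v < 2 * I.n) (hv' : v' < 2 * I.n) :
    row I (s.setWArr 1 (ρ * (2 * I.n) + v) c) ρ' v' = row I s ρ' v' := by
  have : ρ' * (2 * I.n) + v' ≠ ρ * (2 * I.n) + v := by
    intro e
    apply h
    -- Division by the row length recovers the row from an index.
    have h1 : (ρ' * (2 * I.n) + v') / (2 * I.n) = ρ' := by
      rw [Nat.add_comm, Nat.add_mul_div_right _ _ (by omega), Nat.div_eq_of_lt hv', Nat.zero_add]
    have h2 : (ρ * (2 * I.n) + v) / (2 * I.n) = ρ := by
      rw [Nat.add_comm, Nat.add_mul_div_right _ _ (by omega), Nat.div_eq_of_lt hv, Nat.zero_add]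
    rw [← h1, e, h2]
  simp [row, this]

/-- The states `s` and `s'` agree on all rows but `ρ`. -/
def SameRows (I : Input) (ρ : ℕ) (s s' : State) : Prop :=
  ∀ ρ', ρ' ≠ ρ → ∀ v < 2 * I.n, row I s' ρ' v = row I s ρ' v

/-- The number of levels of a tournament tree with at most `n` leaves. -/
def levels (n : ℕ) : ℕ := Nat.log 2 (2 * n) + 1

theorem levels_pos (n : ℕ) : 1 ≤ levels n := by simp [levels]

/-- The index of the first node of row `ρ`, and the next few words, do not overflow. -/
theorem row_lt {n M ρ v : ℕ} (hM : 1000 * (n + 2) ^ 6 ≤ M) (hρ : ρ < n) (hv : v < 2 * n) :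
    ρ * (2 * n) + v < M := by
  have h1 : ρ * (2 * n) + v < n * (2 * n) := by
    have : (ρ + 1) * (2 * n) ≤ n * (2 * n) := Nat.mul_le_mul_right _ hρ
    nlinarith
  have h2 : n * (2 * n) ≤ 1000 * (n + 2) ^ 6 := by
    have : (n + 2) ^ 2 ≤ (n + 2) ^ 6 := Nat.pow_le_pow_right (by omega) (by omega)
    nlinarith
  omega

/-- Discards the reductions modulo `M` for counters and indices of linear size. -/
theorem small_lt {n M a : ℕ} (hM : 1000 * (n + 2) ^ 6 ≤ M) (ha : a ≤ 1000 * (n + 1)) : a < M := by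
  have : (n + 2) ^ 1 ≤ (n + 2) ^ 6 := Nat.pow_le_pow_right (by omega) (by omega)
  rw [pow_one] at this
  omega

/-- Recompute the inner node of word variable `6`. -/
def treeFix : Prog :=
  .branch (.disj (.wle (.get 1 (.var 2 +ʷ (.var 6 +ʷ .var 6 +ʷ .lit 1))) (.lit 0))
      (.conj (.pos (.get 1 (.var 2 +ʷ (.var 6 +ʷ .var 6))))
        (.rle (.dist (.var 3) (.get 2 (.get 1 (.var 2 +ʷ (.var 6 +ʷ .var 6)) -ʷ .lit 1)))
          (.dist (.var 3) (.get 2 (.get 1 (.var 2 +ʷ (.var 6 +ʷ .var 6 +ʷ .lit 1)) -ʷ .lit 1))))))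
    (.setWArr 1 (.var 2 +ʷ .var 6) (.get 1 (.var 2 +ʷ (.var 6 +ʷ .var 6))))
    (.setWArr 1 (.var 2 +ʷ .var 6) (.get 1 (.var 2 +ʷ (.var 6 +ʷ .var 6 +ʷ .lit 1))))

/-- Store `val` in the leaf of word variable `4`. Word variables `2`, `3`, `5` hold the start of the
row, the reference point and the number of leaves. -/
def treeSet (val : WExp) : Prog :=
  .setWArr 1 (.var 2 +ʷ (.var 5 +ʷ .var 4)) val ;;
  6 ≔ʷ (.var 5 +ʷ .var 4) /ʷ .lit 2 ;;
  .loop (.wle (.lit 1) (.var 6)) (treeFix ;; 6 ≔ʷ .var 6 /ʷ .lit 2)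

/-- The tree for `x` with the leaves `0, …, q - 1` is the one the tree programs work on. -/
structure TreeAt (I : Input) (s : State) (ρ x q : ℕ) : Prop where
  base : s.wvar 2 = ρ * (2 * I.n)
  ref : s.wvar 3 = x
  leaves : s.wvar 5 = q
  row_lt : ρ < I.n
  le : q ≤ I.n

theorem TreeAt.frame {I : Input} {s s' : State} {ρ x q : ℕ} (h : TreeAt I s ρ x q)
    (h2 : s'.wvar 2 = s.wvar 2) (h3 : s'.wvar 3 = s.wvar 3) (h5 : s'.wvar 5 = s.wvar 5) :
    TreeAt I s' ρ x q :=
  ⟨h2.trans h.base, h3.trans h.ref, h5.trans h.leaves, h.row_lt, h.le⟩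

/-- An entry `0` stands for an empty subtree. The distances are then read at a meaningless index,
because of the truncated subtraction, but the tests for `0` decide the outcome. -/
theorem treeFix_spec {I : Input} {M : ℕ} (hM : 1000 * (I.n + 2) ^ 6 ≤ M) {s : State} {ρ x q p : ℕ}
    (h : TreeAt I s ρ x q) (h6 : s.wvar 6 = p) (hp : 1 ≤ p) (hpq : p < q) :
    WP I M treeFix (fun s' t => t ≤ 70 ∧
      ∃ c, Wins I (s.warr 2) x c (row I s ρ (2 * p)) (row I s ρ (2 * p + 1)) ∧
        s' = s.setWArr 1 (ρ * (2 * I.n) + p) c) s := by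
  have hq := h.le
  have h2 := h.base
  have h3 := h.ref
  have e0 : 0 % M = 0 := Nat.zero_mod M
  have e1 : 1 % M = 1 := Nat.mod_eq_of_lt (small_lt hM (by omega))
  have ep : (p + p) % M = 2 * p := by
    rw [Nat.mod_eq_of_lt (small_lt hM (by omega))]; ring
  have ep1 : (2 * p + 1) % M = 2 * p + 1 := Nat.mod_eq_of_lt (small_lt hM (by omega))
  have eb : (ρ * (2 * I.n) + p) % M = ρ * (2 * I.n) + p :=
    Nat.mod_eq_of_lt (KMeans.row_lt hM h.row_lt (by omega))
  have ea : (ρ * (2 * I.n) + 2 * p) % M = ρ * (2 * I.n) + 2 * p :=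
    Nat.mod_eq_of_lt (KMeans.row_lt hM h.row_lt (by omega))
  have ec : (ρ * (2 * I.n) + (2 * p + 1)) % M = ρ * (2 * I.n) + (2 * p + 1) :=
    Nat.mod_eq_of_lt (KMeans.row_lt hM h.row_lt (by omega))
  refine wp_branch ?_ ?_
  · intro hb
    simp only [Test.holds_disj, Test.holds_conj, Test.holds_wle, Test.holds_rle, Test.holds_pos,
      WExp.eval, RExp.eval, h2, h3, h6, e0, e1, ep, ep1, ea, ec] at hb
    simp only [wp_setWArr, WExp.eval, h2, h6, ep, ea, eb, WExp.time, RExp.time, Test.time,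
      Test.time_disj, Test.time_pos]
    refine ⟨by norm_num, _, ⟨Or.inl rfl, Beats.refl _ _ _ _, ?_⟩, rfl⟩
    rcases hb with hb | hb
    · exact Or.inl (Nat.le_zero.1 hb)
    · exact Or.inr hb
  · intro hb
    simp only [Test.holds_disj, Test.holds_conj, Test.holds_wle, Test.holds_rle, Test.holds_pos,
      WExp.eval, RExp.eval, h2, h3, h6, e0, e1, ep, ep1, ea, ec, not_or, not_and, not_le] at hb
    simp only [wp_setWArr, WExp.eval, h2, h6, ep, e1, ep1, ec, eb, WExp.time, RExp.time, Test.time,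
      Test.time_disj, Test.time_pos]
    refine ⟨by norm_num, _, ⟨Or.inr rfl, ?_, Beats.refl _ _ _ _⟩, rfl⟩
    by_cases h0 : row I s ρ (2 * p) = 0
    · exact Or.inl h0
    · exact Or.inr ⟨by have := hb.1; simp only [row]; omega, (hb.2 h0).le⟩

/-- Changing a leaf can spoil `win` only at its ancestors. On the walk to the root, the current node
is the only one that may be wrong. -/
theorem treeSet_spec {I : Input} {M : ℕ} (hM : 1000 * (I.n + 2) ^ 6 ≤ M) {s : State}
    {ρ x q j : ℕ} {val : WExp} {live live' : Finset ℕ} (h : TreeAt I s ρ x q)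
    (h4 : s.wvar 4 = j) (hj : j < q) (htree : IsTree I (s.warr 2) (row I s ρ) x q live)
    (hval : val.eval M s = if j ∈ live' then j + 1 else 0)
    (hlive : ∀ i, i ≠ j → (i ∈ live' ↔ i ∈ live)) :
    WP I M (treeSet val) (fun s' t => t ≤ val.time + 100 * levels I.n ∧
      IsTree I (s.warr 2) (row I s' ρ) x q live' ∧ SameRows I ρ s s') s := by
  have hq := h.le
  have h2 := h.base
  have h3 := h.ref
  have h5 := h.leaves
  have e1 : 1 % M = 1 := Nat.mod_eq_of_lt (small_lt hM (by omega))
  have e2 : 2 % M = 2 := Nat.mod_eq_of_lt (small_lt hM (by omega))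
  have ej : (q + j) % M = q + j := Nat.mod_eq_of_lt (small_lt hM (by omega))
  have el : (ρ * (2 * I.n) + (q + j)) % M = ρ * (2 * I.n) + (q + j) :=
    Nat.mod_eq_of_lt (KMeans.row_lt hM h.row_lt (by omega))
  rw [treeSet, wp_seq, wp_setWArr, wp_seq, wp_setW]
  simp only [WExp.eval, State.setWArr_wvar, h2, h4, h5, e2, ej, el, hval, WExp.time]
  set c₀ := if j ∈ live' then j + 1 else 0 with hc₀
  set s₁ := (s.setWArr 1 (ρ * (2 * I.n) + (q + j)) c₀).setW 6 ((q + j) / 2) with hs₁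
  have hrow₁ : row I s₁ ρ = Function.update (row I s ρ) (q + j) c₀ := row_set_self I s ρ (q + j) c₀
  have h1 : TreeAt I s₁ ρ x q := h.frame (by simp [hs₁]) (by simp [hs₁]) (by simp [hs₁])
  -- After `m` halvings the current node `p` satisfies `p * 2 ^ m ≤ 2 n`, so the number of rounds is
  -- at most `levels n`.
  refine wp_loop (fun s₂ t => ∃ m p, s₂.wvar 6 = p ∧ p < q ∧ p * 2 ^ m ≤ 2 * I.n ∧
      m ≤ levels I.n ∧ t ≤ m * 80 ∧ SameRows I ρ s s₂ ∧
      (∀ i < q, row I s₂ ρ (q + i) = if i ∈ live' then i + 1 else 0) ∧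
      ∀ v, 1 ≤ v → v < q → v ≠ p →
        Wins I (s.warr 2) x (row I s₂ ρ v) (row I s₂ ρ (2 * v)) (row I s₂ ρ (2 * v + 1)))
    (fun s₂ => s₂.wvar 6) ?_ ?_ ?_
  · refine ⟨0, (q + j) / 2, by simp [hs₁], by omega, by omega, by omega, by omega, ?_, ?_, ?_⟩
    · intro ρ' hρ' v hv
      exact row_set_ne I s c₀ hρ' (by omega) hv
    · intro i hi
      rw [hrow₁, Function.update_apply]
      by_cases hij : i = j
      · subst hij; simp [hc₀]
      · rw [if_neg (by omega), htree.leaf i hi]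
        simp only [hlive i hij]
    · intro v hv hvq hvp
      rw [hrow₁, Function.update_of_ne (by omega), Function.update_of_ne (by omega),
        Function.update_of_ne (by omega)]
      exact htree.win v hv hvq
  · rintro s₂ t hf ⟨m, p, h6, hpq, hpm, hm, ht, hrows, hleaf, hwin⟩ hb
    have hp : 1 ≤ p := by simpa [h6, e1] using hb
    have h2' : TreeAt I s₂ ρ x q := h1.frame (hf.wvar 2 rfl) (hf.wvar 3 rfl) (hf.wvar 5 rfl)
    have harr : s₂.warr 2 = s.warr 2 := by
      rw [hf.warr 2 rfl]; simp [hs₁]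
    rw [wp_seq]
    refine (treeFix_spec hM h2' h6 hp hpq).mono ?_
    rintro s₃ t₃ ⟨ht₃, c, hc, rfl⟩
    rw [harr] at hc
    have hrow₃ := row_set_self I s₂ ρ p c
    simp only [wp_setW, WExp.eval, WExp.time, State.setWArr_wvar, e2, Test.time]
    have hpow : 2 ^ m ≤ 2 * I.n := le_trans (by nlinarith [Nat.one_le_two_pow (n := m)]) hpm
    have hml : m ≤ Nat.log 2 (2 * I.n) := Nat.le_log_of_pow_le (by omega) hpow
    refine ⟨⟨m + 1, p / 2, by simp [h6], by omega, ?_, by rw [levels]; omega, by omega, ?_, ?_, ?_⟩,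
      by simp [h6]; omega⟩
    · calc p / 2 * 2 ^ (m + 1) = (p / 2 * 2) * 2 ^ m := by ring
        _ ≤ p * 2 ^ m := Nat.mul_le_mul_right _ (Nat.div_mul_le_self p 2)
        _ ≤ _ := hpm
    · intro ρ' hρ' v hv
      exact (row_set_ne I s₂ c hρ' (by omega) hv).trans (hrows ρ' hρ' v hv)
    · intro i hi
      change row I (s₂.setWArr 1 (ρ * (2 * I.n) + p) c) ρ (q + i) = _
      rw [hrow₃, Function.update_of_ne (by omega)]
      exact hleaf i hi
    · intro v hv hvq hvp
      change Wins I (s.warr 2) x (row I (s₂.setWArr 1 (ρ * (2 * I.n) + p) c) ρ v)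
        (row I (s₂.setWArr 1 (ρ * (2 * I.n) + p) c) ρ (2 * v))
        (row I (s₂.setWArr 1 (ρ * (2 * I.n) + p) c) ρ (2 * v + 1))
      rw [hrow₃]
      by_cases hvp' : v = p
      · subst hvp'
        rw [Function.update_self, Function.update_of_ne (by omega),
          Function.update_of_ne (by omega)]
        exact hc
      · rw [Function.update_of_ne hvp', Function.update_of_ne (by omega),
          Function.update_of_ne (by omega)]
        exact hwin v hv hvq hvp'
  · rintro s₂ t hf ⟨m, p, h6, hpq, hpm, hm, ht, hrows, hleaf, hwin⟩ hb
    -- The walk has left the root for `0`, which is not a node, so no exception remains.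
    have hp : p = 0 := by simpa [h6, e1] using hb
    refine ⟨?_, ⟨hleaf, fun v hv hvq => hwin v hv hvq (by omega)⟩, hrows⟩
    have := levels_pos I.n
    simp only [Test.time, WExp.time]
    omega

/-- Build the tree whose live leaves are the values of word variable `4` that pass the test. -/
def treeBuild (b : Test) : Prog :=
  .forIn 7 (.lit 0) (.var 5 +ʷ .var 5) (.setWArr 1 (.var 2 +ʷ .var 7) (.lit 0)) ;;
  .forIn 4 (.lit 0) (.var 5) (.branch b (treeSet (.var 4 +ʷ .lit 1)) .skip)

/-- A row of zeros is a tree without live leaves, so the live leaves can be inserted one after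
another, for a logarithm each. The hypothesis on `b` asks that its truth depend only on memory that
the construction leaves alone. -/
theorem treeBuild_spec {I : Input} {M : ℕ} (hM : 1000 * (I.n + 2) ^ 6 ≤ M) {s : State}
    {ρ x q : ℕ} {b : Test} {live : Finset ℕ} (h : TreeAt I s ρ x q) (hb20 : b.time ≤ 20)
    (hb : ∀ s' j, Frame (treeBuild b) s s' → s'.wvar 4 = j → j < q →
      (b.Holds I M s' ↔ j ∈ live)) :
    WP I M (treeBuild b) (fun s' t => t ≤ 200 * (q + 1) * levels I.n ∧
      IsTree I (s.warr 2) (row I s' ρ) x q live ∧ SameRows I ρ s s') s := by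
  have hq := h.le
  have h2 := h.base
  have h5 := h.leaves
  have hl := levels_pos I.n
  have e0 : 0 % M = 0 := Nat.zero_mod M
  have e1 : 1 % M = 1 := Nat.mod_eq_of_lt (small_lt hM (by omega))
  have eq2 : (q + q) % M = 2 * q := by
    rw [Nat.mod_eq_of_lt (small_lt hM (by omega))]; ring
  rw [treeBuild, wp_seq]
  refine wp_for_le 0 (2 * q) 5
    (fun i s₁ => (∀ v < i, row I s₁ ρ v = 0) ∧ SameRows I ρ s s₁)
    (by simp) (by omega) (small_lt hM (by omega)) ?_ ⟨by simp, fun _ _ _ _ => rfl⟩ ?_ ?_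
  · intro i s₁ hf _
    simp only [WExp.eval, hf.wvar 5 rfl, h5, eq2]
  · rintro i s₁ hf - hi hx ⟨hz, hr⟩
    have e : (ρ * (2 * I.n) + i) % M = ρ * (2 * I.n) + i :=
      Nat.mod_eq_of_lt (KMeans.row_lt hM h.row_lt (by omega))
    simp only [wp_setWArr, WExp.eval, WExp.time, hf.wvar 2 rfl, h2, hx, e, e0]
    refine ⟨le_rfl, hx, ?_, ?_⟩
    · intro v hv
      change row I (s₁.setWArr 1 (ρ * (2 * I.n) + i) 0) ρ v = 0
      rw [row_set_self, Function.update_apply]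
      split_ifs with hvi
      · rfl
      · exact hz v (by omega)
    · intro ρ' hρ' v hv
      exact (row_set_ne I s₁ 0 hρ' (by omega) hv).trans (hr ρ' hρ' v hv)
  · rintro s₁ t₁ hf - ⟨hz, hr⟩ ht₁
    have hs₁ : TreeAt I s₁ ρ x q := h.frame (hf.wvar 2 rfl) (hf.wvar 3 rfl) (hf.wvar 5 rfl)
    have fr1 : Frame (treeBuild b) s s₁ := hf.mono (Prog.sub_seq_left _ _)
    refine wp_for_le 0 q (30 + 100 * levels I.n)
      (fun i s₂ => IsTree I (s.warr 2) (row I s₂ ρ) x q (live.filter (· < i)) ∧ SameRows I ρ s s₂)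
      (by simp) (by omega) (small_lt hM (by omega)) ?_ ?_ ?_ ?_
    · intro i s₂ hf₂ _
      simp only [WExp.eval, hf₂.wvar 5 rfl, hs₁.leaves]
    · refine ⟨⟨fun j hj => ?_, fun v hv hvq => ?_⟩, hr⟩
      · have := hz (q + j) (by omega)
        simpa using this
      · have z1 := hz v (by omega)
        have z2 := hz (2 * v) (by omega)
        have z3 := hz (2 * v + 1) (by omega)
        refine ⟨Or.inl (z1.trans z2.symm), Or.inl z2, Or.inl z3⟩
    · rintro i s₂ hf₂ - hi hx ⟨ht, hr₂⟩
      have hs₂ : TreeAt I s₂ ρ x q := hs₁.frame (hf₂.wvar 2 rfl) (hf₂.wvar 3 rfl) (hf₂.wvar 5 rfl)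
      have fr2 : Frame (treeBuild b) s s₂ := fr1.trans (hf₂.mono (Prog.sub_seq_right _ _))
      have hel : s₂.warr 2 = s.warr 2 := (hf₂.warr 2 rfl).trans (hf.warr 2 rfl)
      have hbi := hb s₂ i fr2 hx hi
      have ei : (i + 1) % M = i + 1 := Nat.mod_eq_of_lt (small_lt hM (by omega))
      refine wp_branch (fun hh => ?_) (fun hh => ?_)
      · have hil := hbi.1 hh
        refine (treeSet_spec (live' := live.filter (· < i + 1)) hM hs₂ hx hi (hel ▸ ht) ?_ ?_).call ?_
        · simp [WExp.eval, hx, e1, ei, hil]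
        · intro j hj
          simp only [Finset.mem_filter]
          constructor
          · rintro ⟨a, c⟩; exact ⟨a, by omega⟩
          · rintro ⟨a, c⟩; exact ⟨a, by omega⟩
        · rintro s₃ t₃ hf₃ ⟨ht₃, htree, hrows⟩
          simp only [WExp.time] at ht₃
          refine ⟨by omega, (hf₃.wvar 4 rfl).trans hx, ?_, ?_⟩
          · rw [hel] at htree; exact htree
          · intro ρ' hρ' v hv
            exact (hrows ρ' hρ' v hv).trans (hr₂ ρ' hρ' v hv)
      · have hil := fun h => hh (hbi.2 h)
        rw [wp_skip]
        refine ⟨by omega, hx, ?_, hr₂⟩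
        have : live.filter (· < i + 1) = live.filter (· < i) := by
          ext j
          simp only [Finset.mem_filter, and_congr_right_iff]
          intro hj
          constructor
          · intro c
            rcases Nat.lt_succ_iff_lt_or_eq.1 c with c | c
            · exact c
            · exact absurd (c ▸ hj) hil
          · intro c; omega
        rw [this]; exact ht
    · rintro s₂ t₂ hf₂ - ⟨ht, hr₂⟩ ht₂
      simp only [WExp.time] at ht₁ ht₂
      refine ⟨?_, ⟨fun j hj => ?_, ht.win⟩, hr₂⟩
      · have : 200 * (q + 1) * levels I.n = q * (100 * levels I.n) + 100 * q * levels I.n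
            + 200 * levels I.n := by ring
        have h3 : 100 * q * 1 ≤ 100 * q * levels I.n := Nat.mul_le_mul_left _ hl
        simp only [Nat.sub_zero] at ht₁ ht₂
        have e3 : q * (30 + 100 * levels I.n + 1 + 8) = q * (100 * levels I.n) + 39 * q := by ring
        omega
      · rw [ht.leaf j hj]
        simp [hj]

/-! ## Reverse greedy as a program -/

theorem IsTree.congr {I : Input} {el T T' : ℕ → ℕ} {x q : ℕ} {live : Finset ℕ}
    (h : IsTree I el T x q live) (hT : ∀ v < 2 * q, T' v = T v) : IsTree I el T' x q live := by
  refine ⟨fun j hj => by rw [hT _ (by omega), h.leaf j hj], fun v hv hvq => ?_⟩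
  rw [hT _ (by omega), hT _ (by omega), hT _ (by omega)]
  exact h.win v hv hvq

theorem treeSet_erase {I : Input} {M : ℕ} (hM : 1000 * (I.n + 2) ^ 6 ≤ M) {s : State}
    {ρ x q j : ℕ} {live : Finset ℕ} (h : TreeAt I s ρ x q)
    (h4 : s.wvar 4 = j) (hj : j < q) (htree : IsTree I (s.warr 2) (row I s ρ) x q live) :
    WP I M (treeSet (.lit 0)) (fun s' t => t ≤ 101 * levels I.n ∧
      IsTree I (s.warr 2) (row I s' ρ) x q (live.erase j) ∧ SameRows I ρ s s') s := by
  refine (treeSet_spec (live' := live.erase j) hM h h4 hj htree (by simp [WExp.eval])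
    (by simp +contextual)).mono ?_
  rintro s' t ⟨ht, h1, h2⟩
  have := levels_pos I.n
  simp only [WExp.time] at ht
  exact ⟨by omega, h1, h2⟩

theorem treeSet_insert {I : Input} {M : ℕ} (hM : 1000 * (I.n + 2) ^ 6 ≤ M) {s : State}
    {ρ x q j : ℕ} {live : Finset ℕ} (h : TreeAt I s ρ x q)
    (h4 : s.wvar 4 = j) (hj : j < q) (htree : IsTree I (s.warr 2) (row I s ρ) x q live) :
    WP I M (treeSet (.var 4 +ʷ .lit 1)) (fun s' t => t ≤ 103 * levels I.n ∧
      IsTree I (s.warr 2) (row I s' ρ) x q (insert j live) ∧ SameRows I ρ s s') s := by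
  have hq := h.le
  have e1 : 1 % M = 1 := Nat.mod_eq_of_lt (small_lt hM (by omega))
  have ei : (j + 1) % M = j + 1 := Nat.mod_eq_of_lt (small_lt hM (by omega))
  refine (treeSet_spec (live' := insert j live) hM h h4 hj htree
    (by simp [WExp.eval, h4, e1, ei]) (by simp +contextual)).mono ?_
  rintro s' t ⟨ht, h1, h2⟩
  have := levels_pos I.n
  simp only [WExp.time] at ht
  exact ⟨by omega, h1, h2⟩

/-- The flagged points in an interval. -/
def centers (s : State) (lo hi : ℕ) : Finset ℕ := {y ∈ Finset.Ico lo hi | s.warr 3 y ≠ 0}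

theorem mem_centers {s : State} {lo hi y : ℕ} :
    y ∈ centers s lo hi ↔ (lo ≤ y ∧ y < hi) ∧ s.warr 3 y ≠ 0 := by
  simp [centers]

/-- Turn to the row and the reference point of word variable `13`. -/
def turn : Prog := 2 ≔ʷ .var 13 *ʷ (.var 0 +ʷ .var 0) ;; 3 ≔ʷ .var 13

theorem turn_spec {I : Input} {M : ℕ} (hM : 1000 * (I.n + 2) ^ 6 ≤ M) {s : State} {x : ℕ}
    (h0 : s.wvar 0 = I.n) (h13 : s.wvar 13 = x) (hx : x < I.n) {Q : State → ℕ → Prop}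
    (hQ : Q ((s.setW 2 (x * (2 * I.n))).setW 3 x) 8) : WP I M turn Q s := by
  have e1 : (I.n + I.n) % M = 2 * I.n := by
    rw [Nat.mod_eq_of_lt (small_lt hM (by omega))]; ring
  have e2 : x * (2 * I.n) % M = x * (2 * I.n) :=
    Nat.mod_eq_of_lt (row_lt (v := 0) hM hx (by omega))
  simpa [turn, WExp.eval, WExp.time, h0, h13, e1, e2] using hQ

/-- Collect the flagged points of the interval in word array `2`. -/
def collect : Prog :=
  11 ≔ʷ .lit 0 ;;
  .forIn 13 (.var 8) (.var 9) (.branch (.pos (.get 3 (.var 13)))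
    (.setWArr 2 (.var 11) (.var 13) ;; 11 ≔ʷ .var 11 +ʷ .lit 1) .skip)

/-- Add the increase of the cost of the point of word variable `13` to the score of its nearest
centre. -/
def score : Prog :=
  turn ;;
  16 ≔ʷ .get 1 (.var 2 +ʷ .lit 1) -ʷ .lit 1 ;;
  4 ≔ʷ .var 16 ;;
  -- With the nearest centre deleted, the root is the second nearest one. The deleted leaf is
  -- restored afterwards.
  treeSet (.lit 0) ;;
  15 ≔ʷ .get 1 (.var 2 +ʷ .lit 1) -ʷ .lit 1 ;;
  treeSet (.var 4 +ʷ .lit 1) ;;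
  .setRArr 0 (.var 16) (.get 0 (.var 16) +ʳ .weight (.var 13) *ʳ
    (.dist (.var 13) (.get 2 (.var 15)) *ʳ .dist (.var 13) (.get 2 (.var 15)) -ʳ
      .dist (.var 13) (.get 2 (.var 16)) *ʳ .dist (.var 13) (.get 2 (.var 16))))

/-- Remove the centre whose removal is cheapest. -/
def greedyStep : Prog :=
  .forIn 14 (.lit 0) (.var 11) (.setRArr 0 (.var 14) (.lit 0)) ;;
  .forIn 13 (.var 8) (.var 9) score ;;
  -- The number of leaves is not the index of a leaf; it marks that no live centre has been seen
  -- yet.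
  15 ≔ʷ .var 11 ;;
  .forIn 14 (.lit 0) (.var 11) (.branch (.conj (.pos (.get 3 (.get 2 (.var 14))))
      (.disj (.wle (.var 11) (.var 15)) (.rlt (.get 0 (.var 14)) (.get 0 (.var 15)))))
    (15 ≔ʷ .var 14) .skip) ;;
  .setWArr 3 (.get 2 (.var 15)) (.lit 0) ;;
  12 ≔ʷ .var 12 -ʷ .lit 1 ;;
  .forIn 13 (.var 8) (.var 9) (turn ;; 4 ≔ʷ .var 15 ;; treeSet (.lit 0))

/-- Reverse greedy on the interval given by the word variables `8` and `9`, down to the number of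
centres in word variable `10`. -/
def greedy : Prog :=
  collect ;;
  5 ≔ʷ .var 11 ;;
  -- The test always holds, so every leaf is live.
  .forIn 13 (.var 8) (.var 9) (turn ;; treeBuild (.wle (.lit 0) (.lit 0))) ;;
  12 ≔ʷ .var 11 ;;
  .loop (.wlt (.var 10) (.var 12)) greedyStep

theorem collect_spec {I : Input} {M : ℕ} (hM : 1000 * (I.n + 2) ^ 6 ≤ M) {s : State} {lo hi : ℕ}
    (h8 : s.wvar 8 = lo) (h9 : s.wvar 9 = hi) (hlo : lo ≤ hi) (hhi : hi ≤ I.n) :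
    WP I M collect (fun s' t => t ≤ 40 * (hi - lo + 1) ∧
      s'.wvar 11 = (centers s lo hi).card ∧
      Set.InjOn (s'.warr 2) (Finset.range (centers s lo hi).card) ∧
      (Finset.range (centers s lo hi).card).image (s'.warr 2) = centers s lo hi) s := by
  have e1 : 1 % M = 1 := Nat.mod_eq_of_lt (small_lt hM (by omega))
  rw [collect, wp_seq, wp_setW]
  refine wp_for_le lo hi 20 (fun i s₁ => s₁.wvar 11 = (centers s lo i).card ∧
      Set.InjOn (s₁.warr 2) (Finset.range (centers s lo i).card) ∧
      (Finset.range (centers s lo i).card).image (s₁.warr 2) = centers s lo i)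
    (by simp [WExp.eval, h8]) hlo (small_lt hM (by omega)) ?_ ?_ ?_ ?_
  · intro i s₁ hf _
    simp [WExp.eval, hf.wvar 9 rfl, h9]
  · have : centers s lo lo = ∅ := by simp [centers]
    simp [this, WExp.eval]
  · rintro i s₁ hf hai hib hx ⟨h11, hinj, him⟩
    have hcard : (centers s lo i).card ≤ i - lo := by
      refine (Finset.card_filter_le _ _).trans (by simp)
    have hcen : s₁.warr 3 = s.warr 3 := by rw [hf.warr 3 rfl]; rfl
    have hni : i ∉ centers s lo i := by simp [centers]
    refine wp_branch (fun hb => ?_) (fun hb => ?_)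
    · have hc : s.warr 3 i ≠ 0 := by simpa [WExp.eval, hx, hcen] using hb
      have hS : centers s lo (i + 1) = insert i (centers s lo i) := by
        ext y
        rw [Finset.mem_insert, mem_centers, mem_centers]
        constructor
        · rintro ⟨h1, h2⟩
          by_cases hy : y = i
          · exact Or.inl hy
          · exact Or.inr ⟨by omega, h2⟩
        · rintro (rfl | ⟨h1, h2⟩)
          · exact ⟨by omega, hc⟩
          · exact ⟨by omega, h2⟩
      have hS' : (centers s lo (i + 1)).card = (centers s lo i).card + 1 := by
        rw [hS, Finset.card_insert_of_notMem hni]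
      have em : ((centers s lo i).card + 1) % M = (centers s lo i).card + 1 :=
        Nat.mod_eq_of_lt (small_lt hM (by omega))
      simp only [wp_seq, wp_setWArr, wp_setW, WExp.eval, WExp.time, State.setWArr_wvar, h11, hx, e1,
        em, Test.time_pos]
      set c := (centers s lo i).card
      have hup : ∀ j < c, Function.update (s₁.warr 2) c i j = s₁.warr 2 j := fun j hj =>
        Function.update_of_ne (by omega) _ _
      refine ⟨by omega, by simp [hx], by simp [hS'], ?_, ?_⟩
      · rw [hS']
        intro a ha b hb hab
        simp only [State.setW_warr, State.setWArr_warr, if_true] at hab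
        rw [Finset.mem_coe, Finset.mem_range] at ha hb
        have hne : ∀ j < c, s₁.warr 2 j ≠ i := fun j hj e => hni (by
          rw [← him, ← e]; exact Finset.mem_image_of_mem _ (Finset.mem_range.2 hj))
        rcases Nat.lt_succ_iff_lt_or_eq.1 ha with ha | ha <;>
          rcases Nat.lt_succ_iff_lt_or_eq.1 hb with hb | hb
        · rw [hup a ha, hup b hb] at hab
          exact hinj (by simpa using ha) (by simpa using hb) hab
        · subst hb
          rw [hup a ha, Function.update_self] at hab
          exact absurd hab (hne a ha)
        · subst ha
          rw [hup b hb, Function.update_self] at hab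
          exact absurd hab.symm (hne b hb)
        · omega
      · rw [hS', Finset.range_add_one, Finset.image_insert, hS]
        simp only [State.setW_warr, State.setWArr_warr, if_true, Function.update_self]
        congr 1
        rw [← him]
        exact Finset.image_congr fun j hj => hup j (by simpa using hj)
    · have hc : s.warr 3 i = 0 := by simpa [WExp.eval, hx, hcen] using hb
      have hS : centers s lo (i + 1) = centers s lo i := by
        ext y
        rw [mem_centers, mem_centers]
        constructor
        · rintro ⟨h1, h2⟩
          have : y ≠ i := fun h => h2 (h ▸ hc)
          exact ⟨by omega, h2⟩
        · rintro ⟨h1, h2⟩; exact ⟨by omega, h2⟩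
      rw [wp_skip]
      simp only [Test.time_pos, WExp.time, hS]
      exact ⟨by omega, hx, h11, hinj, him⟩
  · rintro s₁ t hf - h ht
    refine ⟨?_, h⟩
    simp only [WExp.time] at ht ⊢
    omega

/-- The state during reverse greedy, when the live centres are `el j` for `j` in `L`. -/
structure GreedyState (I : Input) (lo hi m : ℕ) (el : ℕ → ℕ) (L : Finset ℕ) (s : State) :
    Prop where
  w0 : s.wvar 0 = I.n
  w8 : s.wvar 8 = lo
  w9 : s.wvar 9 = hi
  w11 : s.wvar 11 = m
  w5 : s.wvar 5 = m
  lo_le : lo ≤ hi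
  hi_le : hi ≤ I.n
  m_le : m ≤ hi - lo
  wa2 : s.warr 2 = el
  inj : Set.InjOn el (Finset.range m)
  mem : ∀ j < m, lo ≤ el j ∧ el j < hi
  sub : L ⊆ Finset.range m
  flag : ∀ j < m, (s.warr 3 (el j) ≠ 0 ↔ j ∈ L)
  surj : ∀ y, lo ≤ y → y < hi → s.warr 3 y ≠ 0 → ∃ j < m, el j = y
  tree : ∀ x, lo ≤ x → x < hi → IsTree I el (row I s x) x m L

theorem GreedyState.centers_eq {I : Input} {lo hi m : ℕ} {el : ℕ → ℕ} {L : Finset ℕ} {s : State}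
    (h : GreedyState I lo hi m el L s) : centers s lo hi = L.image el := by
  ext y
  rw [mem_centers, Finset.mem_image]
  constructor
  · rintro ⟨⟨h1, h2⟩, h3⟩
    obtain ⟨j, hj, rfl⟩ := h.surj y h1 h2 h3
    exact ⟨j, (h.flag j hj).1 h3, rfl⟩
  · rintro ⟨j, hj, rfl⟩
    have hjm := Finset.mem_range.1 (h.sub hj)
    exact ⟨h.mem j hjm, (h.flag j hjm).2 hj⟩

theorem GreedyState.image_erase {I : Input} {lo hi m : ℕ} {el : ℕ → ℕ} {L : Finset ℕ} {s : State}
    (h : GreedyState I lo hi m el L s) {j : ℕ} (hj : j < m) :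
    (L.erase j).image el = (L.image el).erase (el j) := by
  ext y
  simp only [Finset.mem_image, Finset.mem_erase]
  constructor
  · rintro ⟨i, ⟨h1, h2⟩, rfl⟩
    refine ⟨fun e => h1 (h.inj (h.sub h2) (by simpa using hj) e), i, h2, rfl⟩
  · rintro ⟨h1, i, h2, rfl⟩
    exact ⟨i, ⟨fun e => h1 (e ▸ rfl), h2⟩, rfl⟩

theorem GreedyState.card_image {I : Input} {lo hi m : ℕ} {el : ℕ → ℕ} {L : Finset ℕ} {s : State}
    (h : GreedyState I lo hi m el L s) : (L.image el).card = L.card :=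
  Finset.card_image_of_injOn (h.inj.mono (by exact_mod_cast h.sub))

theorem IsTree.root_sqDist {I : Input} (hI : I.IsMetric) {el T : ℕ → ℕ} {x q : ℕ}
    {live : Finset ℕ} (h : IsTree I el T x q live) (hl : live ⊆ Finset.range q)
    (hne : live.Nonempty) : 1 ≤ T 1 ∧ T 1 - 1 < q ∧ T 1 - 1 ∈ live ∧
      sqDist I (live.image el) x = I.d x (el (T 1 - 1)) ^ 2 := by
  obtain ⟨j, hj⟩ := hne
  have hjq := Finset.mem_range.1 (hl hj)
  have h0 : T 1 ≠ 0 := fun h0 => h.root_eq_zero h0 j hjq hj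
  obtain ⟨h1, h2, h3⟩ := h.root (by omega) h0
  refine ⟨by omega, h1, h2, sqDist_eq (Finset.mem_image_of_mem el h2) fun z hz => ?_⟩
  obtain ⟨i, hi, rfl⟩ := Finset.mem_image.1 hz
  exact pow_le_pow_left₀ (hI.nonneg _ _) (h3 i (Finset.mem_range.1 (hl hi)) hi) 2

/-- Deleting a centre changes the cost of `x` only if it is the centre at the root of the tree of
`x`, so one updated score accounts for all of `L`. Two live centres are needed for a second nearest
one to exist. -/
theorem score_spec {I : Input} {M : ℕ} (hI : I.IsMetric) (hM : 1000 * (I.n + 2) ^ 6 ≤ M) {s : State}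
    {x q : ℕ} {L : Finset ℕ} (h0 : s.wvar 0 = I.n) (h13 : s.wvar 13 = x) (h5 : s.wvar 5 = q)
    (hx : x < I.n) (hq : q ≤ I.n) (hL : L ⊆ Finset.range q) (hL2 : 2 ≤ L.card)
    (hinj : Set.InjOn (s.warr 2) (Finset.range q))
    (htree : IsTree I (s.warr 2) (row I s x) x q L) :
    WP I M score (fun s' t => t ≤ 300 * levels I.n ∧ IsTree I (s.warr 2) (row I s' x) x q L ∧
      SameRows I x s s' ∧ ∀ j ∈ L, s'.rarr 0 j = s.rarr 0 j + I.w x *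
        (sqDist I ((L.image (s.warr 2)).erase (s.warr 2 j)) x -
          sqDist I (L.image (s.warr 2)) x)) s := by
  have e1 : 1 % M = 1 := Nat.mod_eq_of_lt (small_lt hM (by omega))
  have er : (x * (2 * I.n) + 1) % M = x * (2 * I.n) + 1 :=
    Nat.mod_eq_of_lt (row_lt hM hx (by omega))
  obtain ⟨hT1, hTq, hTL, hTd⟩ := htree.root_sqDist hI hL (Finset.card_pos.1 (by omega))
  set j₁ := row I s x 1 - 1 with hj₁
  rw [score, wp_seq]
  refine turn_spec hM h0 h13 hx ?_
  rw [wp_seq, wp_setW, wp_seq, wp_setW]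
  simp only [WExp.eval, State.setW_wvar, State.setW_warr, WExp.time, e1]
  norm_num only [if_true, if_false]
  simp only [er]
  change WP I M _ _ ((((s.setW 2 (x * (2 * I.n))).setW 3 x).setW 16 j₁).setW 4 j₁)
  set s₁ := (((s.setW 2 (x * (2 * I.n))).setW 3 x).setW 16 j₁).setW 4 j₁ with hs₁
  have hat : TreeAt I s₁ x x q :=
    ⟨by simp [hs₁], by simp [hs₁], by simp [hs₁, h5], hx, hq⟩
  rw [wp_seq]
  refine (treeSet_erase hM hat (j := j₁) (by simp [hs₁]) hTq (by simpa [hs₁] using htree)).call ?_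
  rintro s₂ t₂ hf₂ ⟨ht₂, htree₂, hrows₂⟩
  have hel₂ : s₂.warr 2 = s.warr 2 := hf₂.warr 2 rfl
  have hel₁ : s₁.warr 2 = s.warr 2 := rfl
  rw [hel₁] at htree₂
  have hLe : L.erase j₁ ⊆ Finset.range q := (Finset.erase_subset _ _).trans hL
  obtain ⟨hT1', hTq', hTL', hTd'⟩ := htree₂.root_sqDist hI hLe (by
    rw [← Finset.card_pos, Finset.card_erase_of_mem hTL]; omega)
  set j₂ := row I s₂ x 1 - 1 with hj₂
  have hb₂ : s₂.wvar 2 = x * (2 * I.n) := (hf₂.wvar 2 rfl).trans hat.base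
  rw [wp_seq, wp_setW]
  simp only [WExp.eval, WExp.time, e1, hb₂, er]
  rw [show s₂.warr 1 (x * (2 * I.n) + 1) - 1 = j₂ from rfl]
  have hat₃ : TreeAt I (s₂.setW 15 j₂) x x q :=
    hat.frame (hf₂.wvar 2 rfl) (hf₂.wvar 3 rfl) (hf₂.wvar 5 rfl)
  have h4₂ : s₂.wvar 4 = j₁ := hf₂.wvar 4 rfl
  have h16₂ : s₂.wvar 16 = j₁ := hf₂.wvar 16 rfl
  have h13₂ : s₂.wvar 13 = x := (hf₂.wvar 13 rfl).trans (by simp [hs₁, h13])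
  rw [wp_seq]
  refine (treeSet_insert hM hat₃ (j := j₁) (by simp [h4₂]) hTq
    (by simpa [hel₂] using htree₂)).call ?_
  rintro s₄ t₄ hf₄ ⟨ht₄, htree₄, hrows₄⟩
  have hel₄ : s₄.warr 2 = s.warr 2 := (hf₄.warr 2 rfl).trans hel₂
  have h16₄ : s₄.wvar 16 = j₁ := (hf₄.wvar 16 rfl).trans (by simp [h16₂])
  have h15₄ : s₄.wvar 15 = j₂ := (hf₄.wvar 15 rfl).trans (by simp)
  have h13₄ : s₄.wvar 13 = x := (hf₄.wvar 13 rfl).trans (by simp [h13₂])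
  have hr₄ : s₄.rarr 0 = s.rarr 0 := (hf₄.rarr 0 rfl).trans (hf₂.rarr 0 rfl)
  rw [wp_setRArr]
  simp only [WExp.eval, RExp.eval, WExp.time, RExp.time, h16₄, h15₄, h13₄, hel₄, hr₄]
  have hl := levels_pos I.n
  have er₁ : row I s₁ = row I s := rfl
  have himg : (L.erase j₁).image (s.warr 2) = (L.image (s.warr 2)).erase (s.warr 2 j₁) := by
    ext y
    simp only [Finset.mem_image, Finset.mem_erase]
    constructor
    · rintro ⟨i, ⟨h1, h2⟩, rfl⟩
      exact ⟨fun e => h1 (hinj (hL h2) (by simpa using hTq) e), i, h2, rfl⟩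
    · rintro ⟨h1, i, h2, rfl⟩
      exact ⟨i, ⟨fun e => h1 (e ▸ rfl), h2⟩, rfl⟩
  refine ⟨by omega, ?_, ?_, ?_⟩
  · rw [row_setRArr]
    have : (s₂.setW 15 j₂).warr 2 = s.warr 2 := hel₂
    rw [this, Finset.insert_erase hTL] at htree₄
    exact htree₄
  · intro ρ' hρ' v hv
    rw [row_setRArr, hrows₄ ρ' hρ' v hv, row_setW, hrows₂ ρ' hρ' v hv, er₁]
  · intro j hj
    by_cases hjj : j = j₁
    · subst hjj
      rw [← himg, hTd', hTd]
      simp only [State.setRArr_rarr, if_true, Function.update_self]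
      ring
    · simp only [State.setRArr_rarr, if_true, Function.update_of_ne hjj, hr₄]
      have : sqDist I ((L.image (s.warr 2)).erase (s.warr 2 j)) x =
          sqDist I (L.image (s.warr 2)) x := by
        rw [hTd]
        refine sqDist_eq (Finset.mem_erase.2 ⟨fun e => hjj ?_, Finset.mem_image_of_mem _ hTL⟩) ?_
        · exact (hinj (by simpa using hTq) (hL hj) e).symm
        · intro z hz
          rw [← hTd]
          exact sqDist_le (Finset.mem_of_mem_erase hz) x
      rw [this]; ring

/-- The scores are the exact increases of the cost, so the minimal score marks a greedy choice. Each
client needs a constant number of tree operations, which makes a deletion near-linear in the length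
of the interval. -/
theorem greedyStep_spec {I : Input} {M : ℕ} (hI : I.IsMetric) (hM : 1000 * (I.n + 2) ^ 6 ≤ M)
    {s : State} {lo hi m : ℕ} {el : ℕ → ℕ} {L : Finset ℕ} (h : GreedyState I lo hi m el L s)
    (hL2 : 2 ≤ L.card) :
    WP I M greedyStep (fun s' t => t ≤ 1000 * (hi - lo + 1) * levels I.n ∧
      (∃ b ∈ L, GreedyState I lo hi m el (L.erase b) s' ∧
        ∀ j ∈ L, costOn I (Finset.Ico lo hi) ((L.image el).erase (el b)) ≤
          costOn I (Finset.Ico lo hi) ((L.image el).erase (el j))) ∧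
      s'.wvar 12 = s.wvar 12 - 1 ∧
      ∀ y, ¬ (lo ≤ y ∧ y < hi) → s'.warr 3 y = s.warr 3 y) s := by
  have hl := levels_pos I.n
  have hm := h.m_le
  have hhi := h.hi_le
  have hlo := h.lo_le
  have e0 : 0 % M = 0 := Nat.zero_mod M
  have e1 : 1 % M = 1 := Nat.mod_eq_of_lt (small_lt hM (by omega))
  have hLm : L.card ≤ m := by simpa using Finset.card_le_card h.sub
  set X := Finset.Ico lo hi with hX
  set S := L.image el with hS
  rw [greedyStep, wp_seq]
  -- clear the scores
  refine wp_for_le 0 m 3 (fun i s₁ => ∀ j < i, s₁.rarr 0 j = 0)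
    (by simp [WExp.eval]) (by omega) (small_lt hM (by omega)) ?_ (by simp) ?_ ?_
  · intro i s₁ hf _
    simp only [WExp.eval, hf.wvar 11 rfl, h.w11]
  · intro i s₁ hf _ hi hx hz
    simp only [wp_setRArr, WExp.eval, RExp.eval, WExp.time, RExp.time, hx]
    refine ⟨by norm_num, hx, fun j hj => ?_⟩
    simp only [State.setW_rarr, State.setRArr_rarr, if_true, Function.update_apply]
    split_ifs with hji
    · simp
    · exact hz j (by omega)
  rintro s₁ t₁ hf₁ - hz ht₁
  have tree₁ : ∀ x, lo ≤ x → x < hi → IsTree I el (row I s₁ x) x m L := fun x h1 h2 => by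
    rw [row_frame I (hf₁.warr 1 rfl)]; exact h.tree x h1 h2
  have hel₁ : s₁.warr 2 = el := (hf₁.warr 2 rfl).trans h.wa2
  have w0₁ := (hf₁.wvar 0 rfl).trans h.w0
  have w8₁ := (hf₁.wvar 8 rfl).trans h.w8
  have w9₁ := (hf₁.wvar 9 rfl).trans h.w9
  have w11₁ := (hf₁.wvar 11 rfl).trans h.w11
  have w5₁ := (hf₁.wvar 5 rfl).trans h.w5
  have c₁ : s₁.warr 3 = s.warr 3 := hf₁.warr 3 rfl
  have d₁ : s₁.wvar 12 = s.wvar 12 := hf₁.wvar 12 rfl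
  clear hf₁
  -- compute the scores
  rw [wp_seq]
  refine wp_for_le lo hi (300 * levels I.n)
    (fun i s₂ => (∀ x, lo ≤ x → x < hi → IsTree I el (row I s₂ x) x m L) ∧
      ∀ j ∈ L, s₂.rarr 0 j = ∑ x ∈ Finset.Ico lo i, I.w x * (sqDist I (S.erase (el j)) x -
          sqDist I S x))
    (by simp [WExp.eval, w8₁]) hlo (small_lt hM (by omega)) ?_ ?_ ?_ ?_
  · intro i s₂ hf _
    simp only [WExp.eval, hf.wvar 9 rfl, w9₁]
  · refine ⟨tree₁, fun j hj => ?_⟩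
    simpa using hz j (Finset.mem_range.1 (h.sub hj))
  · rintro i s₂ hf hi1 hi2 hx ⟨htr, hsc⟩
    have hel₂ : s₂.warr 2 = el := (hf.warr 2 rfl).trans hel₁
    have htr' : IsTree I (s₂.warr 2) (row I s₂ i) i m L := by
      rw [hel₂]; exact htr i hi1 hi2
    refine (score_spec hI hM ((hf.wvar 0 rfl).trans w0₁) hx ((hf.wvar 5 rfl).trans w5₁)
      (by omega) (by omega) h.sub hL2 (by rw [hel₂]; exact h.inj) htr').call ?_
    rintro s₃ t₃ hf₃ ⟨ht₃, htr₃, hrows, hsc₃⟩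
    rw [hel₂] at htr₃ hsc₃
    refine ⟨ht₃, (hf₃.wvar 13 rfl).trans hx, ?_, ?_⟩
    · intro x hx1 hx2
      rw [row_setW]
      by_cases hxi : x = i
      · subst hxi; exact htr₃
      · exact (htr x hx1 hx2).congr fun v hv => hrows x hxi v (by omega)
    · intro j hj
      rw [State.setW_rarr, hsc₃ j hj, hsc j hj, ← hS, Finset.sum_Ico_succ_top hi1]
  rintro s₂ t₂ hf₂ - ⟨tree₂, hsc₂⟩ ht₂
  have hel₂ : s₂.warr 2 = el := (hf₂.warr 2 rfl).trans hel₁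
  have w0₂ := (hf₂.wvar 0 rfl).trans w0₁
  have w8₂ := (hf₂.wvar 8 rfl).trans w8₁
  have w9₂ := (hf₂.wvar 9 rfl).trans w9₁
  have w11₂ := (hf₂.wvar 11 rfl).trans w11₁
  have w5₂ := (hf₂.wvar 5 rfl).trans w5₁
  have c₂ : s₂.warr 3 = s.warr 3 := (hf₂.warr 3 rfl).trans c₁
  have d₂ : s₂.wvar 12 = s.wvar 12 := (hf₂.wvar 12 rfl).trans d₁
  clear hf₂
  have hcost : ∀ j ∈ L, s₂.rarr 0 j = costOn I X (S.erase (el j)) - costOn I X S := fun j hj => by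
    rw [hsc₂ j hj, costOn, costOn, ← Finset.sum_sub_distrib]
    exact Finset.sum_congr rfl fun x _ => by ring
  -- find the best centre
  rw [wp_seq, wp_setW, wp_seq]
  simp only [WExp.eval, WExp.time, w11₂]
  refine wp_for_le 0 m 40 (fun i s₃ =>
      (s₃.wvar 15 = m ∧ ∀ j < i, j ∉ L) ∨
      ∃ b, s₃.wvar 15 = b ∧ b < i ∧ b ∈ L ∧ ∀ j < i, j ∈ L → s₂.rarr 0 b ≤ s₂.rarr 0 j)
    (by simp [WExp.eval]) (by omega) (small_lt hM (by omega)) ?_ (Or.inl (by simp)) ?_ ?_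
  · intro i s₃ hf _
    simp only [WExp.eval, hf.wvar 11 rfl]
    simp [w11₂]
  · intro i s₃ hf _ hi hx hinv
    have w11₃ : s₃.wvar 11 = m := (hf.wvar 11 rfl).trans (by simp [w11₂])
    have c₃ : s₃.warr 3 = s.warr 3 := (hf.warr 3 rfl).trans c₂
    have el₃ : s₃.warr 2 = el := (hf.warr 2 rfl).trans hel₂
    have r₃ : s₃.rarr 0 = s₂.rarr 0 := hf.rarr 0 rfl
    have hfl := h.flag i hi
    refine wp_branch (fun hb => ?_) (fun hb => ?_)
    · simp only [Test.holds_conj, Test.holds_disj, Test.holds_pos, Test.holds_wle, Test.holds_rlt,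
        WExp.eval, RExp.eval, hx, w11₃, c₃, el₃, r₃, hfl] at hb
      simp only [wp_setW, WExp.eval, WExp.time, Test.time, RExp.time, Test.time_pos,
        Test.time_disj, Test.time_rlt, hx]
      refine ⟨by norm_num, by simp [hx], Or.inr ⟨i, by simp, by omega, hb.1, ?_⟩⟩
      intro j hj hjL
      rcases Nat.lt_succ_iff_lt_or_eq.1 hj with hj | rfl
      · rcases hinv with ⟨hb1, hb2⟩ | ⟨b, hb1, hb2, hb3, hb4⟩
        · exact absurd hjL (hb2 j hj)
        · rw [hb1] at hb
          have := hb.2.resolve_left (by omega)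
          exact this.le.trans (hb4 j hj hjL)
      · exact le_rfl
    · simp only [Test.holds_conj, Test.holds_disj, Test.holds_pos, Test.holds_wle, Test.holds_rlt,
        WExp.eval, RExp.eval, hx, w11₃, c₃, el₃, r₃, hfl, not_and, not_or, not_le, not_lt] at hb
      simp only [wp_skip, Test.time, Test.time_pos, Test.time_disj, Test.time_rlt, WExp.time,
        RExp.time]
      refine ⟨by norm_num, hx, ?_⟩
      rcases hinv with ⟨hb1, hb2⟩ | ⟨b, hb1, hb2, hb3, hb4⟩
      · left
        refine ⟨by simp [hb1], fun j hj hjL => ?_⟩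
        rcases Nat.lt_succ_iff_lt_or_eq.1 hj with hj | rfl
        · exact hb2 j hj hjL
        · have := (hb hjL).1
          omega
      · right
        refine ⟨b, by simp [hb1], by omega, hb3, fun j hj hjL => ?_⟩
        rcases Nat.lt_succ_iff_lt_or_eq.1 hj with hj | rfl
        · exact hb4 j hj hjL
        · have := (hb hjL).2
          rwa [hb1] at this
  rintro s₃ t₃ hf₃ - hinv ht₃
  obtain ⟨b, hb15, hbm, hbL, hbmin⟩ : ∃ b, s₃.wvar 15 = b ∧ b < m ∧ b ∈ L ∧
      ∀ j < m, j ∈ L → s₂.rarr 0 b ≤ s₂.rarr 0 j := by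
    rcases hinv with ⟨-, hno⟩ | hb
    · obtain ⟨j, hj⟩ : L.Nonempty := Finset.card_pos.1 (by omega)
      exact absurd hj (hno j (Finset.mem_range.1 (h.sub hj)))
    · exact hb
  have hel₃ : s₃.warr 2 = el := (hf₃.warr 2 rfl).trans hel₂
  have w0₃ : s₃.wvar 0 = I.n := (hf₃.wvar 0 rfl).trans (by simp [w0₂])
  have w8₃ : s₃.wvar 8 = lo := (hf₃.wvar 8 rfl).trans (by simp [w8₂])
  have w9₃ : s₃.wvar 9 = hi := (hf₃.wvar 9 rfl).trans (by simp [w9₂])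
  have w11₃ : s₃.wvar 11 = m := (hf₃.wvar 11 rfl).trans (by simp [w11₂])
  have w5₃ : s₃.wvar 5 = m := (hf₃.wvar 5 rfl).trans (by simp [w5₂])
  have c₃ : s₃.warr 3 = s.warr 3 := (hf₃.warr 3 rfl).trans c₂
  have d₃ : s₃.wvar 12 = s.wvar 12 := (hf₃.wvar 12 rfl).trans (by simp [d₂])
  have tree₃ : ∀ x, lo ≤ x → x < hi → IsTree I el (row I s₃ x) x m L := fun x h1 h2 => by
    rw [row_frame I (hf₃.warr 1 rfl)]; exact tree₂ x h1 h2
  clear hf₃ hinv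
  -- remove it
  rw [wp_seq, wp_setWArr, wp_seq, wp_setW]
  simp only [WExp.eval, WExp.time, hb15, hel₃, State.setWArr_wvar, d₃, e0, e1]
  set s₄ := (s₃.setWArr 3 (el b) 0).setW 12 (s.wvar 12 - 1) with hs₄
  refine wp_for_le lo hi (120 * levels I.n)
    (fun i s₅ => (∀ x, lo ≤ x → x < i → IsTree I el (row I s₅ x) x m (L.erase b)) ∧
      ∀ x, i ≤ x → x < hi → IsTree I el (row I s₅ x) x m L)
    (by simp [WExp.eval, hs₄, w8₃]) hlo (small_lt hM (by omega)) ?_ ?_ ?_ ?_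
  · intro i s₅ hf _
    simp only [WExp.eval, hf.wvar 9 rfl]
    simp [hs₄, w9₃]
  · refine ⟨fun x h1 h2 => by omega, fun x h1 h2 => ?_⟩
    have : row I (s₄.setW 13 lo) x = row I s₃ x := by
      rw [row_setW, row_frame I (s := s₃)]
      simp [hs₄]
    rw [this]; exact tree₃ x h1 h2
  · rintro i s₅ hf hi1 hi2 hx ⟨htr1, htr2⟩
    have w0₅ : s₅.wvar 0 = I.n := (hf.wvar 0 rfl).trans (by simp [hs₄, w0₃])
    have w5₅ : s₅.wvar 5 = m := (hf.wvar 5 rfl).trans (by simp [hs₄, w5₃])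
    have w15₅ : s₅.wvar 15 = b := (hf.wvar 15 rfl).trans (by simp [hs₄, hb15])
    have el₅ : s₅.warr 2 = el := (hf.warr 2 rfl).trans (by simp [hs₄, hel₃])
    rw [wp_seq]
    refine turn_spec hM w0₅ hx (by omega) ?_
    rw [wp_seq, wp_setW]
    simp only [WExp.eval, WExp.time, State.setW_wvar, w15₅]
    norm_num only [if_true, if_false]
    set s₆ := ((s₅.setW 2 (i * (2 * I.n))).setW 3 i).setW 4 b with hs₆
    have hat : TreeAt I s₆ i i m :=
      ⟨by simp [hs₆], by simp [hs₆], by simp [hs₆, w5₅], by omega, by omega⟩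
    have htr' : IsTree I (s₆.warr 2) (row I s₆ i) i m L := by
      have : s₆.warr 2 = el := el₅
      rw [this]; exact htr2 i le_rfl hi2
    refine (treeSet_erase hM hat (by simp [hs₆]) hbm htr').call ?_
    rintro s₇ t₇ hf₇ ⟨ht₇, htr₇, hrows⟩
    have : s₆.warr 2 = el := el₅
    rw [this] at htr₇
    refine ⟨by omega, (hf₇.wvar 13 rfl).trans (by simp [hs₆, hx]), ?_, ?_⟩
    · intro x hx1 hx2
      rw [row_setW]
      by_cases hxi : x = i
      · subst hxi; exact htr₇
      · exact (htr1 x hx1 (by omega)).congr fun v hv => hrows x hxi v (by omega)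
    · intro x hx1 hx2
      rw [row_setW]
      exact (htr2 x (by omega) hx2).congr fun v hv => hrows x (by omega) v (by omega)
  rintro s₅ t₅ hf₅ - ⟨tree₅, -⟩ ht₅
  have c₅ : s₅.warr 3 = Function.update (s.warr 3) (el b) 0 := by
    rw [hf₅.warr 3 rfl]; simp [hs₄, c₃]
  refine ⟨?_, ⟨b, hbL, ⟨?_, ?_, ?_, ?_, ?_, hlo, hhi, hm, ?_, h.inj, h.mem,
    (Finset.erase_subset _ _).trans h.sub, ?_, ?_, tree₅⟩, ?_⟩, ?_, ?_⟩
  · simp only [WExp.time, Nat.sub_zero] at ht₁ ht₂ ht₃ ht₅ ⊢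
    set l := hi - lo
    have a1 : 1000 * (l + 1) * levels I.n = 420 * (l * levels I.n) + 580 * (l * levels I.n)
      + 1000 * levels I.n := by ring
    have a2 : l * 1 ≤ l * levels I.n := Nat.mul_le_mul_left _ hl
    have a3 : l * (300 * levels I.n + 1 + 8) = 300 * (l * levels I.n) + 9 * l := by ring
    have a4 : l * (120 * levels I.n + 1 + 8) = 120 * (l * levels I.n) + 9 * l := by ring
    omega
  · rw [hf₅.wvar 0 rfl]; simp [hs₄, w0₃]
  · rw [hf₅.wvar 8 rfl]; simp [hs₄, w8₃]
  · rw [hf₅.wvar 9 rfl]; simp [hs₄, w9₃]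
  · rw [hf₅.wvar 11 rfl]; simp [hs₄, w11₃]
  · rw [hf₅.wvar 5 rfl]; simp [hs₄, w5₃]
  · rw [hf₅.warr 2 rfl]; simp [hs₄, hel₃]
  · intro j hj
    rw [c₅, Function.update_apply, Finset.mem_erase]
    split_ifs with hjb
    · have : j = b := h.inj (by simpa using hj) (by simpa using hbm) hjb
      simp [this]
    · rw [h.flag j hj]
      have : j ≠ b := fun e => hjb (e ▸ rfl)
      simp [this]
  · intro y h1 h2 h3
    refine h.surj y h1 h2 fun h0 => h3 ?_
    rw [c₅, Function.update_apply, h0, ite_self]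
  · intro j hj
    have := hbmin j (Finset.mem_range.1 (h.sub hj)) hj
    rw [hcost b hbL, hcost j hj] at this
    linarith
  · rw [hf₅.wvar 12 rfl]; simp [hs₄]
  · intro y hy
    rw [c₅, Function.update_of_ne]
    rintro rfl
    exact hy (h.mem b hbm)

/-- Building the trees and performing at most one deletion per initial centre each cost interval
length times number of centres times a logarithm. Several intervals are treated in turn, so the last
clause records that the flags outside are kept. -/
theorem greedy_spec {I : Input} {M : ℕ} (hI : I.IsMetric) (hM : 1000 * (I.n + 2) ^ 6 ≤ M)
    {s : State} {lo hi k : ℕ} (h0 : s.wvar 0 = I.n) (h8 : s.wvar 8 = lo) (h9 : s.wvar 9 = hi)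
    (h10 : s.wvar 10 = k) (hk : 1 ≤ k) (hlo : lo ≤ hi) (hhi : hi ≤ I.n) :
    WP I M greedy (fun s' t => t ≤ 3000 * ((hi - lo + 1) *
        ((centers s lo hi).card + 1) * levels I.n) ∧
      Greedy I (Finset.Ico lo hi) (centers s lo hi) (centers s' lo hi) ∧
      (centers s' lo hi).card = min (centers s lo hi).card k ∧
      ∀ y, ¬ (lo ≤ y ∧ y < hi) → s'.warr 3 y = s.warr 3 y) s := by
  have hl := levels_pos I.n
  rw [greedy, wp_seq]
  refine (collect_spec hM h8 h9 hlo hhi).call ?_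
  rintro s₁ t₁ hf₁ ⟨ht₁, h11, hinj, himg⟩
  set m := (centers s lo hi).card with hm
  set el := s₁.warr 2 with hel
  have hml : m ≤ hi - lo := (Finset.card_filter_le _ _).trans (by simp)
  rw [wp_seq, wp_setW, wp_seq]
  simp only [WExp.eval, WExp.time, h11]
  have w0₁ : s₁.wvar 0 = I.n := (hf₁.wvar 0 rfl).trans h0
  have w8₁ : s₁.wvar 8 = lo := (hf₁.wvar 8 rfl).trans h8
  have w9₁ : s₁.wvar 9 = hi := (hf₁.wvar 9 rfl).trans h9
  have w10₁ : s₁.wvar 10 = k := (hf₁.wvar 10 rfl).trans h10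
  have c₁ : s₁.warr 3 = s.warr 3 := hf₁.warr 3 rfl
  refine wp_for_le lo hi (8 + 200 * (m + 1) * levels I.n)
    (fun i s₂ => ∀ x, lo ≤ x → x < i → IsTree I el (row I s₂ x) x m (Finset.range m))
    (by simp [WExp.eval, w8₁]) hlo (small_lt hM (by omega)) ?_ ?_ ?_ ?_
  · intro i s₂ hf _
    simp only [WExp.eval, hf.wvar 9 rfl]
    simp [w9₁]
  · intro x h1 h2; omega
  · intro i s₂ hf hi1 hi2 hx htr
    have w0₂ : s₂.wvar 0 = I.n := (hf.wvar 0 rfl).trans (by simp [w0₁])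
    have w5₂ : s₂.wvar 5 = m := (hf.wvar 5 rfl).trans (by simp)
    have el₂ : s₂.warr 2 = el := hf.warr 2 rfl
    rw [wp_seq]
    refine turn_spec hM w0₂ hx (by omega) ?_
    set s₃ := (s₂.setW 2 (i * (2 * I.n))).setW 3 i with hs₃
    have hat : TreeAt I s₃ i i m :=
      ⟨by simp [hs₃], by simp [hs₃], by simp [hs₃, w5₂], by omega, by omega⟩
    refine (treeBuild_spec (live := Finset.range m) hM hat (by simp) ?_).call ?_
    · intro s' j _ _ hj
      simp [hj]
    rintro s₄ t₄ hf₄ ⟨ht₄, htr₄, hrows⟩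
    have : s₃.warr 2 = el := el₂
    rw [this] at htr₄
    refine ⟨by omega, (hf₄.wvar 13 rfl).trans (by simp [hs₃, hx]), ?_⟩
    intro x hx1 hx2
    rw [row_setW]
    by_cases hxi : x = i
    · subst hxi; exact htr₄
    · exact (htr x hx1 (by omega)).congr fun v hv => hrows x hxi v (by omega)
  rintro s₂ t₂ hf₂ - tree₂ ht₂
  have hin : ∀ j < m, el j ∈ centers s lo hi := fun j hj => by
    rw [← himg]; exact Finset.mem_image_of_mem _ (Finset.mem_range.2 hj)
  have w11₂ : s₂.wvar 11 = m := (hf₂.wvar 11 rfl).trans (by simp [h11])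
  have c₂ : s₂.warr 3 = s.warr 3 := (hf₂.warr 3 rfl).trans c₁
  have g₂ : GreedyState I lo hi m el (Finset.range m) (s₂.setW 12 m) := by
    refine ⟨?_, ?_, ?_, ?_, ?_, hlo, hhi, hml, hf₂.warr 2 rfl, hinj, ?_, Finset.Subset.refl _, ?_,
      ?_, tree₂⟩
    · simp [hf₂.wvar 0 rfl, w0₁]
    · simp [hf₂.wvar 8 rfl, w8₁]
    · simp [hf₂.wvar 9 rfl, w9₁]
    · simp [w11₂]
    · simp [hf₂.wvar 5 rfl]
    · exact fun j hj => (mem_centers.1 (hin j hj)).1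
    · intro j hj
      have := (mem_centers.1 (hin j hj)).2
      simp [c₂, this, hj]
    · intro y h1 h2 h3
      rw [State.setW_warr, c₂] at h3
      have : y ∈ centers s lo hi := mem_centers.2 ⟨⟨h1, h2⟩, h3⟩
      rw [← himg] at this
      obtain ⟨j, hj, rfl⟩ := Finset.mem_image.1 this
      exact ⟨j, Finset.mem_range.1 hj, rfl⟩
  rw [wp_seq, wp_setW]
  simp only [WExp.eval, WExp.time, w11₂]
  set K := 1000 * (hi - lo + 1) * levels I.n + 5 with hK
  -- The budget is `K` per live centre, and each round spends at most one `K` and removes one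
  -- centre.
  refine wp_loop (fun s₃ t => ∃ L, GreedyState I lo hi m el L s₃ ∧ s₃.wvar 12 = L.card ∧
      min m k ≤ L.card ∧ t + L.card * K ≤ m * K ∧
      Greedy I (Finset.Ico lo hi) (centers s lo hi) (L.image el) ∧
      ∀ y, ¬ (lo ≤ y ∧ y < hi) → s₃.warr 3 y = s.warr 3 y) (fun s₃ => s₃.wvar 12) ?_ ?_ ?_
  · refine ⟨Finset.range m, g₂, by simp, by simp, by simp, ?_, fun y _ => by simp [c₂]⟩
    rw [himg]; exact .refl
  · rintro s₃ t hf ⟨L, hg, h12, hmin, ht, hgr, hout⟩ hb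
    have w10₃ : s₃.wvar 10 = k :=
      (hf.wvar 10 rfl).trans (by simp [hf₂.wvar 10 rfl, w10₁])
    have hkL : k < L.card := by simpa [w10₃, h12] using hb
    refine (greedyStep_spec hI hM hg (by omega)).mono ?_
    rintro s₄ t₄ ⟨ht₄, ⟨b, hbL, hg₄, hbmin⟩, h12₄, hout₄⟩
    have hcard := Finset.card_erase_add_one hbL
    refine ⟨⟨L.erase b, hg₄, by omega, by omega, ?_, ?_, ?_⟩, by omega⟩
    · have : L.card * K = (L.erase b).card * K + K := by rw [← hcard]; ring
      simp only [Test.time_wlt, WExp.time]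
      omega
    · rw [hg.image_erase (Finset.mem_range.1 (hg.sub hbL))]
      refine hgr.step (Finset.mem_image_of_mem _ hbL) ?_
      intro z hz
      obtain ⟨j, hj, rfl⟩ := Finset.mem_image.1 hz
      exact hbmin j hj
    · exact fun y hy => (hout₄ y hy).trans (hout y hy)
  · rintro s₃ t hf ⟨L, hg, h12, hmin, ht, hgr, hout⟩ hb
    have w10₃ : s₃.wvar 10 = k :=
      (hf.wvar 10 rfl).trans (by simp [hf₂.wvar 10 rfl, w10₁])
    have hkL : L.card ≤ k := by simpa [w10₃, h12] using hb
    have hLm : L.card ≤ m := by simpa using Finset.card_le_card hg.sub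
    refine ⟨?_, ?_, ?_, hout⟩
    · simp only [Test.time_wlt, WExp.time] at ht₂ ⊢
      set l := hi - lo
      have b1 : m * K = 1000 * ((l + 1) * m * levels I.n) + 5 * m := by rw [hK]; ring
      have b2 : 3000 * ((l + 1) * (m + 1) * levels I.n) =
          1000 * ((l + 1) * m * levels I.n) + 2000 * ((l + 1) * m * levels I.n)
            + 3000 * ((l + 1) * levels I.n) := by ring
      have b3 : l * (8 + 200 * (m + 1) * levels I.n + 1 + 8) =
          200 * (l * m * levels I.n) + 200 * (l * levels I.n) + 17 * l := by ring
      have b4 : (l + 1) * m * levels I.n = l * m * levels I.n + m * levels I.n := by ring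
      have b5 : (l + 1) * levels I.n = l * levels I.n + levels I.n := by ring
      have b6 : l * 1 ≤ l * levels I.n := Nat.mul_le_mul_left _ hl
      have b7 : m * 1 ≤ m * levels I.n := Nat.mul_le_mul_left _ hl
      omega
    · rw [hg.centers_eq]; exact hgr
    · rw [hg.centers_eq, hg.card_image]; omega

/-! ## Reverse greedy on a hierarchy of blocks -/

/-- Treat all blocks of the length in word variable `17`. -/
def level : Prog :=
  8 ≔ʷ .lit 0 ;;
  .loop (.wlt (.var 8) (.var 0)) (
    .branch (.wle (.var 0) (.var 8 +ʷ .var 17)) (9 ≔ʷ .var 0) (9 ≔ʷ .var 8 +ʷ .var 17) ;;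
    greedy ;;
    8 ≔ʷ .var 9)

/-- Reduce the set of all points to at most `2 * k` centres. -/
def sparsify : Prog :=
  .forIn 13 (.lit 0) (.var 0) (.setWArr 3 (.var 13) (.lit 1)) ;;
  10 ≔ʷ .var 1 +ʷ .var 1 ;;
  -- A block of this length has at most `2k` points, so all of them may be centres at no cost.
  17 ≔ʷ .var 1 +ʷ .var 1 ;;
  .loop (.wlt (.var 17) (.var 0)) (17 ≔ʷ .var 17 +ʷ .var 17 ;; level)

/-- The centres in the block of length `z` around `x`. -/
def blockCenters (I : Input) (s : State) (z x : ℕ) : Finset ℕ :=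
  centers s (x / z * z) (min (x / z * z + z) I.n)

/-- The cost of the point `x` when it is assigned to a centre of its block. -/
noncomputable def blockCost (I : Input) (s : State) (z x : ℕ) : ℝ :=
  I.w x * sqDist I (blockCenters I s z x) x

theorem Greedy.block_cost_le {I : Input} (hI : I.IsMetric) {X S S' T : Finset ℕ} {k : ℕ}
    (h : Greedy I X S S') (hX : X ⊆ Finset.range I.n) (hTn : T ⊆ Finset.range I.n)
    (hT : T.Nonempty) (hTk : T.card ≤ k) (hS : S.card ≤ 4 * k)
    (hS' : S'.card = min S.card (2 * k)) {θ : ℝ} (hθ : 0 < θ) :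
    costOn I X S' ≤ Real.exp (4 / θ) * (costOn I X S + (4 * θ + 8) * costOn I X T) := by
  have hk : 1 ≤ k := hT.card_pos.trans_le hTk
  have hk' : (1 : ℝ) ≤ k := by exact_mod_cast hk
  have c0 := costOn_nonneg hI X S
  have t0 := costOn_nonneg hI X T
  rcases le_or_gt S.card (2 * k) with hc | hc
  · have : S' = S := Finset.eq_of_subset_of_card_le h.subset (by omega)
    rw [this]
    have h1 : 1 ≤ Real.exp (4 / θ) := Real.one_le_exp (by positivity)
    have h2 : 0 ≤ (4 * θ + 8) * costOn I X T := by positivity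
    nlinarith
  · have hS2 : (S'.card : ℝ) = 2 * k := by
      rw [hS', min_eq_right hc.le]; push_cast; ring
    have hTk' : (T.card : ℝ) ≤ k := by exact_mod_cast hTk
    have hS4 : (S.card : ℝ) ≤ 4 * k := by exact_mod_cast hS
    have hc' : 2 * (k : ℝ) ≤ S.card := by exact_mod_cast hc.le
    -- At least `2k` centres remain, so the slack over `T` is at least `k`. At most `2k` deletions
    -- give the exponent `4/θ` and the additive coefficient `2(2θ+4)`.
    have := h.cost_le hI hX hTn hT (K := k) (θ := θ) (by linarith) hθ (by rw [hS2]; linarith)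
    refine this.trans ?_
    rw [hS2]
    have e1 : 2 / (θ * k) * ((S.card : ℝ) - 2 * k) ≤ 4 / θ := by
      rw [div_mul_eq_mul_div, div_le_div_iff₀ (by positivity) hθ]
      nlinarith
    have e2 : ((S.card : ℝ) - 2 * k) * ((2 * θ + 4) / k * costOn I X T) ≤
        (4 * θ + 8) * costOn I X T := by
      rw [← mul_assoc]
      refine mul_le_mul_of_nonneg_right ?_ t0
      rw [mul_div_assoc', div_le_iff₀ (by linarith)]
      nlinarith
    refine mul_le_mul (Real.exp_le_exp.2 e1) (by linarith) ?_ (Real.exp_pos _).le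
    have : 0 ≤ (S.card : ℝ) - 2 * k := by linarith
    positivity

theorem Greedy.nonempty {S S' : Finset ℕ} {k : ℕ} (hS : S.Nonempty) (hk : 1 ≤ k)
    (hS' : S'.card = min S.card k) : S'.Nonempty := by
  rw [← Finset.card_pos, hS']
  exact lt_min hS.card_pos hk

theorem centers_congr {s s' : State} {lo hi : ℕ}
    (h : ∀ y, lo ≤ y → y < hi → s'.warr 3 y = s.warr 3 y) : centers s' lo hi = centers s lo hi := by
  ext y
  rw [mem_centers, mem_centers]
  constructor
  · rintro ⟨h1, h2⟩; exact ⟨h1, by rwa [← h y h1.1 h1.2]⟩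
  · rintro ⟨h1, h2⟩; exact ⟨h1, by rwa [h y h1.1 h1.2]⟩

theorem centers_mono {s : State} {lo hi lo' hi' : ℕ} (h1 : lo' ≤ lo) (h2 : hi ≤ hi') :
    centers s lo hi ⊆ centers s lo' hi' := by
  intro y
  rw [mem_centers, mem_centers]
  rintro ⟨h, h3⟩
  exact ⟨by omega, h3⟩

theorem div_mul_of_mem {z lo x : ℕ} (hz : z ∣ lo) (h1 : lo ≤ x) (h2 : x < lo + z) :
    x / z * z = lo := by
  obtain ⟨i, rfl⟩ := hz
  have hz0 : 0 < z := by omega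
  have : x / z = i := by
    refine Nat.div_eq_of_lt_le ?_ ?_
    · rw [mul_comm]; exact h1
    · rw [add_mul, mul_comm]; omega
  rw [this, mul_comm]

theorem div_mul_add_le {z lo x : ℕ} (hz : z ∣ lo) (h : x < lo) : x / z * z + z ≤ lo := by
  obtain ⟨i, rfl⟩ := hz
  have : x / z < i := Nat.div_lt_of_lt_mul h
  calc x / z * z + z = (x / z + 1) * z := by ring
    _ ≤ i * z := Nat.mul_le_mul_right _ this
    _ = z * i := mul_comm _ _

/-- The blocks of length `z` have between one and `2 * k` centres. -/
def BlocksOK (I : Input) (k z : ℕ) (s : State) : Prop :=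
  ∀ x < I.n, (blockCenters I s z x).Nonempty ∧ (blockCenters I s z x).card ≤ 2 * k

/-- Reverse greedy in one block may be compared with a solution `T` that ignores the blocks, so the
bounds of the blocks can be added and the costs of `T` on them sum to its total cost. Every point
deals with at most `4k` centres, which gives `n * k` up to logarithms for the whole level. -/
theorem level_spec {I : Input} {M k z : ℕ} (hI : I.IsMetric) (hM : 1000 * (I.n + 2) ^ 6 ≤ M)
    {s : State} (hk : 1 ≤ k) (h0 : s.wvar 0 = I.n) (h10 : s.wvar 10 = 2 * k)
    (h17 : s.wvar 17 = 2 * z) (hz : 1 ≤ z) (hzn : z < I.n) (hs : BlocksOK I k z s) {T : Finset ℕ}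
    (hTn : T ⊆ Finset.range I.n) (hT : T.Nonempty) (hTk : T.card ≤ k) {θ : ℝ} (hθ : 0 < θ) :
    WP I M level (fun s' t => t ≤ 31000 * (I.n * k * levels I.n) ∧ BlocksOK I k (2 * z) s' ∧
      ∑ x ∈ Finset.range I.n, blockCost I s' (2 * z) x ≤ Real.exp (4 / θ) *
        (∑ x ∈ Finset.range I.n, blockCost I s z x +
          (4 * θ + 8) * costOn I (Finset.range I.n) T)) s := by
  have hl := levels_pos I.n
  have e0 : 0 % M = 0 := Nat.zero_mod M
  rw [level, wp_seq, wp_setW]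
  simp only [WExp.eval, WExp.time, e0]
  -- Below `lo` the blocks already have length `2z`; from `lo` on the flags are those of `s`, so the
  -- bounds on blocks of length `z` still apply there.
  refine wp_loop (fun s₁ t => ∃ lo, s₁.wvar 8 = lo ∧ lo ≤ I.n ∧ (2 * z ∣ lo ∨ lo = I.n) ∧
      t ≤ lo * (30500 * (k * levels I.n)) ∧
      (∀ y, lo ≤ y → s₁.warr 3 y = s.warr 3 y) ∧
      (∀ x < lo, (blockCenters I s₁ (2 * z) x).Nonempty ∧
        (blockCenters I s₁ (2 * z) x).card ≤ 2 * k) ∧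
      ∑ x ∈ Finset.range lo, blockCost I s₁ (2 * z) x ≤ Real.exp (4 / θ) *
        (∑ x ∈ Finset.range lo, blockCost I s z x +
          (4 * θ + 8) * ∑ x ∈ Finset.range lo, I.w x * sqDist I T x))
    (fun s₁ => I.n - s₁.wvar 8) ?_ ?_ ?_
  · exact ⟨0, by simp, by omega, by simp, by simp, fun y _ => rfl, by simp, by simp⟩
  · rintro s₁ t hf ⟨lo, h8, hlon, hdvd, ht, hsame, hblk, hcost⟩ hb
    have w0₁ : s₁.wvar 0 = I.n := (hf.wvar 0 rfl).trans (by simp [h0])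
    have w10₁ : s₁.wvar 10 = 2 * k := (hf.wvar 10 rfl).trans (by simp [h10])
    have w17₁ : s₁.wvar 17 = 2 * z := (hf.wvar 17 rfl).trans (by simp [h17])
    have hlo : lo < I.n := by simpa [WExp.eval, h8, w0₁] using hb
    have hdvd : 2 * z ∣ lo := hdvd.resolve_right (by omega)
    set hi := min (lo + 2 * z) I.n with hhi
    have hlohi : lo < hi := by omega
    have esum : (lo + 2 * z) % M = lo + 2 * z := Nat.mod_eq_of_lt (small_lt hM (by omega))
    -- the first part of the body
    have hbr : WP I M (.branch (.wle (.var 0) (.var 8 +ʷ .var 17)) (9 ≔ʷ .var 0)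
        (9 ≔ʷ .var 8 +ʷ .var 17)) (fun s' t => s' = s₁.setW 9 hi ∧ t ≤ 10) s₁ := by
      refine wp_branch (fun hh => ?_) (fun hh => ?_)
      · simp only [Test.holds_wle, WExp.eval, w0₁, h8, w17₁, esum] at hh
        simp only [wp_setW, WExp.eval, w0₁, Test.time, WExp.time]
        exact ⟨by rw [hhi, min_eq_right hh], by norm_num⟩
      · simp only [Test.holds_wle, WExp.eval, w0₁, h8, w17₁, esum, not_le] at hh
        simp only [wp_setW, WExp.eval, h8, w17₁, esum, Test.time, WExp.time]
        exact ⟨by rw [hhi, min_eq_left hh.le], by norm_num⟩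
    rw [wp_seq]
    refine hbr.mono ?_
    rintro _ t₂ ⟨rfl, ht₂⟩
    rw [wp_seq]
    refine (greedy_spec hI hM (s := s₁.setW 9 hi) (lo := lo) (hi := hi) (k := 2 * k)
      (by simp [w0₁]) (by simp [h8]) (by simp) (by simp [w10₁]) (by omega) hlohi.le
      (by omega)).call ?_
    rintro s₃ t₃ hf₃ ⟨ht₃, hgr, hcard, hout⟩
    have hc₁ : centers (s₁.setW 9 hi) lo hi = centers s lo hi :=
      centers_congr fun y h1 _ => hsame y h1
    rw [hc₁] at hgr hcard ht₃
    have w9₃ : s₃.wvar 9 = hi := (hf₃.wvar 9 rfl).trans (by simp)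
    rw [wp_setW]
    simp only [WExp.eval, WExp.time, w9₃]
    -- the blocks of length `z` in the block
    have hsub : ∀ x, lo ≤ x → x < hi → blockCenters I s z x ⊆ centers s lo hi := by
      intro x h1 h2
      obtain ⟨i, rfl⟩ := hdvd
      refine centers_mono ?_ ?_
      · have : 2 * i ≤ x / z := by
          rw [Nat.le_div_iff_mul_le (by omega)]
          calc 2 * i * z = 2 * z * i := by ring
            _ ≤ x := h1
        calc 2 * z * i = (2 * i) * z := by ring
          _ ≤ x / z * z := Nat.mul_le_mul_right _ this
      · have : x / z < 2 * i + 2 := by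
          rw [Nat.div_lt_iff_lt_mul (by omega)]
          calc x < 2 * z * i + 2 * z := by omega
            _ = (2 * i + 2) * z := by ring
        have : x / z * z + z ≤ 2 * z * i + 2 * z := by
          calc x / z * z + z = (x / z + 1) * z := by ring
            _ ≤ (2 * i + 2) * z := Nat.mul_le_mul_right _ this
            _ = 2 * z * i + 2 * z := by ring
        omega
    have hne : (centers s lo hi).Nonempty := (hs lo hlo).1.mono (hsub lo le_rfl hlohi)
    -- The merged block consists of two old blocks, or of one if the second would begin beyond the
    -- last point.
    have hc4 : (centers s lo hi).card ≤ 4 * k := by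
      have hzlo : z ∣ lo := (Dvd.intro_left 2 rfl).trans hdvd
      by_cases hlz : lo + z < I.n
      · have hcov : centers s lo hi ⊆ blockCenters I s z lo ∪ blockCenters I s z (lo + z) := by
          intro y
          rw [Finset.mem_union, blockCenters, blockCenters, mem_centers, mem_centers, mem_centers,
            div_mul_of_mem hzlo le_rfl (by omega),
            div_mul_of_mem (hzlo.add (dvd_refl z)) le_rfl (by omega)]
          rintro ⟨h1, h2⟩
          by_cases hy : y < lo + z
          · exact Or.inl ⟨by omega, h2⟩
          · exact Or.inr ⟨by omega, h2⟩
        have h1 := (Finset.card_le_card hcov).trans (Finset.card_union_le _ _)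
        have h2 := (hs lo hlo).2
        have h3 := (hs (lo + z) hlz).2
        omega
      · have hcov : centers s lo hi ⊆ blockCenters I s z lo := by
          intro y
          rw [blockCenters, mem_centers, mem_centers, div_mul_of_mem hzlo le_rfl (by omega)]
          rintro ⟨h1, h2⟩
          exact ⟨by omega, h2⟩
        have h1 := Finset.card_le_card hcov
        have h2 := (hs lo hlo).2
        omega
    have hsame₃ : ∀ y, ¬ (lo ≤ y ∧ y < hi) → s₃.warr 3 y = s₁.warr 3 y := hout
    have hold : ∀ x < lo, blockCenters I s₃ (2 * z) x = blockCenters I s₁ (2 * z) x :=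
      fun x hx => centers_congr fun y h1 h2 => hsame₃ y (by
        have := div_mul_add_le hdvd hx
        omega)
    have hnew : ∀ x, lo ≤ x → x < hi → blockCenters I s₃ (2 * z) x = centers s₃ lo hi := by
      intro x h1 h2
      rw [blockCenters, div_mul_of_mem hdvd h1 (by omega)]
    refine ⟨⟨hi, by simp, by omega, ?_, ?_, ?_, ?_, ?_⟩, by simp [h8]; omega⟩
    · by_cases h : lo + 2 * z ≤ I.n
      · left
        rw [hhi, min_eq_left h]
        exact hdvd.add (dvd_refl _)
      · right; omega
    · simp only [Test.time_wlt, WExp.time]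
      obtain ⟨l, hl', hl1⟩ : ∃ l, hi = lo + l ∧ 1 ≤ l := ⟨hi - lo, by omega, by omega⟩
      have e : hi - lo = l := by omega
      rw [e] at ht₃
      rw [hl']
      have a1 : (l + 1) * ((centers s lo hi).card + 1) * levels I.n ≤
          (2 * l) * (5 * k) * levels I.n :=
        Nat.mul_le_mul_right _ (Nat.mul_le_mul (by omega) (by omega))
      have a2 : (2 * l) * (5 * k) * levels I.n = 10 * (l * (k * levels I.n)) := by ring
      have a3 : (lo + l) * (30500 * (k * levels I.n)) =
          lo * (30500 * (k * levels I.n)) + 30500 * (l * (k * levels I.n)) := by ring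
      have a4 : 1 ≤ l * (k * levels I.n) :=
        Nat.mul_pos (by omega) (Nat.mul_pos (by omega) (by omega))
      omega
    · intro y hy
      exact (hsame₃ y (by omega)).trans (hsame y (by omega))
    · intro x hx
      change (blockCenters I s₃ (2 * z) x).Nonempty ∧ (blockCenters I s₃ (2 * z) x).card ≤ 2 * k
      by_cases hxl : x < lo
      · rw [hold x hxl]; exact hblk x hxl
      · rw [hnew x (by omega) hx]
        exact ⟨Greedy.nonempty hne (by omega) hcard, by omega⟩
    · have split : ∀ f : ℕ → ℝ, ∑ x ∈ Finset.range hi, f x =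
          ∑ x ∈ Finset.range lo, f x + ∑ x ∈ Finset.Ico lo hi, f x :=
        fun f => (Finset.sum_range_add_sum_Ico f hlohi.le).symm
      change ∑ x ∈ Finset.range hi, blockCost I s₃ (2 * z) x ≤ _
      rw [split, split, split]
      have b1 : ∑ x ∈ Finset.range lo, blockCost I s₃ (2 * z) x =
          ∑ x ∈ Finset.range lo, blockCost I s₁ (2 * z) x :=
        Finset.sum_congr rfl fun x hx => by
          rw [blockCost, blockCost, hold x (Finset.mem_range.1 hx)]
      have b2 : ∑ x ∈ Finset.Ico lo hi, blockCost I s₃ (2 * z) x =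
          costOn I (Finset.Ico lo hi) (centers s₃ lo hi) :=
        Finset.sum_congr rfl fun x hx => by
          rw [Finset.mem_Ico] at hx
          rw [blockCost, hnew x hx.1 hx.2]
      -- Merging blocks only offers more centres to each client.
      have b3 : costOn I (Finset.Ico lo hi) (centers s lo hi) ≤
          ∑ x ∈ Finset.Ico lo hi, blockCost I s z x :=
        Finset.sum_le_sum fun x hx => by
          rw [Finset.mem_Ico] at hx
          exact mul_le_mul_of_nonneg_left
            (sqDist_anti (hsub x hx.1 hx.2) (hs x (by omega)).1 x) (hI.w_nonneg x)
      have hXn : Finset.Ico lo hi ⊆ Finset.range I.n := fun x hx => by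
        rw [Finset.mem_Ico] at hx
        rw [Finset.mem_range]; omega
      have b4 := hgr.block_cost_le hI hXn hTn hT hTk hc4 hcard hθ
      have b5 := mul_le_mul_of_nonneg_left b3 (Real.exp_pos (4 / θ)).le
      have b6 : ∑ x ∈ Finset.Ico lo hi, I.w x * sqDist I T x = costOn I (Finset.Ico lo hi) T := rfl
      rw [b1, b2, b6]
      linarith
  · rintro s₁ t hf ⟨lo, h8, hlon, hdvd, ht, hsame, hblk, hcost⟩ hb
    have w0₁ : s₁.wvar 0 = I.n := (hf.wvar 0 rfl).trans (by simp [h0])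
    have hlo : lo = I.n := by
      have : ¬ lo < I.n := by simpa [WExp.eval, h8, w0₁] using hb
      omega
    subst hlo
    refine ⟨?_, hblk, hcost⟩
    simp only [Test.time_wlt, WExp.time]
    have a1 : I.n * (30500 * (k * levels I.n)) = 30500 * (I.n * k * levels I.n) := by ring
    have a2 : 1 ≤ I.n * k * levels I.n :=
      Nat.mul_pos (Nat.mul_pos (by omega) (by omega)) (by omega)
    omega

/-- After `ℓ` levels the cost is at most `exp(4ℓ/θ) * ℓ * (4θ+8) * cost(T)`. Since `ℓ ≤ θ`, the
exponential stays bounded and two factors `θ` remain. -/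
theorem sparsify_spec {I : Input} {M k : ℕ} (hI : I.IsMetric) (hM : 1000 * (I.n + 2) ^ 6 ≤ M)
    {s : State} (hk : 1 ≤ k) (hkn : k ≤ I.n) (h0 : s.wvar 0 = I.n) (h1 : s.wvar 1 = k)
    {T : Finset ℕ} (hTn : T ⊆ Finset.range I.n) (hT : T.Nonempty) (hTk : T.card ≤ k) {θ : ℝ}
    (hθ : 1 ≤ θ) (hθn : Real.log (I.n / k) / Real.log 2 ≤ θ) :
    WP I M sparsify (fun s' t => t ≤ 40000 * (I.n * k * levels I.n ^ 2) ∧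
      (centers s' 0 I.n).Nonempty ∧ (centers s' 0 I.n).card ≤ 2 * k ∧
      costOn I (Finset.range I.n) (centers s' 0 I.n) ≤
        12 * Real.exp 4 * θ ^ 2 * costOn I (Finset.range I.n) T) s := by
  have hl := levels_pos I.n
  have hO := costOn_nonneg hI (Finset.range I.n) T
  have hθ0 : 0 < θ := by linarith
  have e1 : 1 % M = 1 := Nat.mod_eq_of_lt (small_lt hM (by omega))
  have ek : (k + k) % M = 2 * k := by
    rw [Nat.mod_eq_of_lt (small_lt hM (by omega))]; ring
  rw [sparsify, wp_seq]
  refine wp_for_le 0 I.n 3 (fun i s₁ => ∀ y < i, s₁.warr 3 y = 1)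
    (by simp [WExp.eval]) (by omega) (small_lt hM (by omega)) ?_ (by simp) ?_ ?_
  · intro i s₁ hf _
    simp [WExp.eval, hf.wvar 0 rfl, h0]
  · intro i s₁ hf _ hi hx hz
    simp only [wp_setWArr, WExp.eval, WExp.time, hx, e1]
    refine ⟨by norm_num, hx, fun y hy => ?_⟩
    simp only [State.setW_warr, State.setWArr_warr, if_true, Function.update_apply]
    split_ifs with hyi
    · rfl
    · exact hz y (by omega)
  rintro s₁ t₁ hf₁ - hones ht₁
  have w0₁ : s₁.wvar 0 = I.n := (hf₁.wvar 0 rfl).trans h0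
  have w1₁ : s₁.wvar 1 = k := (hf₁.wvar 1 rfl).trans h1
  rw [wp_seq, wp_setW, wp_seq, wp_setW]
  simp only [WExp.eval, WExp.time, State.setW_wvar, w1₁]
  norm_num only [if_true, if_false]
  rw [ek]
  set s₂ := (s₁.setW 10 (2 * k)).setW 17 (2 * k) with hs₂
  -- A merging round is started only while the block length is below `n`, so after `ℓ ≥ 1` rounds `k
  -- * 2 ^ ℓ < n`. This bounds the rounds both by `levels n` and by `log₂(n/k)`.
  have hlevel : ∀ ℓ, (ℓ = 0 ∨ k * 2 ^ ℓ < I.n) → ℓ + 1 ≤ levels I.n := by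
    rintro ℓ (rfl | h)
    · omega
    · have h2 : 2 ^ ℓ ≤ 2 * I.n := by nlinarith [Nat.one_le_two_pow (n := ℓ)]
      have := Nat.le_log_of_pow_le (b := 2) (by omega) h2
      rw [levels]; omega
  refine wp_loop (fun s₃ t => ∃ ℓ, s₃.wvar 17 = 2 * k * 2 ^ ℓ ∧ (ℓ = 0 ∨ k * 2 ^ ℓ < I.n) ∧
      t ≤ ℓ * (32000 * (I.n * k * levels I.n)) ∧ BlocksOK I k (2 * k * 2 ^ ℓ) s₃ ∧
      ∑ x ∈ Finset.range I.n, blockCost I s₃ (2 * k * 2 ^ ℓ) x ≤ Real.exp (ℓ * (4 / θ)) *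
        (ℓ * ((4 * θ + 8) * costOn I (Finset.range I.n) T)))
    (fun s₃ => I.n - s₃.wvar 17) ?_ ?_ ?_
  · refine ⟨0, by simp [hs₂], by simp, by simp, ?_, ?_⟩
    · intro x hx
      rw [pow_zero, mul_one]
      constructor
      · refine ⟨x, mem_centers.2 ⟨⟨Nat.div_mul_le_self _ _, lt_min ?_ hx⟩, ?_⟩⟩
        · exact Nat.lt_div_mul_add (by omega)
        · simp [hs₂, hones x hx]
      · refine (Finset.card_filter_le _ _).trans ?_
        rw [Nat.card_Ico]; omega
    -- Every point is its own centre at the start.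
    · have hzero : ∀ x ∈ Finset.range I.n, blockCost I s₂ (2 * k * 2 ^ 0) x = 0 := by
        intro x hx
        rw [Finset.mem_range] at hx
        have hmem : x ∈ blockCenters I s₂ (2 * k * 2 ^ 0) x := by
          rw [pow_zero, mul_one]
          refine mem_centers.2 ⟨⟨Nat.div_mul_le_self _ _, lt_min ?_ hx⟩, ?_⟩
          · exact Nat.lt_div_mul_add (by omega)
          · simp [hs₂, hones x hx]
        have h1 := sqDist_le (I := I) hmem x
        rw [hI.self x] at h1
        have h2 := sqDist_nonneg I (blockCenters I s₂ (2 * k * 2 ^ 0) x) x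
        rw [blockCost, le_antisymm (by simpa using h1) h2, mul_zero]
      rw [Finset.sum_eq_zero hzero]; simp
  · rintro s₃ t hf ⟨ℓ, h17, hℓ, ht, hblk, hcost⟩ hb
    have w0₃ : s₃.wvar 0 = I.n := (hf.wvar 0 rfl).trans (by simp [hs₂, w0₁])
    have w10₃ : s₃.wvar 10 = 2 * k := (hf.wvar 10 rfl).trans (by simp [hs₂])
    set z := 2 * k * 2 ^ ℓ with hz
    have hzn : z < I.n := by simpa [WExp.eval, h17, w0₃] using hb
    have hz1 : 1 ≤ z := Nat.mul_pos (by omega) (Nat.two_pow_pos ℓ)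
    have ez : (z + z) % M = 2 * z := by
      rw [Nat.mod_eq_of_lt (small_lt hM (by omega))]; ring
    have hz2 : 2 * k * 2 ^ (ℓ + 1) = 2 * z := by rw [hz]; ring
    rw [wp_seq, wp_setW]
    simp only [WExp.eval, WExp.time, h17, ez]
    refine (level_spec hI hM (s := s₃.setW 17 (2 * z)) (z := z) hk (by simp [w0₃]) (by simp [w10₃])
      (by simp) hz1 hzn hblk hTn hT hTk hθ0).call ?_
    rintro s₄ t₄ hf₄ ⟨ht₄, hblk₄, hcost₄⟩
    have w17₄ : s₄.wvar 17 = 2 * z := (hf₄.wvar 17 rfl).trans (by simp)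
    refine ⟨⟨ℓ + 1, by rw [w17₄, hz2], Or.inr ?_, ?_, by rwa [hz2], ?_⟩, ?_⟩
    · calc k * 2 ^ (ℓ + 1) = z := by rw [hz]; ring
        _ < I.n := hzn
    · simp only [Test.time_wlt, WExp.time]
      have a1 : (ℓ + 1) * (32000 * (I.n * k * levels I.n)) =
        ℓ * (32000 * (I.n * k * levels I.n)) + 32000 * (I.n * k * levels I.n) := by ring
      have a2 : 1 ≤ I.n * k * levels I.n :=
        Nat.mul_pos (Nat.mul_pos (by omega) (by omega)) (by omega)
      omega
    · rw [hz2]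
      refine hcost₄.trans ?_
      have hb3 : ∑ x ∈ Finset.range I.n, blockCost I (s₃.setW 17 (2 * z)) z x =
        ∑ x ∈ Finset.range I.n, blockCost I s₃ z x := rfl
      rw [hb3]
      set A := (4 * θ + 8) * costOn I (Finset.range I.n) T with hA
      have hA0 : 0 ≤ A := by positivity
      push_cast
      rw [add_mul, one_mul, Real.exp_add]
      have hE : 1 ≤ Real.exp (ℓ * (4 / θ)) := Real.one_le_exp (by positivity)
      have hE' := Real.exp_pos (4 / θ)
      calc Real.exp (4 / θ) * (∑ x ∈ Finset.range I.n, blockCost I s₃ z x + A)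
          ≤ Real.exp (4 / θ) * (Real.exp (ℓ * (4 / θ)) * (ℓ * A) +
            Real.exp (ℓ * (4 / θ)) * A) := by
            refine mul_le_mul_of_nonneg_left (add_le_add hcost ?_) hE'.le
            nlinarith
        _ = _ := by ring
    · rw [w17₄]; omega
  · rintro s₃ t hf ⟨ℓ, h17, hℓ, ht, hblk, hcost⟩ hb
    have w0₃ : s₃.wvar 0 = I.n := (hf.wvar 0 rfl).trans (by simp [hs₂, w0₁])
    set z := 2 * k * 2 ^ ℓ with hz
    have hzn : I.n ≤ z := by simpa [WExp.eval, h17, w0₃] using hb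
    -- A single block now contains all points, so the block cost is the cost.
    have hall : ∀ x < I.n, blockCenters I s₃ z x = centers s₃ 0 I.n := fun x hx => by
      rw [blockCenters, Nat.div_eq_of_lt (by omega)]
      congr 1 <;> omega
    obtain ⟨hne, hcd⟩ := hblk 0 (by omega)
    rw [hall 0 (by omega)] at hne hcd
    refine ⟨?_, hne, hcd, ?_⟩
    · have hℓ' := hlevel ℓ hℓ
      simp only [Test.time_wlt, WExp.time] at ht₁ ⊢
      have a1 : ℓ * (32000 * (I.n * k * levels I.n)) ≤
          levels I.n * (32000 * (I.n * k * levels I.n)) := Nat.mul_le_mul_right _ (by omega)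
      have a2 : levels I.n * (32000 * (I.n * k * levels I.n)) =
        32000 * (I.n * k * levels I.n ^ 2) := by ring
      have a3 : I.n * 1 ≤ I.n * (k * levels I.n ^ 2) :=
        Nat.mul_le_mul_left _ (Nat.mul_pos (by omega) (by positivity))
      have a4 : I.n * (k * levels I.n ^ 2) = I.n * k * levels I.n ^ 2 := by ring
      omega
    · have hsum : ∑ x ∈ Finset.range I.n, blockCost I s₃ z x =
          costOn I (Finset.range I.n) (centers s₃ 0 I.n) :=
        Finset.sum_congr rfl fun x hx => by rw [blockCost, hall x (Finset.mem_range.1 hx)]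
      rw [hsum] at hcost
      have hℓθ : (ℓ : ℝ) ≤ θ := by
        rcases hℓ with rfl | h
        · simpa using hθ0.le
        · refine le_trans ?_ hθn
          have hk0 : (0 : ℝ) < k := by exact_mod_cast hk
          rw [le_div_iff₀ (Real.log_pos one_lt_two), ← Real.log_pow]
          refine Real.log_le_log (by positivity) ?_
          rw [le_div_iff₀ hk0]
          have : ((k * 2 ^ ℓ : ℕ) : ℝ) < I.n := by exact_mod_cast h
          push_cast at this
          linarith
      refine hcost.trans ?_
      have f1 : Real.exp (ℓ * (4 / θ)) ≤ Real.exp 4 := by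
        refine Real.exp_le_exp.2 ?_
        rw [mul_div_assoc', div_le_iff₀ hθ0]; linarith
      -- `4θ + 8 ≤ 12θ`, as `1 ≤ θ`.
      have f2 : (ℓ : ℝ) * ((4 * θ + 8) * costOn I (Finset.range I.n) T) ≤
          θ * (12 * θ * costOn I (Finset.range I.n) T) :=
        mul_le_mul hℓθ (mul_le_mul_of_nonneg_right (by linarith) hO) (by positivity) (by positivity)
      calc _ ≤ Real.exp 4 * (θ * (12 * θ * costOn I (Finset.range I.n) T)) :=
            mul_le_mul f1 f2 (by positivity) (Real.exp_pos _).le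
        _ = _ := by ring

/-! ## The primal-dual method: facilities -/

/-- The live leaves of a tournament tree over all points. -/
def liveOf (I : Input) (T : ℕ → ℕ) : Finset ℕ := {j ∈ Finset.range I.n | T (I.n + j) ≠ 0}

theorem liveOf_congr {I : Input} {T T' : ℕ → ℕ} (h : ∀ v < 2 * I.n, T' v = T v) :
    liveOf I T' = liveOf I T := by
  refine Finset.filter_congr fun j hj => ?_
  rw [h _ (by have := Finset.mem_range.1 hj; omega)]

theorem IsTree.liveOf_eq {I : Input} {el T : ℕ → ℕ} {p : ℕ} {live : Finset ℕ}
    (h : IsTree I el T p I.n live) (hl : live ⊆ Finset.range I.n) : liveOf I T = live := by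
  ext j
  rw [liveOf, Finset.mem_filter, Finset.mem_range]
  constructor
  · rintro ⟨h1, h2⟩
    by_contra hj
    exact h2 (by rw [h.leaf j h1, if_neg hj])
  · intro hj
    have := Finset.mem_range.1 (hl hj)
    exact ⟨this, by rw [h.leaf j this, if_pos hj]; omega⟩

/-- What the frozen clients pay for the facility `p`. -/
noncomputable def paid (I : Input) (uf : Finset ℕ) (α : ℕ → ℝ) (p : ℕ) : ℝ :=
  ∑ j ∈ Finset.range I.n \ uf, I.w j * max (α j - I.d p j ^ 2) 0

/-- The data `T`, `W`, `P` of a closed facility `p` at time `τ` with unfrozen clients `uf` and dual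
variables `α`. The unfrozen clients that have left the tree `T` are near enough to pay for `p`; they
have total weight `W`, and `p` opens at time `P / W`. -/
structure Closed (I : Input) (el : ℕ → ℕ) (uf : Finset ℕ) (α : ℕ → ℝ) (f τ : ℝ) (p : ℕ)
    (T : ℕ → ℕ) (W P : ℝ) : Prop where
  tree : IsTree I el T p I.n (liveOf I T)
  sub : liveOf I T ⊆ uf
  weight : W = ∑ j ∈ uf \ liveOf I T, I.w j
  price : P = f - paid I uf α p + ∑ j ∈ uf \ liveOf I T, I.w j * I.d p j ^ 2
  near : ∀ j ∈ uf \ liveOf I T, W * I.d p j ^ 2 ≤ P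
  time : τ * W ≤ P
  far : ∀ j ∈ liveOf I T, τ ≤ I.d p j ^ 2
  ord : ∀ i ∈ uf \ liveOf I T, ∀ j ∈ liveOf I T, I.d p i ^ 2 ≤ I.d p j ^ 2

/-- All clients that are near enough have left the tree. -/
def Settled (I : Input) (p : ℕ) (T : ℕ → ℕ) (W P : ℝ) : Prop :=
  ∀ j ∈ liveOf I T, P < W * I.d p j ^ 2

/-- The data `T` of a facility `p` that opened at time `R`. -/
structure Opened (I : Input) (el : ℕ → ℕ) (uf : Finset ℕ) (α : ℕ → ℝ) (f τ : ℝ) (p : ℕ)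
    (T : ℕ → ℕ) (R : ℝ) : Prop where
  tree : IsTree I el T p I.n uf
  le : R ≤ τ
  price : paid I uf α p + ∑ j ∈ uf, I.w j * max (R - I.d p j ^ 2) 0 = f
  bounded : ∀ j ∈ Finset.range I.n \ uf, α j ≤ max R (I.d p j ^ 2)
  ahead : ∀ j ∈ uf, τ ≤ max R (I.d p j ^ 2)

section
variable {I : Input} {el T T' : ℕ → ℕ} {uf : Finset ℕ} {α : ℕ → ℝ} {f τ t W P R : ℝ} {p j : ℕ}

theorem Closed.congr (h : Closed I el uf α f τ p T W P) (hT : ∀ v < 2 * I.n, T' v = T v) :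
    Closed I el uf α f τ p T' W P := by
  have e := liveOf_congr hT
  exact ⟨by rw [e]; exact h.tree.congr hT, by rw [e]; exact h.sub, by rw [e]; exact h.weight,
    by rw [e]; exact h.price, by rw [e]; exact h.near, h.time, by rw [e]; exact h.far,
    by rw [e]; exact h.ord⟩

theorem Settled.congr (h : Settled I p T W P) (hT : ∀ v < 2 * I.n, T' v = T v) :
    Settled I p T' W P := by
  rw [Settled, liveOf_congr hT]; exact h

theorem Opened.congr (h : Opened I el uf α f τ p T R) (hT : ∀ v < 2 * I.n, T' v = T v) :
    Opened I el uf α f τ p T' R :=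
  ⟨h.tree.congr hT, h.le, h.price, h.bounded, h.ahead⟩

theorem Closed.weight_nonneg (hI : I.IsMetric) (h : Closed I el uf α f τ p T W P) : 0 ≤ W := by
  rw [h.weight]; exact Finset.sum_nonneg fun j _ => hI.w_nonneg j

theorem Closed.le_weight (hI : I.IsMetric) (h : Closed I el uf α f τ p T W P)
    (hj : j ∈ uf \ liveOf I T) : I.w j ≤ W := by
  rw [h.weight]
  exact Finset.single_le_sum (f := I.w) (fun j _ => hI.w_nonneg j) hj

theorem liveOf_subset : liveOf I T ⊆ Finset.range I.n := Finset.filter_subset _ _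

/-- The nearest live client leaves the tree. -/
theorem Closed.pop (hI : I.IsMetric) (h : Closed I el uf α f τ p T W P)
    (hj : j ∈ liveOf I T) (hmin : ∀ i ∈ liveOf I T, I.d p j ^ 2 ≤ I.d p i ^ 2)
    (hW : W * I.d p j ^ 2 ≤ P) (hT : IsTree I el T' p I.n ((liveOf I T).erase j)) :
    Closed I el uf α f τ p T' (W + I.w j) (P + I.w j * I.d p j ^ 2) := by
  have e : liveOf I T' = (liveOf I T).erase j :=
    hT.liveOf_eq ((Finset.erase_subset _ _).trans liveOf_subset)
  have hjuf := h.sub hj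
  have e2 : uf \ liveOf I T' = insert j (uf \ liveOf I T) := by
    ext i
    simp only [e, Finset.mem_sdiff, Finset.mem_erase, Finset.mem_insert, not_and_or, not_not]
    constructor
    · rintro ⟨h1, rfl | h2⟩
      · exact Or.inl rfl
      · exact Or.inr ⟨h1, h2⟩
    · rintro (rfl | ⟨h1, h2⟩)
      · exact ⟨hjuf, Or.inl rfl⟩
      · exact ⟨h1, Or.inr h2⟩
  have hn : j ∉ uf \ liveOf I T := fun h' => (Finset.mem_sdiff.1 h').2 hj
  have hw := hI.w_nonneg j
  refine ⟨by rw [e]; exact hT, by rw [e]; exact (Finset.erase_subset _ _).trans h.sub, ?_, ?_, ?_,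
    ?_, ?_, ?_⟩
  · rw [e2, Finset.sum_insert hn, ← h.weight]; ring
  · rw [e2, Finset.sum_insert hn, h.price]; ring
  -- The clients that left the tree earlier are no farther than `j`, by `ord`, so the bound on `W *
  -- d²` survives adding `w j` on the left and `w j * d(p, j)²` on the right.
  · intro i hi
    rw [e2, Finset.mem_insert] at hi
    rcases hi with rfl | hi
    · linarith
    · have h1 := h.near i hi
      have h2 := h.ord i hi j hj
      have := mul_le_mul_of_nonneg_left h2 hw
      linarith
  · have h1 := h.time
    have := mul_le_mul_of_nonneg_left (h.far j hj) hw
    linarith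
  · intro i hi
    rw [e] at hi
    exact h.far i (Finset.mem_of_mem_erase hi)
  · intro i hi l hl
    rw [e2, Finset.mem_insert] at hi
    rw [e] at hl
    have hl' := Finset.mem_of_mem_erase hl
    rcases hi with rfl | hi
    · exact hmin l hl'
    · exact h.ord i hi l hl'

theorem paid_freeze (hj : j ∈ uf) (hjn : j < I.n) (q : ℕ) :
    paid I (uf.erase j) (Function.update α j t) q =
      paid I uf α q + I.w j * max (t - I.d q j ^ 2) 0 := by
  have e : Finset.range I.n \ uf.erase j = insert j (Finset.range I.n \ uf) := by
    ext i
    simp only [Finset.mem_sdiff, Finset.mem_erase, Finset.mem_insert, Finset.mem_range, not_and_or,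
      not_not]
    constructor
    · rintro ⟨h1, h2 | h2⟩
      · exact Or.inl h2
      · exact Or.inr ⟨h1, h2⟩
    · rintro (h1 | ⟨h1, h2⟩)
      · exact ⟨h1 ▸ hjn, Or.inl h1⟩
      · exact ⟨h1, Or.inr h2⟩
  have hn : j ∉ Finset.range I.n \ uf := fun h => (Finset.mem_sdiff.1 h).2 hj
  rw [paid, e, Finset.sum_insert hn, Function.update_self, paid, add_comm]
  congr 1
  refine Finset.sum_congr rfl fun i hi => ?_
  rw [Function.update_of_ne (by rintro rfl; exact hn hi)]

/-- Time passes until the next event. -/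
theorem Closed.lt_of_settled (hI : I.IsMetric) (h : Closed I el uf α f τ p T W P)
    (hs : Settled I p T W P) (ht : t * W ≤ P) (hj : j ∈ liveOf I T) : t < I.d p j ^ 2 := by
  have h1 := hs j hj
  have h2 := h.weight_nonneg hI
  by_contra hlt
  push Not at hlt
  have := mul_le_mul_of_nonneg_left hlt h2
  linarith

theorem Closed.advance (hI : I.IsMetric) (h : Closed I el uf α f τ p T W P)
    (hs : Settled I p T W P) (ht : t * W ≤ P) : Closed I el uf α f t p T W P :=
  ⟨h.tree, h.sub, h.weight, h.price, h.near, ht, fun _ hj => (h.lt_of_settled hI hs ht hj).le,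
    h.ord⟩

/-- A live client is frozen. -/
theorem Closed.freeze_live (hI : I.IsMetric) (h : Closed I el uf α f τ p T W P)
    (hs : Settled I p T W P) (ht : t * W ≤ P) (hj : j ∈ liveOf I T)
    (hT : IsTree I el T' p I.n ((liveOf I T).erase j)) :
    Closed I el (uf.erase j) (Function.update α j t) f t p T' W P := by
  have e : liveOf I T' = (liveOf I T).erase j :=
    hT.liveOf_eq ((Finset.erase_subset _ _).trans liveOf_subset)
  have hjuf := h.sub hj
  have hjn : j < I.n := Finset.mem_range.1 (liveOf_subset hj)
  have e2 : uf.erase j \ liveOf I T' = uf \ liveOf I T := by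
    ext i
    simp only [e, Finset.mem_sdiff, Finset.mem_erase]
    constructor
    · rintro ⟨⟨h1, h2⟩, h3⟩
      exact ⟨h2, fun h4 => h3 ⟨h1, h4⟩⟩
    · rintro ⟨h1, h2⟩
      have : i ≠ j := fun h => h2 (h ▸ hj)
      exact ⟨⟨this, h1⟩, fun h => h2 h.2⟩
  have h0 := h.lt_of_settled hI hs ht hj
  refine ⟨by rw [e]; exact hT, by rw [e]; exact Finset.erase_subset_erase _ h.sub, ?_, ?_, ?_, ht,
    ?_, ?_⟩
  · rw [e2]; exact h.weight
  · rw [e2, paid_freeze hjuf hjn, max_eq_right (by linarith), mul_zero, add_zero]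
    exact h.price
  · rw [e2]; exact h.near
  · intro i hi
    rw [e] at hi
    exact (h.lt_of_settled hI hs ht (Finset.mem_of_mem_erase hi)).le
  · rw [e2]
    intro i hi l hl
    rw [e] at hl
    exact h.ord i hi l (Finset.mem_of_mem_erase hl)

/-- A client that pays for the facility is frozen. -/
theorem Closed.freeze_near (hI : I.IsMetric) (h : Closed I el uf α f τ p T W P)
    -- A client outside the tree lies within the prospective opening time but perhaps beyond `t`. If
    -- it has been reached, the part of its payment made up to `t` becomes fixed and `P` loses `w j
    -- * t`; if not, it never pays and `P` loses `w j * d²`. The maximum covers both cases.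
    (hs : Settled I p T W P) (ht : t * W ≤ P) (hj : j ∈ uf \ liveOf I T) (hjn : j < I.n) :
    Closed I el (uf.erase j) (Function.update α j t) f t p T (W - I.w j)
      (P - I.w j * max t (I.d p j ^ 2)) := by
  have hj' := Finset.mem_sdiff.1 hj
  have e2 : uf.erase j \ liveOf I T = (uf \ liveOf I T).erase j := by
    ext i
    simp only [Finset.mem_sdiff, Finset.mem_erase]; tauto
  have hw := hI.w_nonneg j
  have hwW := h.le_weight hI hj
  set y := max t (I.d p j ^ 2) with hy
  have hyP : W * y ≤ P := by
    rcases max_choice t (I.d p j ^ 2) with hc | hc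
    · rw [hy, hc]; linarith
    · rw [hy, hc]; exact h.near j hj
  -- Losing a client does not make the facility open earlier: every time that was at most the
  -- opening time remains so.
  have key : ∀ z, W * z ≤ P → (W - I.w j) * z ≤ P - I.w j * y := by
    intro z hz
    rcases le_total z y with hzy | hzy
    · have := mul_le_mul_of_nonneg_left hzy (sub_nonneg.2 hwW)
      linarith
    · have := mul_le_mul_of_nonneg_left hzy hw
      linarith
  refine ⟨h.tree, ?_, ?_, ?_, ?_, ?_, ?_, ?_⟩
  · intro i hi
    exact Finset.mem_erase.2 ⟨fun e => hj'.2 (e ▸ hi), h.sub hi⟩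
  · rw [e2, h.weight, ← Finset.add_sum_erase _ _ hj]; ring
  · have hsplit := Finset.add_sum_erase _ (fun j => I.w j * I.d p j ^ 2) hj
    have hmax : y = max (t - I.d p j ^ 2) 0 + I.d p j ^ 2 := by
      rw [hy, max_add, sub_add_cancel, zero_add]
    rw [e2, paid_freeze hj'.1 hjn, h.price, ← hsplit, hmax]; ring
  · intro i hi
    rw [e2] at hi
    exact key _ (h.near i (Finset.mem_of_mem_erase hi))
  · have := key t (by linarith)
    linarith
  · exact fun i hi => (h.lt_of_settled hI hs ht hi).le
  · rw [e2]
    exact fun i hi l hl => h.ord i (Finset.mem_of_mem_erase hi) l hl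

theorem Opened.advance (h : Opened I el uf α f τ p T R) (hτ : τ ≤ t)
    (ht : ∀ j ∈ uf, t ≤ max R (I.d p j ^ 2)) : Opened I el uf α f t p T R :=
  ⟨h.tree, h.le.trans hτ, h.price, h.bounded, ht⟩

theorem Opened.freeze (h : Opened I el uf α f τ p T R) (hτ : τ ≤ t)
    (ht : ∀ j ∈ uf, t ≤ max R (I.d p j ^ 2)) (hj : j ∈ uf) (hjn : j < I.n)
    (hT : IsTree I el T' p I.n (uf.erase j)) :
    Opened I el (uf.erase j) (Function.update α j t) f t p T' R := by
  have hR := h.le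
  have htj := ht j hj
  refine ⟨hT, hR.trans hτ, ?_, ?_, fun i hi => ht i (Finset.mem_of_mem_erase hi)⟩
  · rw [paid_freeze hj hjn, ← h.price, ← Finset.add_sum_erase _ _ hj]
    -- Freezing at `t` instead of the opening time `R` does not change the payment: a client beyond
    -- `R` is frozen no later than it is reached and pays nothing, and for one within `R` the bounds
    -- force `t = R`.
    have : max (t - I.d p j ^ 2) 0 = max (R - I.d p j ^ 2) 0 := by
      rcases le_total R (I.d p j ^ 2) with hc | hc
      · rw [max_eq_right hc] at htj
        rw [max_eq_right (by linarith), max_eq_right (by linarith)]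
      · rw [max_eq_left hc] at htj
        rw [le_antisymm htj (hR.trans hτ)]
    rw [this]; ring
  · intro i hi
    by_cases hij : i = j
    · subst hij; rw [Function.update_self]; exact htj
    · rw [Function.update_of_ne hij]
      refine h.bounded i ?_
      simp only [Finset.mem_sdiff, Finset.mem_erase, not_and] at hi ⊢
      exact ⟨hi.1, fun h => hi.2 hij h⟩

/-- A closed facility opens. -/
theorem Closed.opened (h : Closed I el uf α f τ p T W P)
    (hs : Settled I p T W P) (hW : 0 < W) (hτ : ∀ j ∈ Finset.range I.n \ uf, α j ≤ τ)
    (hT : IsTree I el T' p I.n uf) : Opened I el uf α f (P / W) p T' (P / W) := by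
  have hτt : τ ≤ P / W := by
    rw [le_div_iff₀ hW]; exact h.time
  refine ⟨hT, le_rfl, ?_, fun j hj => ((hτ j hj).trans hτt).trans (le_max_left _ _),
    fun j _ => le_max_left _ _⟩
  -- The clients still in the tree are beyond the opening time and pay nothing; those outside are
  -- within it, so their payments are linear in it and `price` gives exactly `f`.
  have e1 : ∑ j ∈ liveOf I T, I.w j * max (P / W - I.d p j ^ 2) 0 = 0 := by
    refine Finset.sum_eq_zero fun j hj => ?_
    have := hs j hj
    rw [max_eq_right, mul_zero]
    rw [sub_nonpos, div_le_iff₀ hW]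
    linarith
  have e2 : ∑ j ∈ uf \ liveOf I T, I.w j * max (P / W - I.d p j ^ 2) 0 =
      ∑ j ∈ uf \ liveOf I T, (I.w j * (P / W) - I.w j * I.d p j ^ 2) := by
    refine Finset.sum_congr rfl fun j hj => ?_
    have := h.near j hj
    rw [max_eq_left, mul_sub]
    rw [sub_nonneg, le_div_iff₀ hW]
    linarith
  rw [← Finset.sum_sdiff h.sub, e1, e2, Finset.sum_sub_distrib, ← Finset.sum_mul, ← h.weight,
    mul_div_cancel₀ _ hW.ne']
  have := h.price
  linarith

/-- A closed facility is not overpaid. -/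
theorem Closed.paid_le (hI : I.IsMetric) (h : Closed I el uf α f τ p T W P) : paid I uf α p ≤ f := by
  -- The weighted sum of the squared distances is at most `W` times the largest of them, which
  -- `near` bounds by `P`.
  have h1 : ∑ j ∈ uf \ liveOf I T, I.w j * I.d p j ^ 2 ≤ P := by
    rcases (uf \ liveOf I T).eq_empty_or_nonempty with he | ⟨j₀, hj₀⟩
    · rw [he, Finset.sum_empty]
      have h2 := h.time
      have h3 := h.weight
      rw [he, Finset.sum_empty] at h3
      rw [h3] at h2; linarith
    · obtain ⟨m, hm, hmax⟩ := Finset.exists_max_image (uf \ liveOf I T) (fun j => I.d p j ^ 2)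
        ⟨j₀, hj₀⟩
      calc ∑ j ∈ uf \ liveOf I T, I.w j * I.d p j ^ 2
          ≤ ∑ j ∈ uf \ liveOf I T, I.w j * I.d p m ^ 2 :=
            Finset.sum_le_sum fun j hj => mul_le_mul_of_nonneg_left (hmax j hj) (hI.w_nonneg j)
        _ = W * I.d p m ^ 2 := by rw [← Finset.sum_mul, ← h.weight]
        _ ≤ P := h.near m hm
  have := h.price
  linarith

end
/-! ## The primal-dual method: the program for one facility -/

theorem IsTree.root_nearest {I : Input} (hI : I.IsMetric) {el T : ℕ → ℕ} {x q : ℕ}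
    {live : Finset ℕ} (h : IsTree I el T x q live) (hel : ∀ j < q, el j = j)
    (hl : live ⊆ Finset.range q) (hq : 1 ≤ q) (h1 : T 1 ≠ 0) :
    T 1 - 1 < q ∧ T 1 - 1 ∈ live ∧ ∀ j ∈ live, I.d x (T 1 - 1) ^ 2 ≤ I.d x j ^ 2 := by
  obtain ⟨a, b, c⟩ := h.root hq h1
  refine ⟨a, b, fun j hj => ?_⟩
  have hjq := Finset.mem_range.1 (hl hj)
  have := c j hjq hj
  rw [hel _ a, hel _ hjq] at this
  exact pow_le_pow_left₀ (hI.nonneg _ _) this 2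

/-- The states `s` and `s'` agree on the data of the facility `p`. -/
structure SameFac (I : Input) (p : ℕ) (s s' : State) : Prop where
  row : ∀ v < 2 * I.n, row I s' p v = row I s p v
  flag : s'.warr 5 p = s.warr 5 p
  weight : s'.rarr 1 p = s.rarr 1 p
  price : s'.rarr 2 p = s.rarr 2 p
  radius : s'.rarr 3 p = s.rarr 3 p

theorem SameFac.refl (I : Input) (p : ℕ) (s : State) : SameFac I p s s :=
  ⟨fun _ _ => rfl, rfl, rfl, rfl, rfl⟩

theorem SameFac.trans {I : Input} {p : ℕ} {s s₁ s₂ : State} (h : SameFac I p s s₁)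
    (h' : SameFac I p s₁ s₂) : SameFac I p s s₂ :=
  ⟨fun v hv => (h'.row v hv).trans (h.row v hv), h'.flag.trans h.flag, h'.weight.trans h.weight,
    h'.price.trans h.price, h'.radius.trans h.radius⟩

/-- The squared distance from the facility of word variable `13` to the nearest live leaf in the row
of word variable `2`. -/
def nearestDist : RExp :=
  .dist (.var 13) (.get 1 (.var 2 +ʷ .lit 1) -ʷ .lit 1) *ʳ
    .dist (.var 13) (.get 1 (.var 2 +ʷ .lit 1) -ʷ .lit 1)

/-- Remove all clients that are near enough to pay from the tree of the facility of word variable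
`13`. -/
def pop : Prog :=
  .loop (.conj (.pos (.get 1 (.var 2 +ʷ .lit 1)))
      (.rle (.get 1 (.var 13) *ʳ nearestDist) (.get 2 (.var 13)))) (
    4 ≔ʷ .get 1 (.var 2 +ʷ .lit 1) -ʷ .lit 1 ;;
    .setRArr 1 (.var 13) (.get 1 (.var 13) +ʳ .weight (.var 4)) ;;
    .setRArr 2 (.var 13) (.get 2 (.var 13) +ʳ .weight (.var 4) *ʳ
      (.dist (.var 13) (.var 4) *ʳ .dist (.var 13) (.var 4))) ;;
    treeSet (.lit 0))

/-- The facility `p` is closed, and all clients that are near enough have left its tree. -/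
def ClosedAt (I : Input) (el : ℕ → ℕ) (uf : Finset ℕ) (α : ℕ → ℝ) (f τ : ℝ) (p : ℕ) (s : State) :
    Prop :=
  Closed I el uf α f τ p (row I s p) (s.rarr 1 p) (s.rarr 2 p) ∧
    Settled I p (row I s p) (s.rarr 1 p) (s.rarr 2 p)

/-- A popped client still has `W * d² ≤ P` with the new values, so earlier pops remain justified and
the loop ends with `Settled`. Each round is charged to the leaf it removes. -/
theorem pop_spec {I : Input} {M : ℕ} (hI : I.IsMetric) (hM : 1000 * (I.n + 2) ^ 6 ≤ M) {s : State}
    {el : ℕ → ℕ} {uf : Finset ℕ} {α : ℕ → ℝ} {f τ : ℝ} {p : ℕ} (hat : TreeAt I s p p I.n)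
    (h13 : s.wvar 13 = p) (hel : s.warr 2 = el) (hid : ∀ j < I.n, el j = j)
    (h : Closed I el uf α f τ p (row I s p) (s.rarr 1 p) (s.rarr 2 p)) :
    WP I M pop (fun s' t => t + (liveOf I (row I s' p)).card * (170 * levels I.n) ≤
        (liveOf I (row I s p)).card * (170 * levels I.n) + 40 ∧
      ClosedAt I el uf α f τ p s' ∧ ∀ q, q ≠ p → SameFac I q s s') s := by
  have hl := levels_pos I.n
  have hp := hat.row_lt
  have e1 : 1 % M = 1 := Nat.mod_eq_of_lt (small_lt hM (by omega))
  have er : (p * (2 * I.n) + 1) % M = p * (2 * I.n) + 1 :=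
    Nat.mod_eq_of_lt (row_lt hM hp (by omega))
  refine wp_loop (fun s₁ t => t + (liveOf I (row I s₁ p)).card * (170 * levels I.n) ≤
        (liveOf I (row I s p)).card * (170 * levels I.n) ∧
      Closed I el uf α f τ p (row I s₁ p) (s₁.rarr 1 p) (s₁.rarr 2 p) ∧
      ∀ q, q ≠ p → SameFac I q s s₁) (fun s₁ => (liveOf I (row I s₁ p)).card)
    ⟨by omega, h, fun q _ => .refl I q s⟩ ?_ ?_
  · rintro s₁ t hf ⟨ht, hc, hsame⟩ hb
    have hat₁ := hat.frame (s' := s₁) (hf.wvar 2 rfl) (hf.wvar 3 rfl) (hf.wvar 5 rfl)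
    have h13₁ : s₁.wvar 13 = p := (hf.wvar 13 rfl).trans h13
    have hel₁ : s₁.warr 2 = el := (hf.warr 2 rfl).trans hel
    simp only [Test.holds_conj, Test.holds_pos, Test.holds_rle, nearestDist, WExp.eval, RExp.eval,
      hat₁.base, h13₁, e1, er] at hb
    obtain ⟨hb1, hb2⟩ := hb
    obtain ⟨hj, hjl, hmin⟩ := hc.tree.root_nearest hI hid liveOf_subset (by omega) hb1
    set j := row I s₁ p 1 - 1 with hjdef
    have hb2' : s₁.rarr 1 p * I.d p j ^ 2 ≤ s₁.rarr 2 p := by rw [sq]; exact hb2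
    simp only [wp_seq, wp_setW, wp_setRArr, WExp.eval, RExp.eval, WExp.time, RExp.time, hat₁.base,
      State.setW_wvar, State.setRArr_wvar, State.setW_rarr, State.setRArr_rarr, h13₁, e1, er,
      if_true, nearestDist, Test.time, Test.time_pos]
    norm_num only [if_true, if_false]
    change WP I M _ _ (((s₁.setW 4 j).setRArr 1 p _).setRArr 2 p _)
    set s₂ := ((s₁.setW 4 j).setRArr 1 p (s₁.rarr 1 p + I.w j)).setRArr 2 p
      (s₁.rarr 2 p + I.w j * (I.d p j * I.d p j)) with hs₂
    have hat₂ : TreeAt I s₂ p p I.n := hat₁.frame (by simp [hs₂]) (by simp [hs₂]) (by simp [hs₂])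
    refine (treeSet_erase hM hat₂ (j := j) (by simp [hs₂]) hj
      (live := liveOf I (row I s₁ p)) (by simpa [hs₂, hel₁] using hc.tree)).call ?_
    rintro s₃ t₃ hf₃ ⟨ht₃, htree, hrows⟩
    have hw : s₃.rarr 1 p = s₁.rarr 1 p + I.w j := by rw [hf₃.rarr 1 rfl]; simp [hs₂]
    have hpr : s₃.rarr 2 p = s₁.rarr 2 p + I.w j * I.d p j ^ 2 := by
      rw [hf₃.rarr 2 rfl]; simp [hs₂, sq]
    have htree' : IsTree I el (row I s₃ p) p I.n ((liveOf I (row I s₁ p)).erase j) := by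
      rw [← hel₁]; exact htree
    have hlive := htree'.liveOf_eq ((Finset.erase_subset _ _).trans liveOf_subset)
    have hcard := Finset.card_erase_add_one hjl
    rw [← hlive] at hcard
    refine ⟨⟨?_, ?_, fun q hq => (hsame q hq).trans ?_⟩, by omega⟩
    · rw [← hcard] at ht
      have : ((liveOf I (row I s₃ p)).card + 1) * (170 * levels I.n) =
        (liveOf I (row I s₃ p)).card * (170 * levels I.n) + 170 * levels I.n := by ring
      omega
    · rw [hw, hpr]
      exact hc.pop hI hjl hmin hb2' htree'
    · refine ⟨fun v hv => hrows q hq v hv, ?_, ?_, ?_, ?_⟩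
      · rw [hf₃.warr 5 rfl]; rfl
      · rw [hf₃.rarr 1 rfl]; simp [hs₂, hq]
      · rw [hf₃.rarr 2 rfl]; simp [hs₂, hq]
      · rw [hf₃.rarr 3 rfl]; simp [hs₂]
  · rintro s₁ t hf ⟨ht, hc, hsame⟩ hb
    have hat₁ := hat.frame (s' := s₁) (hf.wvar 2 rfl) (hf.wvar 3 rfl) (hf.wvar 5 rfl)
    have h13₁ : s₁.wvar 13 = p := (hf.wvar 13 rfl).trans h13
    simp only [Test.holds_conj, Test.holds_pos, Test.holds_rle, nearestDist, WExp.eval, RExp.eval,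
      hat₁.base, h13₁, e1, er] at hb
    refine ⟨?_, ⟨hc, ?_⟩, hsame⟩
    · simp only [nearestDist, Test.time, Test.time_pos, WExp.time, RExp.time]
      omega
    · intro i hi
      by_cases h0 : row I s₁ p 1 = 0
      · exact absurd hi (hc.tree.root_eq_zero h0 i (Finset.mem_range.1 (liveOf_subset hi)))
      · obtain ⟨hj, hjl, hmin⟩ := hc.tree.root_nearest hI hid liveOf_subset (by omega) h0
        have h2 : ¬ s₁.rarr 1 p * (I.d p (row I s₁ p 1 - 1) * I.d p (row I s₁ p 1 - 1)) ≤
          s₁.rarr 2 p := fun h => hb ⟨h0, h⟩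
        rw [← sq, not_le] at h2
        exact h2.trans_le (mul_le_mul_of_nonneg_left (hmin i hi) (hc.weight_nonneg hI))

/-- The facilities are `fac 0, …, fac (mf - 1)`. -/
structure FacList (I : Input) (mf : ℕ) (fac el : ℕ → ℕ) (s : State) : Prop where
  w0 : s.wvar 0 = I.n
  w5 : s.wvar 5 = I.n
  w18 : s.wvar 18 = mf
  wa4 : s.warr 4 = fac
  wa2 : s.warr 2 = el
  id : ∀ j < I.n, el j = j
  lt : ∀ i < mf, fac i < I.n
  inj : Set.InjOn fac (Finset.range mf)
  le : mf ≤ I.n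

/-- Treat all facilities. -/
def forFac (body : Prog) : Prog :=
  .forIn 19 (.lit 0) (.var 18) (13 ≔ʷ .get 4 (.var 19) ;; turn ;; body)

/-- The potential of the facility `p`: a closed facility has to remove its clients from its tree and
to open. -/
def potential (I : Input) (s : State) (p : ℕ) : ℕ :=
  if s.warr 5 p = 0 then (liveOf I (row I s p)).card * (170 * levels I.n) +
    1000 * ((I.n + 1) * levels I.n) else 0

theorem SameFac.potential {I : Input} {p : ℕ} {s s' : State} (h : SameFac I p s s') :
    potential I s' p = potential I s p := by
  rw [KMeans.potential, KMeans.potential, h.flag, liveOf_congr h.row]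

theorem potential_le (I : Input) (s : State) (p : ℕ) :
    potential I s p ≤ 1170 * ((I.n + 1) * levels I.n) := by
  rw [potential]
  split_ifs
  · have : (liveOf I (row I s p)).card ≤ I.n := by
      simpa using Finset.card_le_card (liveOf_subset (I := I) (T := row I s p))
    have := Nat.mul_le_mul_right (170 * levels I.n) this
    nlinarith
  · exact Nat.zero_le _

/-- The body changes the data of its own facility only, so the goal `Q i` reached there survives the
later rounds. Its time may exceed `C` by the drop of that facility's potential, and these drops add
up over the facilities. -/
theorem forFac_spec {I : Input} {M : ℕ} (hM : 1000 * (I.n + 2) ^ 6 ≤ M) {s : State} {mf C : ℕ}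
    {fac el : ℕ → ℕ} {body : Prog} (h : FacList I mf fac el s)
    (hw0 : body.writesW 0 = false) (hw5 : body.writesW 5 = false)
    (hw18 : body.writesW 18 = false) (hw19 : body.writesW 19 = false)
    (hwa2 : body.writesWA 2 = false) (hwa4 : body.writesWA 4 = false) (Q : ℕ → State → Prop)
    (hQ : ∀ i s₁ s₂, SameFac I (fac i) s₁ s₂ → Q i s₁ → Q i s₂)
    (hbody : ∀ i < mf, ∀ s₁, Frame (forFac body) s s₁ → FacList I mf fac el s₁ →
      s₁.wvar 13 = fac i → TreeAt I s₁ (fac i) (fac i) I.n → SameFac I (fac i) s s₁ →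
      WP I M body (fun s' t => t + potential I s' (fac i) ≤ potential I s (fac i) + C ∧
        Q i s' ∧ ∀ q, q ≠ fac i → SameFac I q s₁ s') s₁) :
    WP I M (forFac body) (fun s' t =>
      t + ∑ i ∈ Finset.range mf, potential I s' (fac i) ≤
        ∑ i ∈ Finset.range mf, potential I s (fac i) + (mf + 1) * (C + 30) ∧
      FacList I mf fac el s' ∧ (∀ i < mf, Q i s') ∧
      ∀ q, (∀ i < mf, q ≠ fac i) → SameFac I q s s') s := by
  have fl : ∀ s₁, Frame (forFac body) s s₁ → FacList I mf fac el s₁ := by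
    intro s₁ hf
    refine ⟨?_, ?_, ?_, ?_, ?_, h.id, h.lt, h.inj, h.le⟩
    · rw [hf.wvar 0 (by simp [forFac, Prog.forIn, turn, Prog.writesW, hw0]), h.w0]
    · rw [hf.wvar 5 (by simp [forFac, Prog.forIn, turn, Prog.writesW, hw5]), h.w5]
    · rw [hf.wvar 18 (by simp [forFac, Prog.forIn, turn, Prog.writesW, hw18]), h.w18]
    · rw [hf.warr 4 (by simp [forFac, Prog.forIn, turn, Prog.writesWA, hwa4]), h.wa4]
    · rw [hf.warr 2 (by simp [forFac, Prog.forIn, turn, Prog.writesWA, hwa2]), h.wa2]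
  have hne : ∀ i < mf, ∀ i' < mf, i' ≠ i → fac i' ≠ fac i := fun i hi i' hi' hii e =>
    hii (h.inj (by simpa using hi') (by simpa using hi) e)
  refine wp_for 0 mf (fun i s₁ t => t + ∑ i' ∈ Finset.range i, potential I s₁ (fac i') ≤
      ∑ i' ∈ Finset.range i, potential I s (fac i') + i * (C + 30) + 2 ∧
      (∀ i' < i, Q i' s₁) ∧ (∀ i' < mf, i ≤ i' → SameFac I (fac i') s s₁) ∧
      ∀ q, (∀ i < mf, q ≠ fac i) → SameFac I q s s₁)
    (by simp [WExp.eval]) (Nat.zero_le _) (small_lt hM (by have := h.le; omega)) ?_ ?_ ?_ ?_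
  · intro i s₁ t hf _
    exact (fl s₁ hf).w18
  · exact ⟨by simp, by simp, fun _ _ _ => ⟨fun _ _ => rfl, rfl, rfl, rfl, rfl⟩,
      fun _ _ => ⟨fun _ _ => rfl, rfl, rfl, rfl, rfl⟩⟩
  · rintro i s₁ t hf - hi hx ⟨ht, hq, hs, ho⟩
    have f₁ := fl s₁ hf
    rw [wp_seq, wp_setW, wp_seq]
    simp only [WExp.eval, WExp.time, f₁.wa4, hx]
    refine turn_spec hM (by simpa using f₁.w0) (x := fac i) (by simp) (h.lt i hi) ?_
    set s₂ := ((s₁.setW 13 (fac i)).setW 2 (fac i * (2 * I.n))).setW 3 (fac i) with hs₂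
    have same₂ : ∀ q, SameFac I q s₁ s₂ := fun q => ⟨fun _ _ => rfl, rfl, rfl, rfl, rfl⟩
    have hf₂ : Frame (forFac body) s s₂ := by
      refine hf.trans ⟨fun y hy => ?_, fun _ _ => rfl, fun _ _ => rfl, fun _ _ => rfl⟩
      simp only [Prog.forIn, turn, Prog.writesW, Bool.or_eq_false_iff, beq_eq_false_iff_ne]
        at hy
      simp [hs₂, hy.2.1.1, hy.2.1.2.1.1, hy.2.1.2.1.2]
    have f₂ := fl s₂ hf₂
    refine (hbody i hi s₂ hf₂ f₂ (by simp [hs₂])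
      ⟨by simp [hs₂], by simp [hs₂], f₂.w5, h.lt i hi, le_rfl⟩
      ((hs i hi le_rfl).trans (same₂ _))).call ?_
    rintro s₃ t₃ hf₃ ⟨ht₃, hq₃, hsame₃⟩
    have same₃ : ∀ q, q ≠ fac i → SameFac I q s₁ (s₃.setW 19 (i + 1)) := fun q hq =>
      ((same₂ q).trans (hsame₃ q hq)).trans ⟨fun _ _ => rfl, rfl, rfl, rfl, rfl⟩
    have same₄ : ∀ q, SameFac I q s₃ (s₃.setW 19 (i + 1)) := fun q =>
      ⟨fun _ _ => rfl, rfl, rfl, rfl, rfl⟩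
    refine ⟨?_, ?_, ?_, ?_, ?_⟩
    · rw [hf₃.wvar 19 hw19]; simp [hs₂, hx]
    · rw [Finset.sum_range_succ, Finset.sum_range_succ, (same₄ _).potential]
      have : ∑ i' ∈ Finset.range i, potential I (s₃.setW 19 (i + 1)) (fac i') =
          ∑ i' ∈ Finset.range i, potential I s₁ (fac i') :=
        Finset.sum_congr rfl fun i' hi' => (same₃ _ (hne i hi i' (by
          have := Finset.mem_range.1 hi'; omega) (by have := Finset.mem_range.1 hi'; omega))).potential
      rw [this]
      have : (i + 1) * (C + 30) = i * (C + 30) + C + 30 := by ring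
      omega
    · intro i' hi'
      by_cases hii : i' = i
      · subst hii; exact hQ _ _ _ (same₄ _) hq₃
      · exact hQ _ _ _ (same₃ _ (hne i hi i' (by omega) hii)) (hq i' (by omega))
    · intro i' hi' hle
      exact (hs i' hi' (by omega)).trans (same₃ _ (hne i hi i' hi' (by omega)))
    · intro q hq
      exact (ho q hq).trans (same₃ q (hq i hi))
  · rintro s₁ t hf - ⟨ht, hq, -, ho⟩
    refine ⟨?_, fl s₁ hf, hq, ho⟩
    simp only [WExp.time]
    have : (mf + 1) * (C + 30) = mf * (C + 30) + C + 30 := by ring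
    omega

/-! ## The primal-dual method: the next event -/

/-- The facility `p` has an event at time `e`: it freezes a client, or it opens. -/
def HasEvent (I : Input) (s : State) (p : ℕ) (e : ℝ) : Prop :=
  (s.warr 5 p ≠ 0 ∧ row I s p 1 ≠ 0 ∧ e = max (s.rarr 3 p) (I.d p (row I s p 1 - 1) ^ 2)) ∨
    (s.warr 5 p = 0 ∧ 0 < s.rarr 1 p ∧ e = s.rarr 2 p / s.rarr 1 p)

theorem HasEvent.congr {I : Input} {s s' : State} {p : ℕ} {e : ℝ} (h1 : s'.warr 1 = s.warr 1)
    (h5 : s'.warr 5 = s.warr 5) (hr : s'.rarr = s.rarr) : HasEvent I s' p e ↔ HasEvent I s p e := by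
  rw [HasEvent, HasEvent, row_frame I h1, h5, hr]

theorem HasEvent.unique {I : Input} {s : State} {p : ℕ} {e e' : ℝ} (h : HasEvent I s p e)
    (h' : HasEvent I s p e') : e = e' := by
  rcases h with ⟨a, -, b⟩ | ⟨a, -, b⟩ <;> rcases h' with ⟨c, -, d⟩ | ⟨c, -, d⟩
  · rw [b, d]
  · exact absurd c a
  · exact absurd a c
  · rw [b, d]

/-- Compute the event of the facility of word variable `13` in real variable `1`, and set word
variable `22` if there is one. -/
def eventOf : Prog :=
  22 ≔ʷ .lit 0 ;;
  .branch (.pos (.get 5 (.var 13)))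
    (.branch (.pos (.get 1 (.var 2 +ʷ .lit 1)))
      (22 ≔ʷ .lit 1 ;; 1 ≔ʳ nearestDist ;;
        .branch (.rle (.var 1) (.get 3 (.var 13))) (1 ≔ʳ .get 3 (.var 13)) .skip) .skip)
    (.branch (.rlt (.lit 0) (.get 1 (.var 13)))
      (22 ≔ʷ .lit 1 ;; 1 ≔ʳ .get 2 (.var 13) /ʳ .get 1 (.var 13)) .skip)

/-- Find the next event. Word variable `20` is its facility, or the number of points if there is
none, and real variable `2` is its time. -/
def select : Prog :=
  20 ≔ʷ .var 0 ;;
  forFac (eventOf ;;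
    .branch (.conj (.pos (.var 22)) (.disj (.wle (.var 0) (.var 20)) (.rlt (.var 1) (.var 2))))
      (2 ≔ʳ .var 1 ;; 20 ≔ʷ .var 13) .skip)

theorem eventOf_spec {I : Input} {M : ℕ} (hM : 1000 * (I.n + 2) ^ 6 ≤ M) {s : State} {p : ℕ}
    (hp : p < I.n) (h2 : s.wvar 2 = p * (2 * I.n)) (h13 : s.wvar 13 = p) :
    WP I M eventOf (fun s' t => t ≤ 60 ∧
      (s'.wvar 22 = 0 ∧ (∀ e, ¬ HasEvent I s p e) ∨
        s'.wvar 22 ≠ 0 ∧ HasEvent I s p (s'.rvar 1))) s := by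
  have e0 : 0 % M = 0 := Nat.zero_mod M
  have e1 : 1 % M = 1 := Nat.mod_eq_of_lt (small_lt hM (by omega))
  have er : (p * (2 * I.n) + 1) % M = p * (2 * I.n) + 1 :=
    Nat.mod_eq_of_lt (row_lt hM hp (by omega))
  rw [eventOf, wp_seq, wp_setW]
  simp only [WExp.eval, WExp.time, e0]
  refine wp_branch (fun hb => ?_) (fun hb => ?_)
  · have ho : s.warr 5 p ≠ 0 := by simpa [WExp.eval, h13] using hb
    refine wp_branch (fun hb => ?_) (fun hb => ?_)
    · have hr : row I s p 1 ≠ 0 := by simpa [WExp.eval, h13, h2, e1, er, row] using hb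
      simp only [wp_seq, wp_setW, wp_setR]
      refine wp_branch (fun hb => ?_) (fun hb => ?_)
      · simp only [Test.holds_rle, nearestDist, RExp.eval, WExp.eval, State.setR_rvar,
          State.setW_wvar, State.setR_wvar, State.setW_warr, State.setR_rarr, State.setW_rarr, e1,
          h13, h2] at hb
        norm_num only [if_true, if_false] at hb
        rw [er] at hb
        simp only [wp_setR, nearestDist, Test.time, Test.time_pos, WExp.time, RExp.time]
        refine ⟨by norm_num, Or.inr ⟨by simp [WExp.eval, e1], Or.inl ⟨ho, hr, ?_⟩⟩⟩
        rw [max_eq_left]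
        · simp [RExp.eval, WExp.eval, h13]
        · rw [sq]; exact hb
      · simp only [Test.holds_rle, nearestDist, RExp.eval, WExp.eval, State.setR_rvar,
          State.setW_wvar, State.setR_wvar, State.setW_warr, State.setR_rarr, State.setW_rarr, e1,
          h13, h2] at hb
        norm_num only [if_true, if_false] at hb
        rw [er] at hb
        rw [wp_skip]
        simp only [nearestDist, Test.time, Test.time_pos, WExp.time, RExp.time]
        refine ⟨by norm_num, Or.inr ⟨by simp [WExp.eval, e1], Or.inl ⟨ho, hr, ?_⟩⟩⟩
        rw [max_eq_right]
        · simp only [RExp.eval, WExp.eval, State.setR_rvar, if_true, State.setW_wvar,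
            State.setW_warr, e1]
          norm_num only [if_true, if_false]
          rw [h2, er, h13, sq]; rfl
        · rw [sq]; exact (not_le.1 hb).le
    · have hr : row I s p 1 = 0 := by simpa [WExp.eval, h13, h2, e1, er, row] using hb
      rw [wp_skip]
      simp only [Test.time_pos, WExp.time]
      refine ⟨by norm_num, Or.inl ⟨by simp, ?_⟩⟩
      rintro e (⟨-, h, -⟩ | ⟨h, -⟩)
      · exact h hr
      · exact ho h
  · have ho : s.warr 5 p = 0 := by simpa [WExp.eval, h13] using hb
    refine wp_branch (fun hb => ?_) (fun hb => ?_)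
    · have hr : 0 < s.rarr 1 p := by simpa [WExp.eval, RExp.eval, h13] using hb
      simp only [wp_seq, wp_setW, wp_setR, WExp.time, RExp.time, Test.time_rlt, Test.time_pos]
      refine ⟨by norm_num, Or.inr ⟨by simp [WExp.eval, e1], Or.inr ⟨ho, hr, ?_⟩⟩⟩
      simp [RExp.eval, WExp.eval, h13]
    · have hr : ¬ 0 < s.rarr 1 p := by simpa [WExp.eval, RExp.eval, h13] using hb
      rw [wp_skip]
      simp only [Test.time_pos, Test.time_rlt, WExp.time, RExp.time]
      refine ⟨by norm_num, Or.inl ⟨by simp, ?_⟩⟩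
      rintro e (⟨h, -, -⟩ | ⟨-, h, -⟩)
      · exact h ho
      · exact hr h

/-- The facility `p` has the first event among the first `i` facilities, at time `e`; if there is no
event, then `p = n`. -/
def FirstEvent (I : Input) (fac : ℕ → ℕ) (s : State) (i p : ℕ) (e : ℝ) : Prop :=
  p = I.n ∧ (∀ i' < i, ∀ e', ¬ HasEvent I s (fac i') e') ∨
    (∃ i' < i, p = fac i') ∧ HasEvent I s p e ∧ ∀ i' < i, ∀ e', HasEvent I s (fac i') e' → e ≤ e'

theorem FirstEvent.congr {I : Input} {fac : ℕ → ℕ} {s s' : State} {i p : ℕ} {e : ℝ}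
    (h : FirstEvent I fac s i p e) (h1 : s'.warr 1 = s.warr 1)
    (h5 : s'.warr 5 = s.warr 5) (hr : s'.rarr = s.rarr) : FirstEvent I fac s' i p e := by
  simpa only [FirstEvent, HasEvent.congr h1 h5 hr] using h

/-- A running minimum over the facilities. The initial value `n` of word variable `20` is no
facility, so it can mean that there is no event. -/
theorem select_spec {I : Input} {M : ℕ} (hM : 1000 * (I.n + 2) ^ 6 ≤ M) {s : State} {mf : ℕ}
    {fac el : ℕ → ℕ} (h : FacList I mf fac el s) :
    WP I M select (fun s' t => t ≤ 200 * (mf + 1) ∧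
      FirstEvent I fac s' mf (s'.wvar 20) (s'.rvar 2)) s := by
  rw [select, wp_seq, wp_setW]
  simp only [WExp.eval, WExp.time, h.w0]
  refine wp_for_le 0 mf 100 (fun i s₁ => FirstEvent I fac s i (s₁.wvar 20) (s₁.rvar 2))
    (by simp [WExp.eval]) (Nat.zero_le _) (small_lt hM (by have := h.le; omega)) ?_ ?_ ?_ ?_
  · intro i s₁ hf _
    simp only [WExp.eval, hf.wvar 18 rfl]
    simp [h.w18]
  · exact Or.inl ⟨by simp, fun _ h => absurd h (Nat.not_lt_zero _)⟩
  · rintro i s₁ hf - hi hx hS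
    have w0 : s₁.wvar 0 = I.n := (hf.wvar 0 rfl).trans (by simp [h.w0])
    have hfac : s₁.warr 4 = fac := (hf.warr 4 rfl).trans h.wa4
    have hp := h.lt i hi
    rw [wp_seq, wp_setW, wp_seq]
    simp only [WExp.eval, WExp.time, hfac, hx]
    refine turn_spec hM (by simp [w0]) (x := fac i) (by simp) hp ?_
    set s₂ := ((s₁.setW 13 (fac i)).setW 2 (fac i * (2 * I.n))).setW 3 (fac i) with hs₂
    have hE : ∀ p e, HasEvent I s₂ p e ↔ HasEvent I s p e := fun p e =>
      HasEvent.congr (hf.warr 1 rfl) (hf.warr 5 rfl) (by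
        funext a; exact hf.rarr a rfl)
    rw [wp_seq]
    refine (eventOf_spec hM (s := s₂) hp (by simp [hs₂]) (by simp [hs₂])).call ?_
    rintro s₃ t₃ hf₃ ⟨ht₃, hev⟩
    simp only [hE] at hev
    have w19 : s₃.wvar 19 = i := (hf₃.wvar 19 rfl).trans (by simp [hs₂, hx])
    have w0₃ : s₃.wvar 0 = I.n := (hf₃.wvar 0 rfl).trans (by simp [hs₂, w0])
    have w13 : s₃.wvar 13 = fac i := (hf₃.wvar 13 rfl).trans (by simp [hs₂])
    have w20 : s₃.wvar 20 = s₁.wvar 20 := (hf₃.wvar 20 rfl).trans (by simp [hs₂])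
    have r2 : s₃.rvar 2 = s₁.rvar 2 := hf₃.rvar 2 rfl
    refine wp_branch (fun hb => ?_) (fun hb => ?_)
    · simp only [Test.holds_conj, Test.holds_pos, Test.holds_disj, Test.holds_wle, Test.holds_rlt,
        WExp.eval, RExp.eval, w0₃, w20, r2] at hb
      have hev := (hev.resolve_left fun h => hb.1 h.1).2
      simp only [wp_seq, wp_setR, wp_setW, WExp.eval, RExp.eval, WExp.time, RExp.time, Test.time,
        Test.time_pos, Test.time_disj, Test.time_rlt, State.setR_wvar, w13]
      refine ⟨by omega, by simp [w19], Or.inr ⟨⟨i, by omega, by simp⟩, by simpa using hev, ?_⟩⟩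
      intro i' hi' e' he'
      simp only [State.setW_rvar, State.setR_rvar, if_true]
      rcases Nat.lt_succ_iff_lt_or_eq.1 hi' with hi' | rfl
      · rcases hS with hS | hS
        · exact absurd he' (hS.2 i' hi' e')
        · have h1 := hS.2.2 i' hi' e' he'
          rcases hb.2 with hb | hb
          · obtain ⟨⟨i'', hi'', e⟩, -⟩ := hS
            have := h.lt i'' (by omega)
            omega
          · linarith
      · exact (hev.unique he').le
    · simp only [Test.holds_conj, Test.holds_pos, Test.holds_disj, Test.holds_wle, Test.holds_rlt,
        WExp.eval, RExp.eval, w0₃, w20, r2, not_and_or, not_or, not_not, not_le, not_lt] at hb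
      rw [wp_skip]
      simp only [Test.time, Test.time_pos, Test.time_disj, Test.time_rlt, WExp.time, RExp.time]
      refine ⟨by omega, w19, ?_⟩
      simp only [State.setW_wvar, State.setW_rvar, w20, r2]
      norm_num only [if_true, if_false]
      rcases hS with hS | hS
      · refine Or.inl ⟨hS.1, fun i' hi' e' he' => ?_⟩
        rcases Nat.lt_succ_iff_lt_or_eq.1 hi' with hi' | rfl
        · exact hS.2 i' hi' e' he'
        · rcases hev with hev | hev
          · exact hev.2 e' he'
          · rcases hb with hb | hb
            · exact hev.1 hb
            · omega
      · obtain ⟨⟨i'', hi'', e⟩, h2, h3⟩ := hS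
        refine Or.inr ⟨⟨i'', by omega, e⟩, h2, fun i' hi' e' he' => ?_⟩
        rcases Nat.lt_succ_iff_lt_or_eq.1 hi' with hi' | rfl
        · exact h3 i' hi' e' he'
        · rcases hev with hev | hev
          · exact absurd he' (hev.2 e')
          · rcases hb with hb | hb
            · exact absurd hb hev.1
            · rw [he'.unique hev.2]; exact hb.2
  · rintro s₁ t hf - hS ht
    refine ⟨?_, hS.congr (hf.warr 1 rfl) (hf.warr 5 rfl) (by funext a; exact hf.rarr a rfl)⟩
    simp only [WExp.time, Nat.sub_zero] at ht
    omega

/-! ## The primal-dual method: the phases -/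

/-- The state of the primal-dual method at time `τ`. The facilities flagged in word array `5` are
open, the clients flagged in word array `6` are unfrozen, and the open facilities flagged in word
array `3` are the centres. -/
structure Phase (I : Input) (mf : ℕ) (fac el : ℕ → ℕ) (f : ℝ) (uf : Finset ℕ) (α : ℕ → ℝ) (τ : ℝ)
    (s : State) : Prop where
  list : FacList I mf fac el s
  sub : uf ⊆ Finset.range I.n
  unfrozen : ∀ j < I.n, s.warr 6 j ≠ 0 ↔ j ∈ uf
  closed : ∀ i < mf, s.warr 5 (fac i) = 0 → ClosedAt I el uf α f τ (fac i) s
  opened : ∀ i < mf, s.warr 5 (fac i) ≠ 0 →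
    Opened I el uf α f τ (fac i) (row I s (fac i)) (s.rarr 3 (fac i)) ∧ 0 ≤ s.rarr 3 (fac i)
  nonneg : 0 ≤ τ
  frozen : ∀ j ∈ Finset.range I.n \ uf, α j ≤ τ ∧ ∃ i < mf, s.warr 5 (fac i) ≠ 0 ∧
    s.rarr 3 (fac i) ≤ α j ∧ I.d (fac i) j ^ 2 ≤ α j
  flagged : ∀ y < I.n, s.warr 3 y ≠ 0 → ∃ i < mf, fac i = y ∧ s.warr 5 y ≠ 0
  sep : ∀ y < I.n, ∀ z < I.n, s.warr 3 y ≠ 0 → s.warr 3 z ≠ 0 → y ≠ z →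
    4 * s.rarr 3 y < I.d y z ^ 2 ∨ 4 * s.rarr 3 z < I.d y z ^ 2
  cover : ∀ i < mf, s.warr 5 (fac i) ≠ 0 → ∃ z < I.n, s.warr 3 z ≠ 0 ∧
    I.d (fac i) z ^ 2 ≤ 4 * s.rarr 3 (fac i)

theorem ClosedAt.congr {I : Input} {el : ℕ → ℕ} {uf : Finset ℕ} {α : ℕ → ℝ} {f τ : ℝ} {p : ℕ}
    {s s' : State} (hs : SameFac I p s s') (h : ClosedAt I el uf α f τ p s) :
    ClosedAt I el uf α f τ p s' := by
  rw [ClosedAt, hs.weight, hs.price]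
  exact ⟨h.1.congr hs.row, h.2.congr hs.row⟩

theorem Closed.start {I : Input} {el T : ℕ → ℕ} {f : ℝ} (hf : 0 ≤ f) {p : ℕ}
    (hT : IsTree I el T p I.n (Finset.range I.n)) :
    Closed I el (Finset.range I.n) (fun _ => 0) f 0 p T 0 f := by
  have e := hT.liveOf_eq (Finset.Subset.refl _)
  refine ⟨by rwa [e], liveOf_subset, ?_, ?_, ?_, by linarith, fun j _ => sq_nonneg _, ?_⟩
  · simp [e]
  · simp [e, paid]
  · simp [e]
  · simp [e]

/-- Close all facilities. -/
def initPhase : Prog :=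
  -- From here on the leaves of the trees are all clients, in their own numbering.
  .forIn 13 (.lit 0) (.var 0) (.setWArr 2 (.var 13) (.var 13) ;; .setWArr 6 (.var 13) (.lit 1) ;;
    .setWArr 3 (.var 13) (.lit 0)) ;;
  5 ≔ʷ .var 0 ;;
  forFac (.setWArr 5 (.var 13) (.lit 0) ;; .setRArr 1 (.var 13) (.lit 0) ;;
    .setRArr 2 (.var 13) (.var 0) ;; treeBuild (.wle (.lit 0) (.lit 0)) ;; pop)

/-- Initially `W = 0` and `P = f ≥ 0`, so the condition for popping holds for the nearest client;
popping continues until the next client is beyond `P / W`. Hence `Settled` already holds at time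
`0`. -/
theorem initPhase_spec {I : Input} {M : ℕ} (hI : I.IsMetric) (hM : 1000 * (I.n + 2) ^ 6 ≤ M)
    {s : State} {mf : ℕ} {fac : ℕ → ℕ} {f : ℝ} (h0 : s.wvar 0 = I.n) (h18 : s.wvar 18 = mf)
    (hfac : s.warr 4 = fac) (hlt : ∀ i < mf, fac i < I.n)
    (hinj : Set.InjOn fac (Finset.range mf)) (hmf : mf ≤ I.n) (hr : s.rvar 0 = f) (hf : 0 ≤ f) :
    WP I M initPhase (fun s' t => ∃ el,
      t + ∑ i ∈ Finset.range mf, potential I s' (fac i) ≤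
        (mf + 1) * (6000 * ((I.n + 1) * levels I.n)) ∧
      Phase I mf fac el f (Finset.range I.n) (fun _ => 0) 0 s') s := by
  have hl := levels_pos I.n
  have e0 : 0 % M = 0 := Nat.zero_mod M
  have e1 : 1 % M = 1 := Nat.mod_eq_of_lt (small_lt hM (by omega))
  rw [initPhase, wp_seq]
  refine wp_for_le 0 I.n 20 (fun i s₁ => ∀ j < i, s₁.warr 2 j = j ∧ s₁.warr 6 j = 1 ∧
    s₁.warr 3 j = 0) (by simp [WExp.eval]) (Nat.zero_le _) (small_lt hM (by omega)) ?_ (by simp)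
    ?_ ?_
  · intro i s₁ hf _
    simp only [WExp.eval, hf.wvar 0 rfl, h0]
  · rintro i s₁ hf - hi hx h
    simp only [wp_seq, wp_setWArr, WExp.eval, WExp.time, State.setWArr_wvar, hx, e0, e1]
    refine ⟨by norm_num, trivial, ?_⟩
    intro j hj
    simp only [State.setW_warr, State.setWArr_warr]
    norm_num only [if_true, if_false]
    simp only [Function.update_apply]
    split_ifs with hji
    · exact ⟨hji.symm, rfl, rfl⟩
    · exact h j (by omega)
  rintro s₁ t₁ hf₁ - h₁ ht₁
  rw [wp_seq, wp_setW]
  simp only [WExp.eval, WExp.time, hf₁.wvar 0 rfl, h0]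
  set s₂ := s₁.setW 5 I.n with hs₂
  have list₂ : FacList I mf fac (s₁.warr 2) s₂ := by
    refine ⟨?_, by simp [hs₂], ?_, ?_, rfl, fun j hj => (h₁ j hj).1, hlt, hinj, hmf⟩
    · simp [hs₂, hf₁.wvar 0 rfl, h0]
    · simp [hs₂, hf₁.wvar 18 rfl, h18]
    · simp [hs₂, hf₁.warr 4 rfl, hfac]
  set el := s₁.warr 2
  refine (forFac_spec hM list₂ (C := 2000 * ((I.n + 1) * levels I.n)) rfl rfl rfl rfl rfl rfl
    (fun i s' => s'.warr 5 (fac i) = 0 ∧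
      ClosedAt I el (Finset.range I.n) (fun _ => 0) f 0 (fac i) s') ?_ ?_).call ?_
  · rintro i s s' hs ⟨h1, h2⟩
    exact ⟨hs.flag.trans h1, h2.congr hs⟩
  · intro i hi s₃ hf₃ l₃ h13 hat hsame
    have hr₃ : s₃.rvar 0 = f := (hf₃.rvar 0 rfl).trans ((hf₁.rvar 0 rfl).trans hr)
    simp only [wp_seq, wp_setWArr, wp_setRArr, WExp.eval, RExp.eval, WExp.time, RExp.time,
      State.setWArr_wvar, State.setRArr_wvar, State.setRArr_rvar, State.setWArr_rvar, h13, e0, hr₃]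
    set s₄ := ((s₃.setWArr 5 (fac i) 0).setRArr 1 (fac i) ((0 : ℕ) : ℝ)).setRArr 2 (fac i) f
      with hs₄
    refine (treeBuild_spec (live := Finset.range I.n) hM (s := s₄)
      (hat.frame (by simp [hs₄]) (by simp [hs₄]) (by simp [hs₄])) (by simp) ?_).call ?_
    · intro s' j _ _ hj
      simp [hj]
    rintro s₅ t₅ hf₅ ⟨ht₅, htree, hrows⟩
    have hel : s₅.warr 2 = el := (hf₅.warr 2 rfl).trans l₃.wa2
    have hc : Closed I el (Finset.range I.n) (fun _ => 0) f 0 (fac i) (row I s₅ (fac i))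
        (s₅.rarr 1 (fac i)) (s₅.rarr 2 (fac i)) := by
      rw [hf₅.rarr 1 rfl, hf₅.rarr 2 rfl]
      have : s₄.warr 2 = el := l₃.wa2
      rw [this] at htree
      simpa [hs₄] using Closed.start hf htree
    refine (pop_spec hI hM (hat.frame (s' := s₅) ((hf₅.wvar 2 rfl).trans (by simp [hs₄]))
      ((hf₅.wvar 3 rfl).trans (by simp [hs₄])) ((hf₅.wvar 5 rfl).trans (by simp [hs₄])))
      ((hf₅.wvar 13 rfl).trans (by simp [hs₄, h13])) hel l₃.id hc).call ?_
    rintro s₆ t₆ hf₆ ⟨ht₆, hc₆, hsame₆⟩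
    refine ⟨?_, ⟨?_, hc₆⟩, fun q hq => SameFac.trans ?_ (hsame₆ q hq)⟩
    · have h1 := potential_le I s₆ (fac i)
      have h2 : (liveOf I (row I s₅ (fac i))).card ≤ I.n := by
        simpa using Finset.card_le_card (liveOf_subset (I := I) (T := row I s₅ (fac i)))
      have h3 := Nat.mul_le_mul_right (170 * levels I.n) h2
      have h4 : (I.n + 1) * levels I.n = I.n * levels I.n + levels I.n := by ring
      have h5 : I.n * (170 * levels I.n) = 170 * (I.n * levels I.n) := by ring
      have h6 : 200 * (I.n + 1) * levels I.n = 200 * ((I.n + 1) * levels I.n) := by ring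
      omega
    · rw [hf₆.warr 5 rfl, hf₅.warr 5 rfl]; simp [hs₄]
    · refine ⟨fun v hv => hrows q hq v hv, ?_, ?_, ?_, ?_⟩
      · rw [hf₅.warr 5 rfl]; simp [hs₄, hq]
      · rw [hf₅.rarr 1 rfl]; simp [hs₄, hq]
      · rw [hf₅.rarr 2 rfl]; simp [hs₄, hq]
      · rw [hf₅.rarr 3 rfl]; simp [hs₄]
  rintro s₃ t₃ hf₃ ⟨ht₃, l₃, hq, -⟩
  have c₃ : ∀ y < I.n, s₃.warr 3 y = 0 := fun y hy => by
    rw [hf₃.warr 3 rfl]; exact (h₁ y hy).2.2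
  refine ⟨el, ?_, l₃, Finset.Subset.refl _, ?_, fun i hi _ => (hq i hi).2,
    fun i hi h => absurd (hq i hi).1 h, le_rfl, by simp, fun y hy h => absurd (c₃ y hy) h,
    fun y hy _ _ h => absurd (c₃ y hy) h, fun i hi h => absurd (hq i hi).1 h⟩
  · have h1 : ∑ i ∈ Finset.range mf, potential I s₂ (fac i) ≤
        mf * (1170 * ((I.n + 1) * levels I.n)) := by
      refine (Finset.sum_le_card_nsmul _ _ _ fun i _ => potential_le I s₂ (fac i)).trans ?_
      simp
    simp only [WExp.time, Nat.sub_zero] at ht₁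
    have h2 : (I.n + 1) * levels I.n = I.n * levels I.n + levels I.n := by ring
    have h3 : I.n * 1 ≤ I.n * levels I.n := Nat.mul_le_mul_left _ hl
    set A := (I.n + 1) * levels I.n
    have h4 : (mf + 1) * (2000 * A + 30) = 2000 * (mf * A) + 30 * mf + 2000 * A + 30 := by ring
    have h5 : (mf + 1) * (6000 * A) = 6000 * (mf * A) + 6000 * A := by ring
    have h6 : mf * (1170 * A) = 1170 * (mf * A) := by ring
    omega
  · intro j hj
    rw [hf₃.warr 6 rfl]
    simp [hs₂, (h₁ j hj).2.1, hj]

/-- Nothing happens before time `t`. -/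
structure Quiet (I : Input) (mf : ℕ) (fac : ℕ → ℕ) (uf : Finset ℕ) (τ t : ℝ) (s : State) :
    Prop where
  le : τ ≤ t
  closed : ∀ i < mf, s.warr 5 (fac i) = 0 → t * s.rarr 1 (fac i) ≤ s.rarr 2 (fac i)
  opened : ∀ i < mf, s.warr 5 (fac i) ≠ 0 → ∀ j ∈ uf, t ≤ max (s.rarr 3 (fac i)) (I.d (fac i) j ^ 2)

section
variable {I : Input} {mf : ℕ} {fac el : ℕ → ℕ} {f : ℝ} {uf : Finset ℕ} {α : ℕ → ℝ} {τ : ℝ}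
  {s : State}

theorem Phase.root (hI : I.IsMetric) (h : Phase I mf fac el f uf α τ s) {i : ℕ} (hi : i < mf)
    (ho : s.warr 5 (fac i) ≠ 0) : (row I s (fac i) 1 = 0 ∧ uf = ∅) ∨
      (row I s (fac i) 1 ≠ 0 ∧ row I s (fac i) 1 - 1 ∈ uf ∧
        ∀ j ∈ uf, I.d (fac i) (row I s (fac i) 1 - 1) ^ 2 ≤ I.d (fac i) j ^ 2) := by
  have ht := (h.opened i hi ho).1.tree
  by_cases h0 : row I s (fac i) 1 = 0
  · refine Or.inl ⟨h0, Finset.eq_empty_of_forall_notMem fun j hj => ?_⟩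
    exact ht.root_eq_zero h0 j (Finset.mem_range.1 (h.sub hj)) hj
  · have := h.list.lt i hi
    exact Or.inr ⟨h0, (ht.root_nearest hI h.list.id h.sub (by omega) h0).2⟩

/-- Nothing happens before the first event. -/
theorem Phase.quiet (hI : I.IsMetric) (h : Phase I mf fac el f uf α τ s) {p : ℕ} {t : ℝ}
    (he : FirstEvent I fac s mf p t) (hp : p < I.n) :
    Quiet I mf fac uf τ t s := by
  obtain ⟨⟨i₀, hi₀, rfl⟩, hev, hmin⟩ := he.resolve_left fun h => by omega
  -- Events lie in the future by the invariants: `ahead` for a client near an open facility, `time`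
  -- for a closed facility.
  have hle : τ ≤ t := by
    rcases hev with ⟨h1, h2, rfl⟩ | ⟨h1, h2, rfl⟩
    · obtain ⟨-, h3, -⟩ := (h.root hI hi₀ h1).resolve_left fun h => h2 h.1
      exact (h.opened i₀ hi₀ h1).1.ahead _ h3
    · rw [le_div_iff₀ h2]; exact (h.closed i₀ hi₀ h1).1.time
  refine ⟨hle, fun i hi hc => ?_, fun i hi ho j hj => ?_⟩
  -- A closed facility with `W = 0` has no event, and for it the bound reads `0 ≤ P`.
  · have hc' := (h.closed i hi hc).1
    rcases (hc'.weight_nonneg hI).eq_or_lt with hW | hW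
    · have := hc'.time
      rw [← hW, mul_zero] at this ⊢
      exact this
    · have := hmin i hi _ (Or.inr ⟨hc, hW, rfl⟩)
      rwa [le_div_iff₀ hW] at this
  · rcases h.root hI hi ho with ⟨-, h1⟩ | ⟨h1, -, h2⟩
    · rw [h1] at hj; exact absurd hj (Finset.notMem_empty j)
    · exact (hmin i hi _ (Or.inl ⟨ho, h1, rfl⟩)).trans (max_le_max_left _ (h2 j hj))

/-- Without further events, the dual solution is complete. -/
theorem Phase.dualCert (hI : I.IsMetric) (h : Phase I mf fac el f uf α τ s)
    (he : ∀ i < mf, ∀ e, ¬ HasEvent I s (fac i) e) (hmf : 1 ≤ mf)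
    (hw : 0 < ∑ j ∈ Finset.range I.n, I.w j) :
    DualCert I ((Finset.range mf).image fac) f (centers s 0 I.n) α (s.rarr 3) := by
  -- If no facility were open, no client would be frozen, and without events every `W` would be `0`.
  -- A client left in a tree would need `P < 0` by `Settled`, so the trees are empty and `W` is the
  -- total weight, which is positive.
  have hex : ∃ i < mf, s.warr 5 (fac i) ≠ 0 := by
    by_contra hno
    push Not at hno
    have huf : uf = Finset.range I.n := by
      refine Finset.Subset.antisymm h.sub fun j hj => ?_
      by_contra hju
      obtain ⟨-, i, hi, ho, -⟩ := h.frozen j (Finset.mem_sdiff.2 ⟨hj, hju⟩)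
      exact ho (hno i hi)
    have h0 := hno 0 hmf
    obtain ⟨hc, hs⟩ := h.closed 0 hmf h0
    have hW : s.rarr 1 (fac 0) = 0 := by
      refine le_antisymm (not_lt.1 fun hW => ?_) (hc.weight_nonneg hI)
      exact he 0 hmf _ (Or.inr ⟨h0, hW, rfl⟩)
    have hlive : liveOf I (row I s (fac 0)) = ∅ := by
      refine Finset.eq_empty_of_forall_notMem fun j hj => ?_
      have h1 := hs j hj
      have h2 := hc.time
      rw [hW] at h1 h2
      linarith
    have := hc.weight
    rw [hW, hlive, Finset.sdiff_empty, huf] at this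
    linarith
  obtain ⟨i₀, hi₀, ho₀⟩ := hex
  -- An open facility without an event has an empty tree, and its tree holds all unfrozen clients.
  have huf : uf = ∅ := by
    rcases h.root hI hi₀ ho₀ with h1 | h1
    · exact h1.2
    · exact absurd (Or.inl ⟨ho₀, h1.1, rfl⟩) (he i₀ hi₀ _)
  subst huf
  have hpaid : ∀ p, paid I ∅ α p =
      ∑ j ∈ Finset.range I.n, I.w j * max (α j - I.d p j ^ 2) 0 := fun p => by
    rw [paid, Finset.sdiff_empty]
  have htight : ∀ i < mf, s.warr 5 (fac i) ≠ 0 →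
      ∑ j ∈ Finset.range I.n, I.w j * max (α j - I.d (fac i) j ^ 2) 0 = f := by
    intro i hi ho
    have := (h.opened i hi ho).1.price
    rwa [Finset.sum_empty, add_zero, hpaid] at this
  have hZ : ∀ z ∈ centers s 0 I.n, ∃ i < mf, fac i = z ∧ s.warr 5 z ≠ 0 := fun z hz =>
    h.flagged z (mem_centers.1 hz).1.2 (mem_centers.1 hz).2
  refine ⟨?_, ?_, ?_, ?_, ?_, ?_⟩
  · intro z hz
    obtain ⟨i, hi, rfl, -⟩ := hZ z hz
    exact Finset.mem_image_of_mem _ (Finset.mem_range.2 hi)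
  · intro p hp
    obtain ⟨i, hi, rfl⟩ := Finset.mem_image.1 hp
    have hi := Finset.mem_range.1 hi
    by_cases ho : s.warr 5 (fac i) = 0
    · rw [← hpaid]; exact (h.closed i hi ho).1.paid_le hI
    · exact (htight i hi ho).le
  · intro z hz
    obtain ⟨i, hi, rfl, ho⟩ := hZ z hz
    exact htight i hi ho
  · intro z hz j hj
    obtain ⟨i, hi, rfl, ho⟩ := hZ z hz
    exact (h.opened i hi ho).1.bounded j (by simpa using hj)
  · intro z hz z' hz' hne
    rw [mem_centers] at hz hz'
    exact h.sep z hz.1.2 z' hz'.1.2 hz.2 hz'.2 hne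
  · intro j hj
    obtain ⟨-, i, hi, ho, h1, h2⟩ := h.frozen j (by simpa using hj)
    obtain ⟨z, hz, hz', h3⟩ := h.cover i hi ho
    refine ⟨z, mem_centers.2 ⟨⟨Nat.zero_le _, hz⟩, hz'⟩, ?_⟩
    have h4 := hI.tri j (fac i) z (h.list.lt i hi)
    rw [hI.comm j (fac i)] at h4
    have a := hI.nonneg (fac i) j
    have b := hI.nonneg (fac i) z
    have c := hI.nonneg j z
    -- `(a + b)² ≤ 3a² + (3/2)b²`, with `a² ≤ α j` and `b² ≤ 4R ≤ 4 α j`, gives the `9`.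
    nlinarith [sq_nonneg (2 * I.d (fac i) j - I.d (fac i) z)]

end
-- Freezing a client
/-- The client of word variable `4` leaves the closed facility of word variable `13` at the time in
real variable `2`. -/
def freezeClosed : Prog :=
  .branch (.pos (.get 1 (.var 2 +ʷ (.var 5 +ʷ .var 4))))
    (treeSet (.lit 0))
    (1 ≔ʳ .dist (.var 13) (.var 4) *ʳ .dist (.var 13) (.var 4) ;;
      .branch (.rle (.var 1) (.var 2)) (1 ≔ʳ .var 2) .skip ;;
      .setRArr 1 (.var 13) (.get 1 (.var 13) -ʳ .weight (.var 4)) ;;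
      .setRArr 2 (.var 13) (.get 2 (.var 13) -ʳ .weight (.var 4) *ʳ .var 1)) ;;
  pop

/-- Freeze the nearest unfrozen client of the open facility of word variable `20` at the time in
real variable `2`. -/
def freeze : Prog :=
  13 ≔ʷ .var 20 ;; turn ;;
  21 ≔ʷ .get 1 (.var 2 +ʷ .lit 1) -ʷ .lit 1 ;;
  .setWArr 6 (.var 21) (.lit 0) ;;
  forFac (4 ≔ʷ .var 21 ;; .branch (.pos (.get 5 (.var 13))) (treeSet (.lit 0)) freezeClosed)

/-- Whether the client was still in the tree decides if `W` and `P` change. Removing a near client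
may postpone the opening, which brings further clients within reach, so popping follows. -/
theorem freezeClosed_spec {I : Input} {M : ℕ} (hI : I.IsMetric) (hM : 1000 * (I.n + 2) ^ 6 ≤ M)
    {s : State} {el : ℕ → ℕ} {uf : Finset ℕ} {α : ℕ → ℝ} {f τ t : ℝ} {p j : ℕ}
    (hat : TreeAt I s p p I.n) (h13 : s.wvar 13 = p) (h4 : s.wvar 4 = j) (hr : s.rvar 2 = t)
    (hel : s.warr 2 = el) (hid : ∀ j < I.n, el j = j) (hj : j ∈ uf) (hjn : j < I.n)
    (h : ClosedAt I el uf α f τ p s) (ht : t * s.rarr 1 p ≤ s.rarr 2 p) :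
    WP I M freezeClosed (fun s' T => T + (liveOf I (row I s' p)).card * (170 * levels I.n) ≤
        (liveOf I (row I s p)).card * (170 * levels I.n) + 200 * levels I.n ∧
      ClosedAt I el (uf.erase j) (Function.update α j t) f t p s' ∧
      ∀ q, q ≠ p → SameFac I q s s') s := by
  have hl := levels_pos I.n
  have hp := hat.row_lt
  have ej : (I.n + j) % M = I.n + j := Nat.mod_eq_of_lt (small_lt hM (by omega))
  have er : (p * (2 * I.n) + (I.n + j)) % M = p * (2 * I.n) + (I.n + j) :=
    Nat.mod_eq_of_lt (row_lt hM hp (by omega))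
  have hiff : j ∈ liveOf I (row I s p) ↔ row I s p (I.n + j) ≠ 0 := by simp [liveOf, hjn]
  have key : ∀ (s₁ : State) (T : ℕ), T ≤ 140 * levels I.n → s₁.wvar 2 = s.wvar 2 →
      s₁.wvar 3 = s.wvar 3 → s₁.wvar 5 = s.wvar 5 → s₁.wvar 13 = s.wvar 13 → s₁.warr 2 = s.warr 2 →
      (liveOf I (row I s₁ p)).card ≤ (liveOf I (row I s p)).card →
      (∀ q, q ≠ p → SameFac I q s s₁) →
      Closed I el (uf.erase j) (Function.update α j t) f t p (row I s₁ p) (s₁.rarr 1 p)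
        (s₁.rarr 2 p) →
      WP I M pop (fun s' T' => T + T' + (liveOf I (row I s' p)).card * (170 * levels I.n) ≤
        (liveOf I (row I s p)).card * (170 * levels I.n) + 200 * levels I.n ∧
        ClosedAt I el (uf.erase j) (Function.update α j t) f t p s' ∧
        ∀ q, q ≠ p → SameFac I q s s') s₁ := by
    intro s₁ T hT e2 e3 e5 e13 ea hlive hsame hc
    refine (pop_spec hI hM (hat.frame e2 e3 e5) (e13.trans h13) (ea.trans hel) hid hc).mono ?_
    rintro s₂ T₂ ⟨hT₂, hc₂, hsame₂⟩
    refine ⟨?_, hc₂, fun q hq => (hsame q hq).trans (hsame₂ q hq)⟩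
    have := Nat.mul_le_mul_right (170 * levels I.n) hlive
    omega
  rw [freezeClosed, wp_seq]
  refine wp_branch (fun hb => ?_) (fun hb => ?_)
  · have hlv : j ∈ liveOf I (row I s p) := hiff.2 (by
      simpa [WExp.eval, hat.base, hat.leaves, h4, ej, er, row] using hb)
    refine (treeSet_erase hM hat h4 hjn (live := liveOf I (row I s p))
      (by rw [hel]; exact h.1.tree)).call ?_
    rintro s₁ t₁ hf₁ ⟨ht₁, htree, hrows⟩
    rw [hel] at htree
    have hlive := htree.liveOf_eq ((Finset.erase_subset _ _).trans liveOf_subset)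
    refine key s₁ _ ?_ (hf₁.wvar 2 rfl) (hf₁.wvar 3 rfl) (hf₁.wvar 5 rfl) (hf₁.wvar 13 rfl)
      (hf₁.warr 2 rfl) ?_ ?_ ?_
    · simp only [Test.time_pos, WExp.time]; omega
    · rw [hlive]; exact Finset.card_le_card (Finset.erase_subset _ _)
    · intro q hq
      exact ⟨hrows q hq, by rw [hf₁.warr 5 rfl], by rw [hf₁.rarr 1 rfl], by rw [hf₁.rarr 2 rfl],
        by rw [hf₁.rarr 3 rfl]⟩
    · rw [hf₁.rarr 1 rfl, hf₁.rarr 2 rfl]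
      exact h.1.freeze_live hI h.2 ht hlv htree
  · have hlv : j ∉ liveOf I (row I s p) := fun h' => hb (by
      have := hiff.1 h'
      simpa [WExp.eval, hat.base, hat.leaves, h4, ej, er, row] using this)
    have hmax : WP I M (.branch (.rle (.var 1) (.var 2)) (1 ≔ʳ .var 2) .skip)
        (fun s' T => T ≤ 10 ∧ ∃ r, s' = (s.setR 1 r) ∧ r = max t (I.d p j ^ 2))
        (s.setR 1 (I.d p j * I.d p j)) := by
      refine wp_branch (fun hb => ?_) (fun hb => ?_)
      · have hb : I.d p j * I.d p j ≤ t := by simpa [RExp.eval, hr] using hb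
        simp only [wp_setR, Test.time, RExp.time, RExp.eval]
        refine ⟨by norm_num, t, ?_, ?_⟩
        · simp [State.setR, hr]
        · rw [max_eq_left]; rwa [sq]
      · have hb : t < I.d p j * I.d p j := by simpa [RExp.eval, hr] using hb
        simp only [wp_skip, Test.time, RExp.time]
        refine ⟨by norm_num, _, rfl, ?_⟩
        rw [max_eq_right, sq]; rw [sq]; exact hb.le
    simp only [wp_seq, wp_setR, RExp.eval, WExp.eval, h13, h4, RExp.time, WExp.time]
    refine hmax.mono ?_
    rintro _ T ⟨hT, r, rfl, hrm⟩
    simp only [wp_setRArr, RExp.eval, WExp.eval, State.setR_wvar, State.setRArr_wvar, h13, h4,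
      State.setR_rarr, State.setRArr_rarr, State.setR_rvar, State.setRArr_rvar, if_true, WExp.time,
      RExp.time, Test.time_pos]
    norm_num only [if_true, if_false]
    have hc := h.1.freeze_near hI h.2 ht (Finset.mem_sdiff.2 ⟨hj, hlv⟩) hjn
    rw [← hrm] at hc
    refine key _ _ (by omega) rfl rfl rfl rfl rfl le_rfl ?_ ?_
    · intro q hq
      refine ⟨fun _ _ => rfl, rfl, ?_, ?_, ?_⟩ <;> simp [hq]
    · simpa using hc

/-- Since nothing happens before the first event, the invariants of all facilities may be moved to
its time `t`. As `t = max(R, d²)` for the facility that causes it, that facility is the witness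
required by `frozen` for the new dual value `t`. -/
theorem freeze_spec {I : Input} {M : ℕ} (hI : I.IsMetric) (hM : 1000 * (I.n + 2) ^ 6 ≤ M)
    {s : State} {mf : ℕ} {fac el : ℕ → ℕ} {f : ℝ} {uf : Finset ℕ} {α : ℕ → ℝ} {τ : ℝ} {p : ℕ}
    (h : Phase I mf fac el f uf α τ s) (h20 : s.wvar 20 = p) (hp : p < I.n)
    (ho : s.warr 5 p ≠ 0) (he : FirstEvent I fac s mf p (s.rvar 2)) :
    WP I M freeze (fun s' T => ∃ j ∈ uf, ∃ α' τ', Phase I mf fac el f (uf.erase j) α' τ' s' ∧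
      T + ∑ i ∈ Finset.range mf, potential I s' (fac i) ≤
        ∑ i ∈ Finset.range mf, potential I s (fac i) + 300 * ((mf + 1) * levels I.n)) s := by
  have hl := levels_pos I.n
  have e0 : 0 % M = 0 := Nat.zero_mod M
  have e1 : 1 % M = 1 := Nat.mod_eq_of_lt (small_lt hM (by omega))
  have er : (p * (2 * I.n) + 1) % M = p * (2 * I.n) + 1 :=
    Nat.mod_eq_of_lt (row_lt hM hp (by omega))
  have hquiet := h.quiet hI he hp
  obtain ⟨⟨i₀, hi₀, hpi⟩, hev, -⟩ := he.resolve_left fun h => by omega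
  subst hpi
  obtain ⟨h1, h2, het⟩ := hev.resolve_right fun h => ho h.1
  obtain ⟨-, hj, -⟩ := (h.root hI hi₀ h1).resolve_left fun h => h2 h.1
  set j := row I s (fac i₀) 1 - 1 with hjdef
  set t := s.rvar 2 with htdef
  have hjn : j < I.n := Finset.mem_range.1 (h.sub hj)
  rw [freeze, wp_seq, wp_setW, wp_seq]
  simp only [WExp.eval, WExp.time, h20]
  refine turn_spec hM (by simpa using h.list.w0) (x := fac i₀) (by simp) hp ?_
  simp only [wp_seq, wp_setW, wp_setWArr, WExp.eval, WExp.time, State.setW_wvar, State.setW_warr,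
    e0, e1]
  norm_num only [if_true, if_false]
  rw [er, show s.warr 1 (fac i₀ * (2 * I.n) + 1) - 1 = j from rfl]
  set s₁ := ((((s.setW 13 (fac i₀)).setW 2 (fac i₀ * (2 * I.n))).setW 3 (fac i₀)).setW 21
    j).setWArr 6 j 0 with hs₁
  have same₁ : ∀ q, SameFac I q s s₁ := fun q => ⟨fun _ _ => rfl, rfl, rfl, rfl, rfl⟩
  have list₁ : FacList I mf fac el s₁ := by
    refine ⟨?_, ?_, ?_, h.list.wa4, h.list.wa2, h.list.id, h.list.lt, h.list.inj, h.list.le⟩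
    · simp [hs₁, h.list.w0]
    · simp [hs₁, h.list.w5]
    · simp [hs₁, h.list.w18]
  refine (forFac_spec hM list₁ (C := 250 * levels I.n) rfl rfl rfl rfl rfl rfl
    (fun i s' => s'.warr 5 (fac i) = s.warr 5 (fac i) ∧ s'.rarr 3 (fac i) = s.rarr 3 (fac i) ∧
      (s.warr 5 (fac i) = 0 →
        ClosedAt I el (uf.erase j) (Function.update α j t) f t (fac i) s') ∧
      (s.warr 5 (fac i) ≠ 0 → Opened I el (uf.erase j) (Function.update α j t) f t (fac i)
        (row I s' (fac i)) (s.rarr 3 (fac i)))) ?_ ?_).call ?_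
  · rintro i s₂ s₃ hs ⟨a, b, c, d⟩
    exact ⟨hs.flag.trans a, hs.radius.trans b, fun h => (c h).congr hs, fun h =>
      (d h).congr hs.row⟩
  · intro i hi s₂ hf₂ l₂ h13 hat hsame
    have hsame' := (same₁ (fac i)).trans hsame
    have w21 : s₂.wvar 21 = j := (hf₂.wvar 21 rfl).trans (by simp [hs₁])
    have r2 : s₂.rvar 2 = t := hf₂.rvar 2 rfl
    rw [wp_seq, wp_setW]
    simp only [WExp.eval, WExp.time, w21]
    have hat' : TreeAt I (s₂.setW 4 j) (fac i) (fac i) I.n := hat.frame rfl rfl rfl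
    refine wp_branch (fun hb => ?_) (fun hb => ?_)
    · have ho : s.warr 5 (fac i) ≠ 0 := by
        rw [← hsame'.flag]; simpa [WExp.eval, h13] using hb
      obtain ⟨hop, hR⟩ := h.opened i hi ho
      have htree := hop.tree.congr hsame'.row
      refine (treeSet_erase hM hat' (j := j) (by simp) hjn (live := uf)
        (by simpa [l₂.wa2] using htree)).call ?_
      rintro s₃ t₃ hf₃ ⟨ht₃, htree₃, hrows⟩
      have hel : (s₂.setW 4 j).warr 2 = el := l₂.wa2
      rw [hel] at htree₃
      have hflag : s₃.warr 5 (fac i) = s.warr 5 (fac i) := by rw [hf₃.warr 5 rfl]; exact hsame'.flag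
      refine ⟨?_, ⟨hflag, ?_, fun h => absurd h ho, fun _ =>
        hop.freeze hquiet.le (hquiet.opened i hi ho) hj hjn htree₃⟩, ?_⟩
      · have : potential I s₃ (fac i) = 0 := by rw [potential, if_neg (by rwa [hflag])]
        simp only [Test.time_pos, WExp.time]
        omega
      · rw [hf₃.rarr 3 rfl]; exact hsame'.radius
      · intro q hq
        exact ⟨hrows q hq, by rw [hf₃.warr 5 rfl]; rfl, by rw [hf₃.rarr 1 rfl]; rfl,
          by rw [hf₃.rarr 2 rfl]; rfl, by rw [hf₃.rarr 3 rfl]; rfl⟩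
    · have hc : s.warr 5 (fac i) = 0 := by
        rw [← hsame'.flag]; simpa [WExp.eval, h13] using hb
      have hcl := (h.closed i hi hc).congr hsame'
      refine (freezeClosed_spec hI hM hat' (j := j) (t := t) (by simp [h13]) (by simp)
        (by simp [r2]) l₂.wa2 l₂.id hj hjn hcl ?_).call ?_
      · have := hquiet.closed i hi hc
        rw [← hsame'.weight, ← hsame'.price] at this
        exact this
      rintro s₃ t₃ hf₃ ⟨ht₃, hc₃, hrows⟩
      have hflag : s₃.warr 5 (fac i) = s.warr 5 (fac i) := by rw [hf₃.warr 5 rfl]; exact hsame'.flag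
      refine ⟨?_, ⟨hflag, ?_, fun _ => hc₃, fun h => absurd hc h⟩, ?_⟩
      · rw [← hsame.potential, potential, potential, if_pos (by rw [hflag, hc]),
          if_pos (by rw [hsame'.flag, hc])]
        have : row I (s₂.setW 4 j) = row I s₂ := rfl
        rw [this] at ht₃
        simp only [Test.time_pos, WExp.time]
        omega
      · rw [hf₃.rarr 3 rfl]; exact hsame'.radius
      · exact fun q hq => SameFac.trans (s₁ := s₂.setW 4 j) ⟨fun _ _ => rfl, rfl, rfl, rfl, rfl⟩
          (hrows q hq)
  rintro s₂ t₂ hf₂ ⟨ht₂, l₂, hq, -⟩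
  have f6 : s₂.warr 6 = Function.update (s.warr 6) j 0 := (hf₂.warr 6 rfl).trans (by simp [hs₁])
  have f3 : s₂.warr 3 = s.warr 3 := hf₂.warr 3 rfl
  have f5 : s₂.warr 5 = s.warr 5 := hf₂.warr 5 rfl
  have r3 : s₂.rarr 3 = s.rarr 3 := hf₂.rarr 3 rfl
  refine ⟨j, hj, Function.update α j t, t, ⟨l₂, (Finset.erase_subset _ _).trans h.sub, ?_, ?_, ?_,
    h.nonneg.trans hquiet.le, ?_, ?_, ?_, ?_⟩, ?_⟩
  · intro i hi
    rw [f6, Function.update_apply, Finset.mem_erase, ← h.unfrozen i hi]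
    split_ifs with hij <;> simp [hij]
  · intro i hi hc
    rw [f5] at hc
    exact (hq i hi).2.2.1 hc
  · intro i hi hc
    rw [f5] at hc
    rw [r3]
    exact ⟨(hq i hi).2.2.2 hc, (h.opened i hi hc).2⟩
  · intro i hi
    rw [f5, r3]
    by_cases hij : i = j
    · subst hij
      rw [Function.update_self]
      exact ⟨le_rfl, i₀, hi₀, ho, het ▸ le_max_left _ _, het ▸ le_max_right _ _⟩
    · rw [Function.update_of_ne hij]
      obtain ⟨a, b⟩ := h.frozen i (by
        simp only [Finset.mem_sdiff, Finset.mem_erase, not_and] at hi ⊢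
        exact ⟨hi.1, fun h => hi.2 hij h⟩)
      exact ⟨a.trans hquiet.le, b⟩
  · rw [f3, f5]; exact h.flagged
  · rw [f3, r3]; exact h.sep
  · rw [f3, f5, r3]; exact h.cover
  · have hpot : ∀ i, potential I s₁ (fac i) = potential I s (fac i) := fun i =>
      (same₁ (fac i)).potential
    simp only [hpot] at ht₂
    have a1 : (mf + 1) * (250 * levels I.n + 30) = 250 * ((mf + 1) * levels I.n) + 30 * mf + 30 := by
      ring
    have a2 : (mf + 1) * levels I.n = mf * levels I.n + levels I.n := by ring
    have a3 : mf * 1 ≤ mf * levels I.n := Nat.mul_le_mul_left _ hl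
    omega

/-! ### Opening a facility and selecting the centres -/

/-- Word variable `22` becomes nonzero if no centre is close to the facility of word variable `13`
at the time in real variable `2`. -/
def separated : Prog :=
  22 ≔ʷ .lit 1 ;;
  .forIn 23 (.lit 0) (.var 18) (24 ≔ʷ .get 4 (.var 23) ;;
    .branch (.conj (.pos (.get 3 (.var 24))) (.rle (.dist (.var 13) (.var 24) *ʳ
      .dist (.var 13) (.var 24)) (.lit 4 *ʳ .var 2))) (22 ≔ʷ .lit 0) .skip)

/-- Open the facility of word variable `20` at the time in real variable `2`. -/
def openFac : Prog :=
  13 ≔ʷ .var 20 ;; turn ;;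
  .setWArr 5 (.var 13) (.lit 1) ;;
  .setRArr 3 (.var 13) (.var 2) ;;
  treeBuild (.pos (.get 6 (.var 4))) ;;
  separated ;;
  .branch (.pos (.var 22)) (.setWArr 3 (.var 13) (.lit 1)) .skip

theorem separated_spec {I : Input} {M : ℕ} (hM : 1000 * (I.n + 2) ^ 6 ≤ M) {s : State} {mf : ℕ}
    {fac el : ℕ → ℕ} {p : ℕ} {t : ℝ} (h : FacList I mf fac el s) (h13 : s.wvar 13 = p)
    (hr : s.rvar 2 = t) :
    WP I M separated (fun s' T => T ≤ 60 * (mf + 1) ∧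
      (s'.wvar 22 ≠ 0 ∧ (∀ i < mf, s.warr 3 (fac i) ≠ 0 → 4 * t < I.d p (fac i) ^ 2) ∨
        s'.wvar 22 = 0 ∧ ∃ i < mf, s.warr 3 (fac i) ≠ 0 ∧ I.d p (fac i) ^ 2 ≤ 4 * t)) s := by
  have e0 : 0 % M = 0 := Nat.zero_mod M
  have e1 : 1 % M = 1 := Nat.mod_eq_of_lt (small_lt hM (by omega))
  rw [separated, wp_seq, wp_setW]
  simp only [WExp.eval, WExp.time, e1]
  refine wp_for_le 0 mf 40 (fun m s₁ =>
      s₁.wvar 22 ≠ 0 ∧ (∀ i < m, s.warr 3 (fac i) ≠ 0 → 4 * t < I.d p (fac i) ^ 2) ∨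
        s₁.wvar 22 = 0 ∧ ∃ i < mf, s.warr 3 (fac i) ≠ 0 ∧ I.d p (fac i) ^ 2 ≤ 4 * t)
    (by simp [WExp.eval]) (Nat.zero_le _) (small_lt hM (by have := h.le; omega)) ?_ ?_ ?_ ?_
  · intro i s₁ hf _
    simp only [WExp.eval, hf.wvar 18 rfl]
    simp [h.w18]
  · exact Or.inl ⟨by simp, fun _ h => absurd h (Nat.not_lt_zero _)⟩
  · rintro m s₁ hf - hm hx hS
    have hfac : s₁.warr 4 = fac := (hf.warr 4 rfl).trans h.wa4
    have hcen : s₁.warr 3 = s.warr 3 := hf.warr 3 rfl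
    have w13 : s₁.wvar 13 = p := (hf.wvar 13 rfl).trans (by simp [h13])
    have r2 : s₁.rvar 2 = t := (hf.rvar 2 rfl).trans hr
    have hbr : (Test.conj (.pos (.get 3 (.var 24))) (.rle (.dist (.var 13) (.var 24) *ʳ
        .dist (.var 13) (.var 24)) (.lit 4 *ʳ .var 2))).Holds I M (s₁.setW 24 (fac m)) ↔
        s.warr 3 (fac m) ≠ 0 ∧ I.d p (fac m) ^ 2 ≤ 4 * t := by
      simp [WExp.eval, RExp.eval, hcen, w13, r2, sq]
    rw [wp_seq, wp_setW]
    simp only [WExp.eval, WExp.time, hfac, hx]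
    refine wp_branch (fun hb => ?_) (fun hb => ?_)
    · rw [hbr] at hb
      simp only [wp_setW, WExp.eval, e0, WExp.time, RExp.time, Test.time, Test.time_pos]
      exact ⟨by norm_num, by simp [hx], Or.inr ⟨by simp, m, hm, hb⟩⟩
    · rw [hbr, not_and, not_le] at hb
      simp only [wp_skip, WExp.time, RExp.time, Test.time, Test.time_pos]
      refine ⟨by norm_num, by simp [hx], ?_⟩
      rcases hS with hS | hS
      · refine Or.inl ⟨by simpa using hS.1, fun i hi => ?_⟩
        rcases Nat.lt_succ_iff_lt_or_eq.1 hi with hi | rfl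
        · exact hS.2 i hi
        · exact hb
      · exact Or.inr ⟨by simpa using hS.1, hS.2⟩
  · rintro s₁ T hf - hS hT
    refine ⟨?_, hS⟩
    simp only [WExp.time, Nat.sub_zero] at hT
    omega

/-- The new facility becomes a centre only if no centre lies within squared distance `4t`; otherwise
such a centre covers it. Rebuilding its tree with all unfrozen clients is paid for by the potential
it gives up, with `500 (n + 1) levels` to spare. -/
theorem openFac_spec {I : Input} {M : ℕ} (hI : I.IsMetric) (hM : 1000 * (I.n + 2) ^ 6 ≤ M)
    {s : State} {mf : ℕ} {fac el : ℕ → ℕ} {f : ℝ} {uf : Finset ℕ} {α : ℕ → ℝ} {τ : ℝ} {p : ℕ}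
    (h : Phase I mf fac el f uf α τ s) (h20 : s.wvar 20 = p) (hp : p < I.n)
    (hc : s.warr 5 p = 0) (he : FirstEvent I fac s mf p (s.rvar 2)) :
    WP I M openFac (fun s' T => ∃ τ', Phase I mf fac el f uf α τ' s' ∧
      T + ∑ i ∈ Finset.range mf, potential I s' (fac i) + 500 * ((I.n + 1) * levels I.n) ≤
        ∑ i ∈ Finset.range mf, potential I s (fac i)) s := by
  have hl := levels_pos I.n
  have e1 : 1 % M = 1 := Nat.mod_eq_of_lt (small_lt hM (by omega))
  have hquiet := h.quiet hI he hp
  obtain ⟨⟨i₀, hi₀, hpi⟩, hev, -⟩ := he.resolve_left fun h => by omega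
  subst hpi
  obtain ⟨-, hW, het⟩ := hev.resolve_left fun h => h.1 hc
  set t := s.rvar 2 with htdef
  have ht0 : 0 ≤ t := h.nonneg.trans hquiet.le
  set p := fac i₀ with hpdef
  rw [openFac, wp_seq, wp_setW, wp_seq]
  simp only [WExp.eval, WExp.time, h20]
  refine turn_spec hM (by simpa using h.list.w0) (x := p) (by simp) hp ?_
  rw [wp_seq, wp_setWArr, wp_seq, wp_setRArr]
  simp only [WExp.eval, RExp.eval, WExp.time, RExp.time, State.setWArr_wvar, State.setW_wvar, e1]
  norm_num only [if_true, if_false]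
  change WP I M _ _ (((((s.setW 13 p).setW 2 (p * (2 * I.n))).setW 3 p).setWArr 5 p 1).setRArr 3 p t)
  set s₁ := ((((s.setW 13 p).setW 2 (p * (2 * I.n))).setW 3 p).setWArr 5 p 1).setRArr 3 p t with hs₁
  have list₁ : FacList I mf fac el s₁ := by
    refine ⟨?_, ?_, ?_, h.list.wa4, h.list.wa2, h.list.id, h.list.lt, h.list.inj, h.list.le⟩
    · simp [hs₁, h.list.w0]
    · simp [hs₁, h.list.w5]
    · simp [hs₁, h.list.w18]
  rw [wp_seq]
  refine (treeBuild_spec (live := uf) hM (s := s₁) (ρ := p) (x := p) (q := I.n)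
    ⟨by simp [hs₁], by simp [hs₁], list₁.w5, hp, le_rfl⟩ (by simp) ?_).call ?_
  · intro s' j hf hj hjn
    simp only [Test.holds_pos, WExp.eval, hj, hf.warr 6 rfl]
    simpa [hs₁] using h.unfrozen j hjn
  rintro s₂ t₂ hf₂ ⟨ht₂, htree, hrows⟩
  rw [list₁.wa2] at htree
  have list₂ : FacList I mf fac el s₂ := ⟨(hf₂.wvar 0 rfl).trans list₁.w0,
    (hf₂.wvar 5 rfl).trans list₁.w5, (hf₂.wvar 18 rfl).trans list₁.w18,
    (hf₂.warr 4 rfl).trans list₁.wa4, (hf₂.warr 2 rfl).trans list₁.wa2, h.list.id, h.list.lt,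
    h.list.inj, h.list.le⟩
  have c₂ : s₂.warr 3 = s.warr 3 := hf₂.warr 3 rfl
  rw [wp_seq]
  refine (separated_spec hM list₂ (p := p) (t := t) ((hf₂.wvar 13 rfl).trans (by simp [hs₁]))
    (hf₂.rvar 2 rfl)).call ?_
  rintro s₃ t₃ hf₃ ⟨ht₃, hsep⟩
  rw [c₂] at hsep
  have w13 : s₃.wvar 13 = p := (hf₃.wvar 13 rfl).trans ((hf₂.wvar 13 rfl).trans (by simp [hs₁]))
  -- Only open facilities are flagged, so every flagged point differs from `p`.
  have hnp : s.warr 3 p = 0 := by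
    by_contra hnp
    obtain ⟨-, -, -, h5⟩ := h.flagged p hp hnp
    exact h5 hc
  -- The two branches differ only in the flag of `p`, so they share this conclusion.
  have fin : ∀ (s₄ : State) (T : ℕ), T ≤ 300 * ((I.n + 1) * levels I.n) → s₄.wvar = s₃.wvar →
      s₄.warr 1 = s₃.warr 1 → s₄.warr 2 = s₃.warr 2 → s₄.warr 4 = s₃.warr 4 →
      s₄.warr 5 = s₃.warr 5 → s₄.warr 6 = s₃.warr 6 → s₄.rarr = s₃.rarr →
      (∀ y, y ≠ p → s₄.warr 3 y = s.warr 3 y) →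
      (s₄.warr 3 p ≠ 0 ∧ (∀ i < mf, s.warr 3 (fac i) ≠ 0 → 4 * t < I.d p (fac i) ^ 2) ∨
        s₄.warr 3 p = 0 ∧ ∃ i < mf, s.warr 3 (fac i) ≠ 0 ∧ I.d p (fac i) ^ 2 ≤ 4 * t) →
      ∃ τ', Phase I mf fac el f uf α τ' s₄ ∧
      T + ∑ i ∈ Finset.range mf, potential I s₄ (fac i) + 500 * ((I.n + 1) * levels I.n) ≤
        ∑ i ∈ Finset.range mf, potential I s (fac i) := by
    intro s₄ T hT ew a1 a2 a4 a5 a6 er hflag hsep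
    have r1 : row I s₄ = row I s₂ := by
      rw [row_frame I a1, row_frame I (hf₃.warr 1 rfl)]
    have f5 : s₄.warr 5 = Function.update (s.warr 5) p 1 := by
      rw [a5, hf₃.warr 5 rfl, hf₂.warr 5 rfl]; simp [hs₁]
    have q1 : s₄.rarr 1 = s.rarr 1 := by
      rw [er, hf₃.rarr 1 rfl, hf₂.rarr 1 rfl]; simp [hs₁]
    have q2 : s₄.rarr 2 = s.rarr 2 := by
      rw [er, hf₃.rarr 2 rfl, hf₂.rarr 2 rfl]; simp [hs₁]
    have q3 : s₄.rarr 3 = Function.update (s.rarr 3) p t := by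
      rw [er, hf₃.rarr 3 rfl, hf₂.rarr 3 rfl]; simp [hs₁]
    have f6 : s₄.warr 6 = s.warr 6 := by
      rw [a6, hf₃.warr 6 rfl, hf₂.warr 6 rfl]; simp [hs₁]
    have same : ∀ q, q ≠ p → SameFac I q s s₄ := by
      intro q hq
      refine ⟨fun v hv => ?_, ?_, ?_, ?_, ?_⟩
      · rw [r1]; exact hrows q hq v hv
      · rw [f5, Function.update_of_ne hq]
      · rw [q1]
      · rw [q2]
      · rw [q3, Function.update_of_ne hq]
    have fp : s₄.warr 5 p ≠ 0 := by rw [f5, Function.update_self]; exact one_ne_zero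
    have rp : s₄.rarr 3 p = t := by rw [q3, Function.update_self]
    refine ⟨t, ⟨⟨?_, ?_, ?_, ?_, ?_, h.list.id, h.list.lt, h.list.inj, h.list.le⟩, h.sub, ?_, ?_,
      ?_, ht0, ?_, ?_, ?_, ?_⟩, ?_⟩
    · rw [ew, hf₃.wvar 0 rfl, list₂.w0]
    · rw [ew, hf₃.wvar 5 rfl, list₂.w5]
    · rw [ew, hf₃.wvar 18 rfl, list₂.w18]
    · rw [a4, hf₃.warr 4 rfl, list₂.wa4]
    · rw [a2, hf₃.warr 2 rfl, list₂.wa2]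
    · rw [f6]; exact h.unfrozen
    · intro i hi hci
      have hne : fac i ≠ p := fun e => fp (e ▸ hci)
      have hci' : s.warr 5 (fac i) = 0 := by rw [← (same _ hne).flag]; exact hci
      obtain ⟨b1, b2⟩ := h.closed i hi hci'
      exact ClosedAt.congr (same _ hne) ⟨b1.advance hI b2 (hquiet.closed i hi hci'), b2⟩
    · intro i hi hoi
      by_cases hip : fac i = p
      · rw [hip, rp, r1]
        refine ⟨?_, ht0⟩
        obtain ⟨b1, b2⟩ := h.closed i₀ hi₀ hc
        rw [het]
        exact b1.opened b2 hW (fun j hj => (h.frozen j hj).1) htree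
      · have hs := same _ hip
        rw [hs.flag] at hoi
        rw [hs.radius]
        obtain ⟨b1, b2⟩ := h.opened i hi hoi
        exact ⟨(b1.advance hquiet.le (hquiet.opened i hi hoi)).congr hs.row, b2⟩
    · intro j hj
      obtain ⟨b1, i, hi, hoi, b2⟩ := h.frozen j hj
      have hs := same (fac i) fun e => hoi (e ▸ hc)
      refine ⟨b1.trans hquiet.le, i, hi, ?_, ?_⟩
      · rw [hs.flag]; exact hoi
      · rw [hs.radius]; exact b2
    · intro y hy hyf
      by_cases hyp : y = p
      · subst hyp; exact ⟨i₀, hi₀, rfl, fp⟩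
      · rw [hflag y hyp] at hyf
        rw [(same y hyp).flag]
        exact h.flagged y hy hyf
    · have hnew : ∀ z < I.n, s₄.warr 3 p ≠ 0 → s₄.warr 3 z ≠ 0 → z ≠ p → 4 * t < I.d p z ^ 2 := by
        intro z hz hpf hzf hzp
        have := (hsep.resolve_right fun h => hpf h.1).2
        rw [hflag z hzp] at hzf
        obtain ⟨i, hi, rfl, -⟩ := h.flagged z hz hzf
        exact this i hi hzf
      intro y hy z hz hyf hzf hyz
      by_cases hyp : y = p
      · subst hyp
        rw [rp]
        exact Or.inl (hnew z hz hyf hzf (Ne.symm hyz))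
      · by_cases hzp : z = p
        · subst hzp
          rw [rp, hI.comm]
          exact Or.inr (hnew y hy hzf hyf hyz)
        · rw [(same y hyp).radius, (same z hzp).radius]
          rw [hflag y hyp] at hyf
          rw [hflag z hzp] at hzf
          exact h.sep y hy z hz hyf hzf hyz
    · intro i hi hoi
      by_cases hip : fac i = p
      · rw [hip, rp]
        rcases hsep with ⟨b1, -⟩ | ⟨-, i', hi', b1, b2⟩
        · exact ⟨p, hp, b1, by rw [hI.self]; linarith⟩
        · refine ⟨fac i', h.list.lt i' hi', ?_, b2⟩
          rw [hflag (fac i') fun e => b1 (e ▸ hnp)]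
          exact b1
      · rw [(same _ hip).flag] at hoi
        rw [(same _ hip).radius]
        obtain ⟨z, hz, b1, b2⟩ := h.cover i hi hoi
        refine ⟨z, hz, ?_, b2⟩
        rw [hflag z fun e => b1 (e ▸ hnp)]
        exact b1
    · have hmem : i₀ ∈ Finset.range mf := Finset.mem_range.2 hi₀
      rw [← Finset.add_sum_erase _ _ hmem, ← Finset.add_sum_erase (Finset.range mf) _ hmem]
      have h1 : potential I s₄ (fac i₀) = 0 := by rw [potential, if_neg fp]
      have h2 : 1000 * ((I.n + 1) * levels I.n) ≤ potential I s (fac i₀) := by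
        rw [potential, if_pos hc]; omega
      have h3 : ∑ i ∈ (Finset.range mf).erase i₀, potential I s₄ (fac i) =
          ∑ i ∈ (Finset.range mf).erase i₀, potential I s (fac i) := by
        refine Finset.sum_congr rfl fun i hi => (same _ fun e => ?_).potential
        rw [Finset.mem_erase] at hi
        exact hi.1 (h.list.inj (by simpa using hi.2) (by simpa using hi₀) e)
      rw [h1, h3]
      omega
  have htime : ∀ T ≤ 20, 1 + 1 + (8 + (1 + 1 + 1 + (1 + 1 + 1 + (t₂ + (t₃ + T))))) ≤
      300 * ((I.n + 1) * levels I.n) := by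
    intro T hT
    have h1 := h.list.le
    have a1 : 200 * (I.n + 1) * levels I.n = 200 * ((I.n + 1) * levels I.n) := by ring
    have a2 : (I.n + 1) * 1 ≤ (I.n + 1) * levels I.n := Nat.mul_le_mul_left _ hl
    omega
  refine wp_branch (fun hb => ?_) (fun hb => ?_)
  · have hb : s₃.wvar 22 ≠ 0 := by simpa [WExp.eval] using hb
    simp only [wp_setWArr, WExp.eval, w13, e1, Test.time_pos, WExp.time]
    refine fin _ _ (htime _ (by norm_num)) rfl rfl rfl rfl rfl rfl rfl ?_ ?_
    · intro y hy
      simp [hy, hf₃.warr 3 rfl, c₂]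
    · exact Or.inl ⟨by simp, (hsep.resolve_right fun h => hb h.1).2⟩
  · have hb : s₃.wvar 22 = 0 := by simpa [WExp.eval] using hb
    simp only [wp_skip, Test.time_pos, WExp.time]
    refine fin _ _ (htime _ (by norm_num)) rfl rfl rfl rfl rfl rfl rfl ?_ ?_
    · intro y hy
      simp [hf₃.warr 3 rfl, c₂]
    · refine Or.inr ⟨by simp [hf₃.warr 3 rfl, c₂, hnp], (hsep.resolve_left fun h => h.1 hb).2⟩

/-! ### The event loop of the primal-dual method -/

/-- The primal-dual method for the facilities in word array `4` and the facility cost in real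
variable `0`. -/
def primalDual : Prog :=
  initPhase ;; select ;;
  .loop (.wlt (.var 20) (.var 0)) (.branch (.pos (.get 5 (.var 20))) freeze openFac ;; select)

/-- The flagged clients. -/
def unfrozenOf (I : Input) (s : State) : Finset ℕ := {j ∈ Finset.range I.n | s.warr 6 j ≠ 0}

theorem Phase.unfrozenOf_eq {I : Input} {mf : ℕ} {fac el : ℕ → ℕ} {f : ℝ} {uf : Finset ℕ}
    {α : ℕ → ℝ} {τ : ℝ} {s : State} (h : Phase I mf fac el f uf α τ s) : unfrozenOf I s = uf := by
  ext j
  rw [unfrozenOf, Finset.mem_filter, Finset.mem_range]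
  constructor
  · rintro ⟨h1, h2⟩; exact (h.unfrozen j h1).1 h2
  · intro hj
    have := Finset.mem_range.1 (h.sub hj)
    exact ⟨this, (h.unfrozen j this).2 hj⟩

/-- The work that remains. -/
def remaining (I : Input) (mf : ℕ) (fac : ℕ → ℕ) (s : State) : ℕ :=
  ∑ i ∈ Finset.range mf, potential I s (fac i) +
    (unfrozenOf I s).card * (600 * ((mf + 1) * levels I.n))

theorem Phase.congr {I : Input} {mf : ℕ} {fac el : ℕ → ℕ} {f : ℝ} {uf : Finset ℕ} {α : ℕ → ℝ}
    {τ : ℝ} {s s' : State} (h : Phase I mf fac el f uf α τ s) (h0 : s'.wvar 0 = s.wvar 0)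
    (h5 : s'.wvar 5 = s.wvar 5) (h18 : s'.wvar 18 = s.wvar 18) (ha : s'.warr = s.warr)
    (hr : s'.rarr = s.rarr) : Phase I mf fac el f uf α τ s' := by
  have hrow : row I s' = row I s := row_frame I (by rw [ha])
  refine ⟨⟨h0.trans h.list.w0, h5.trans h.list.w5, h18.trans h.list.w18, ?_, ?_, h.list.id,
    h.list.lt, h.list.inj, h.list.le⟩, h.sub, ?_, ?_, ?_, h.nonneg, ?_, ?_, ?_, ?_⟩
  · rw [ha]; exact h.list.wa4
  · rw [ha]; exact h.list.wa2
  · rw [ha]; exact h.unfrozen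
  · rw [ha]; simp only [ClosedAt, hrow, hr]; exact h.closed
  · rw [ha, hrow, hr]; exact h.opened
  · rw [ha, hr]; exact h.frozen
  · rw [ha]; exact h.flagged
  · rw [ha, hr]; exact h.sep
  · rw [ha, hr]; exact h.cover

theorem remaining_congr {I : Input} {mf : ℕ} {fac : ℕ → ℕ} {s s' : State}
    (ha : s'.warr = s.warr) : remaining I mf fac s' = remaining I mf fac s := by
  simp only [remaining, unfrozenOf, potential, row_frame I (show s'.warr 1 = s.warr 1 by rw [ha]),
    ha]

/-- Every round freezes a client or opens a facility, and no round undoes either. Freezing is paid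
for by the budget of the client in `remaining`, opening and popping by the potentials of the
facilities. -/
theorem primalDual_spec {I : Input} {M : ℕ} (hI : I.IsMetric) (hM : 1000 * (I.n + 2) ^ 6 ≤ M)
    {s : State} {mf : ℕ} {fac : ℕ → ℕ} {f : ℝ} (h0 : s.wvar 0 = I.n) (h18 : s.wvar 18 = mf)
    (hfac : s.warr 4 = fac) (hlt : ∀ i < mf, fac i < I.n)
    (hinj : Set.InjOn fac (Finset.range mf)) (hmf1 : 1 ≤ mf) (hmf : mf ≤ I.n) (hr : s.rvar 0 = f)
    (hf : 0 ≤ f) (hw : 0 < ∑ j ∈ Finset.range I.n, I.w j) :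
    WP I M primalDual (fun s' t => t ≤ 10000 * ((mf + 1) * ((I.n + 1) * levels I.n)) ∧
      ∃ α R, DualCert I ((Finset.range mf).image fac) f (centers s' 0 I.n) α R) s := by
  have hl := levels_pos I.n
  have selstep : ∀ (s₁ : State) (el : ℕ → ℕ) (uf : Finset ℕ) (α : ℕ → ℝ) (τ : ℝ),
      Phase I mf fac el f uf α τ s₁ → WP I M select (fun s' t => t ≤ 200 * (mf + 1) ∧
        Phase I mf fac el f uf α τ s' ∧ remaining I mf fac s' = remaining I mf fac s₁ ∧
        FirstEvent I fac s' mf (s'.wvar 20) (s'.rvar 2)) s₁ := by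
    intro s₁ el uf α τ h
    refine (select_spec hM h.list).call ?_
    rintro s₂ t₂ hf₂ ⟨ht₂, hev⟩
    have ha : s₂.warr = s₁.warr := by funext a; exact hf₂.warr a rfl
    have hr : s₂.rarr = s₁.rarr := by funext a; exact hf₂.rarr a rfl
    exact ⟨ht₂, h.congr (hf₂.wvar 0 rfl) (hf₂.wvar 5 rfl) (hf₂.wvar 18 rfl) ha hr,
      remaining_congr ha, hev⟩
  rw [primalDual, wp_seq]
  refine (initPhase_spec hI hM h0 h18 hfac hlt hinj hmf hr hf).mono ?_
  rintro s₁ t₁ ⟨el, ht₁, h₁⟩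
  rw [wp_seq]
  refine (selstep s₁ el _ _ _ h₁).mono ?_
  rintro s₂ t₂ ⟨ht₂, h₂, hrem₂, hev₂⟩
  refine wp_loop (fun s' t => (∃ uf α τ, Phase I mf fac el f uf α τ s' ∧
      FirstEvent I fac s' mf (s'.wvar 20) (s'.rvar 2)) ∧
      t + remaining I mf fac s' ≤ remaining I mf fac s₂) (remaining I mf fac) ?_ ?_ ?_
  · exact ⟨⟨_, _, _, h₂, hev₂⟩, by omega⟩
  · rintro s₃ t hf ⟨⟨uf, α, τ, h, hev⟩, ht⟩ hb
    have hlt' : s₃.wvar 20 < I.n := by simpa [WExp.eval, h.list.w0] using hb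
    have a1 : (mf + 1) * 1 ≤ (mf + 1) * levels I.n := Nat.mul_le_mul_left _ hl
    have a2 : (mf + 1) * levels I.n ≤ (I.n + 1) * levels I.n := Nat.mul_le_mul_right _ (by omega)
    -- The surplus `220 * (mf + 1)` pays for the following `select` and for the test of the loop.
    have step : WP I M (.branch (.pos (.get 5 (.var 20))) freeze openFac) (fun s' t' =>
        (∃ uf α τ, Phase I mf fac el f uf α τ s') ∧
        t' + remaining I mf fac s' + 220 * (mf + 1) ≤ remaining I mf fac s₃) s₃ := by
      refine wp_branch (fun hb => ?_) (fun hb => ?_)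
      · have ho : s₃.warr 5 (s₃.wvar 20) ≠ 0 := by simpa [WExp.eval] using hb
        refine (freeze_spec hI hM h rfl hlt' ho hev).mono ?_
        rintro s₄ t₄ ⟨j, hj, α', τ', h₄, ht₄⟩
        refine ⟨⟨_, _, _, h₄⟩, ?_⟩
        rw [remaining, remaining, h₄.unfrozenOf_eq, h.unfrozenOf_eq, ← Finset.card_erase_add_one hj]
        have : ((uf.erase j).card + 1) * (600 * ((mf + 1) * levels I.n)) =
          (uf.erase j).card * (600 * ((mf + 1) * levels I.n)) + 600 * ((mf + 1) * levels I.n) := by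
          ring
        simp only [Test.time_pos, WExp.time]
        omega
      · have ho : s₃.warr 5 (s₃.wvar 20) = 0 := by simpa [WExp.eval] using hb
        refine (openFac_spec hI hM h rfl hlt' ho hev).mono ?_
        rintro s₄ t₄ ⟨τ', h₄, ht₄⟩
        refine ⟨⟨_, _, _, h₄⟩, ?_⟩
        rw [remaining, remaining, h₄.unfrozenOf_eq, h.unfrozenOf_eq]
        simp only [Test.time_pos, WExp.time]
        omega
    rw [wp_seq]
    refine step.mono ?_
    rintro s₄ t₄ ⟨⟨uf', α', τ', h₄⟩, ht₄⟩
    refine (selstep s₄ el _ _ _ h₄).mono ?_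
    rintro s₅ t₅ ⟨ht₅, h₅, hrem₅, hev₅⟩
    refine ⟨⟨⟨_, _, _, h₅, hev₅⟩, ?_⟩, ?_⟩
    · simp only [Test.time_wlt, WExp.time]; omega
    · omega
  · rintro s₃ t hf ⟨⟨uf, α, τ, h, hev⟩, ht⟩ hb
    have hge : I.n ≤ s₃.wvar 20 := by simpa [WExp.eval, h.list.w0] using hb
    refine ⟨?_, α, s₃.rarr 3, h.dualCert hI ?_ hmf1 hw⟩
    · rw [hrem₂] at ht
      have hrem₁ : remaining I mf fac s₁ = ∑ i ∈ Finset.range mf, potential I s₁ (fac i) +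
        (unfrozenOf I s₁).card * (600 * ((mf + 1) * levels I.n)) := rfl
      have hc : (unfrozenOf I s₁).card ≤ I.n := (Finset.card_filter_le _ _).trans (by simp)
      have b1 := Nat.mul_le_mul_right (600 * ((mf + 1) * levels I.n)) hc
      have b2 : (mf + 1) * (6000 * ((I.n + 1) * levels I.n)) =
        6000 * ((mf + 1) * (I.n * levels I.n)) + 6000 * ((mf + 1) * levels I.n) := by ring
      have b3 : 10000 * ((mf + 1) * ((I.n + 1) * levels I.n)) =
        10000 * ((mf + 1) * (I.n * levels I.n)) + 10000 * ((mf + 1) * levels I.n) := by ring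
      have b4 : I.n * (600 * ((mf + 1) * levels I.n)) = 600 * ((mf + 1) * (I.n * levels I.n)) := by
        ring
      have b5 : (mf + 1) * 1 ≤ (mf + 1) * levels I.n := Nat.mul_le_mul_left _ hl
      simp only [Test.time_wlt, WExp.time]
      omega
    · rcases hev with h1 | ⟨⟨i, hi, h1⟩, -⟩
      · exact h1.2
      · have := h.list.lt i hi
        omega

/-! ## The choice of the multiplier -/

/-- Compute in real variable `1` the squared distance of the point of word variable `13` from the
flagged facilities. -/
def nearestSq : Prog :=
  22 ≔ʷ .lit 0 ;;
  .forIn 19 (.lit 0) (.var 18) (24 ≔ʷ .get 4 (.var 19) ;;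
    .branch (.conj (.pos (.get 3 (.var 24))) (.disj (.wle (.var 22) (.lit 0))
        (.rlt (.dist (.var 13) (.var 24) *ʳ .dist (.var 13) (.var 24)) (.var 1))))
      (22 ≔ʷ .lit 1 ;; 1 ≔ʳ .dist (.var 13) (.var 24) *ʳ .dist (.var 13) (.var 24)) .skip)

/-- Compute the cost of the flagged facilities in real variable `3`. -/
def evaluate : Prog :=
  3 ≔ʳ .lit 0 ;;
  .forIn 13 (.lit 0) (.var 0) (nearestSq ;; 3 ≔ʳ .var 3 +ʳ .weight (.var 13) *ʳ .var 1)

theorem nearestSq_spec {I : Input} {M : ℕ} (hM : 1000 * (I.n + 2) ^ 6 ≤ M)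
    {s : State} {mf x : ℕ} {fac : ℕ → ℕ} (h18 : s.wvar 18 = mf) (h13 : s.wvar 13 = x)
    (hfac : s.warr 4 = fac) (hmf : mf ≤ I.n) {Z : Finset ℕ}
    (hZ : ∀ i < mf, s.warr 3 (fac i) ≠ 0 ↔ fac i ∈ Z)
    (hZF : Z ⊆ (Finset.range mf).image fac) (hZne : Z.Nonempty) :
    WP I M nearestSq (fun s' t => t ≤ 60 * (mf + 1) ∧ s'.rvar 1 = sqDist I Z x) s := by
  have e0 : 0 % M = 0 := Nat.zero_mod M
  have e1 : 1 % M = 1 := Nat.mod_eq_of_lt (small_lt hM (by omega))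
  rw [nearestSq, wp_seq, wp_setW]
  simp only [WExp.eval, WExp.time, e0]
  -- Word variable `22` tells whether real variable `1` holds a distance yet.
  refine wp_for_le 0 mf 45 (fun m s₁ =>
      s₁.wvar 22 = 0 ∧ (∀ i < m, fac i ∉ Z) ∨
        s₁.wvar 22 ≠ 0 ∧ (∃ z ∈ Z, s₁.rvar 1 = I.d x z ^ 2) ∧
          ∀ i < m, fac i ∈ Z → s₁.rvar 1 ≤ I.d x (fac i) ^ 2)
    (by simp [WExp.eval]) (Nat.zero_le _) (small_lt hM (by omega)) ?_ ?_ ?_ ?_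
  · intro i s₁ hf _
    simp only [WExp.eval, hf.wvar 18 rfl]
    simp [h18]
  · exact Or.inl ⟨by simp, fun _ h => absurd h (Nat.not_lt_zero _)⟩
  · rintro m s₁ hf - hm hx hS
    have hfac₁ : s₁.warr 4 = fac := (hf.warr 4 rfl).trans hfac
    have hcen : s₁.warr 3 = s.warr 3 := hf.warr 3 rfl
    have w13 : s₁.wvar 13 = x := (hf.wvar 13 rfl).trans (by simp [h13])
    have hbr : (Test.conj (.pos (.get 3 (.var 24))) (.disj (.wle (.var 22) (.lit 0))
        (.rlt (.dist (.var 13) (.var 24) *ʳ .dist (.var 13) (.var 24)) (.var 1)))).Holds I M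
          (s₁.setW 24 (fac m)) ↔
        fac m ∈ Z ∧ (s₁.wvar 22 = 0 ∨ I.d x (fac m) ^ 2 < s₁.rvar 1) := by
      rw [← hZ m hm]
      simp [WExp.eval, RExp.eval, hcen, w13, sq]
    rw [wp_seq, wp_setW]
    simp only [WExp.eval, WExp.time, hfac₁, hx]
    refine wp_branch (fun hb => ?_) (fun hb => ?_)
    · rw [hbr] at hb
      simp only [wp_seq, wp_setW, wp_setR, WExp.eval, RExp.eval, e1, WExp.time, RExp.time,
        Test.time, Test.time_pos, Test.time_disj, Test.time_rlt]
      refine ⟨by norm_num, by simp [hx], Or.inr ⟨by simp, ⟨fac m, hb.1, by simp [w13, sq]⟩, ?_⟩⟩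
      intro i hi hiZ
      simp only [State.setW_rvar, State.setR_rvar, if_true, State.setW_wvar]
      norm_num only [if_true, if_false]
      rw [w13, ← sq]
      rcases Nat.lt_succ_iff_lt_or_eq.1 hi with hi | rfl
      · rcases hS with hS | hS
        · exact absurd hiZ (hS.2 i hi)
        · exact (hb.2.resolve_left hS.1).le.trans (hS.2.2 i hi hiZ)
      · exact le_rfl
    · rw [hbr, not_and, not_or, not_lt] at hb
      simp only [wp_skip, WExp.time, RExp.time, Test.time, Test.time_pos, Test.time_disj,
        Test.time_rlt]
      refine ⟨by norm_num, by simp [hx], ?_⟩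
      rcases hS with hS | hS
      · refine Or.inl ⟨by simpa using hS.1, fun i hi hiZ => ?_⟩
        rcases Nat.lt_succ_iff_lt_or_eq.1 hi with hi | rfl
        · exact hS.2 i hi hiZ
        · exact (hb hiZ).1 hS.1
      · refine Or.inr ⟨by simpa using hS.1, hS.2.1, fun i hi hiZ => ?_⟩
        rcases Nat.lt_succ_iff_lt_or_eq.1 hi with hi | rfl
        · exact hS.2.2 i hi hiZ
        · exact (hb hiZ).2
  · rintro s₁ T hf - hS hT
    obtain ⟨z, hz⟩ := hZne
    obtain ⟨i, hi, rfl⟩ := Finset.mem_image.1 (hZF hz)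
    have hS := hS.resolve_left fun h => h.2 i (Finset.mem_range.1 hi) hz
    refine ⟨?_, ?_⟩
    · simp only [WExp.time, Nat.sub_zero] at hT
      omega
    · obtain ⟨-, ⟨y, hy, hyr⟩, hmin⟩ := hS
      rw [hyr]
      refine (sqDist_eq hy fun z hz => ?_).symm
      obtain ⟨i', hi', rfl⟩ := Finset.mem_image.1 (hZF hz)
      rw [← hyr]
      exact hmin i' (Finset.mem_range.1 hi') hz

theorem evaluate_spec {I : Input} {M : ℕ} (hM : 1000 * (I.n + 2) ^ 6 ≤ M)
    {s : State} {mf : ℕ} {fac : ℕ → ℕ} (h0 : s.wvar 0 = I.n) (h18 : s.wvar 18 = mf)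
    (hfac : s.warr 4 = fac) (hmf : mf ≤ I.n) (hlt : ∀ i < mf, fac i < I.n)
    (hZF : centers s 0 I.n ⊆ (Finset.range mf).image fac) (hZne : (centers s 0 I.n).Nonempty) :
    WP I M evaluate (fun s' t => t ≤ 100 * ((I.n + 1) * (mf + 1)) ∧
      s'.rvar 3 = costOn I (Finset.range I.n) (centers s 0 I.n)) s := by
  rw [evaluate, wp_seq, wp_setR]
  refine wp_for_le 0 I.n (60 * (mf + 1) + 10) (fun x s₁ => s₁.rvar 3 =
      ∑ x ∈ Finset.range x, I.w x * sqDist I (centers s 0 I.n) x)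
    (by simp [WExp.eval]) (Nat.zero_le _) (small_lt hM (by omega)) ?_ ?_ ?_ ?_
  · intro i s₁ hf _
    simp only [WExp.eval, hf.wvar 0 rfl]
    simp [h0]
  · simp [RExp.eval]
  · rintro x s₁ hf - hx h13 hS
    have hcen : s₁.warr 3 = s.warr 3 := hf.warr 3 rfl
    rw [wp_seq]
    refine (nearestSq_spec hM (Z := centers s 0 I.n) ((hf.wvar 18 rfl).trans h18) h13
      ((hf.warr 4 rfl).trans hfac) hmf ?_ hZF hZne).call ?_
    · intro i hi
      rw [hcen, mem_centers]
      exact ⟨fun h => ⟨⟨Nat.zero_le _, hlt i hi⟩, h⟩, fun h => h.2⟩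
    rintro s₂ t₂ hf₂ ⟨ht₂, hr⟩
    have w13 : s₂.wvar 13 = x := (hf₂.wvar 13 rfl).trans h13
    have r3 : s₂.rvar 3 = s₁.rvar 3 := hf₂.rvar 3 rfl
    simp only [wp_setR, RExp.eval, WExp.eval, RExp.time, WExp.time]
    refine ⟨by omega, by simp [w13], ?_⟩
    simp [Finset.sum_range_succ, hr, r3, hS, w13]
  · rintro s₁ t hf - hS ht
    refine ⟨?_, hS⟩
    simp only [WExp.time, RExp.time, Nat.sub_zero] at ht ⊢
    nlinarith

/-- Reduce the flagged facilities to `k` and compute their cost. -/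
def reduce : Prog := greedy ;; evaluate

theorem reduce_spec {I : Input} {M : ℕ} (hI : I.IsMetric) (hM : 1000 * (I.n + 2) ^ 6 ≤ M)
    {s : State} {mf k : ℕ} {fac : ℕ → ℕ} (h0 : s.wvar 0 = I.n) (h8 : s.wvar 8 = 0)
    (h9 : s.wvar 9 = I.n) (h10 : s.wvar 10 = k) (h18 : s.wvar 18 = mf)
    (hfac : s.warr 4 = fac) (hk : 1 ≤ k) (hmf : mf ≤ I.n) (hlt : ∀ i < mf, fac i < I.n)
    (hZF : centers s 0 I.n ⊆ (Finset.range mf).image fac) (hZne : (centers s 0 I.n).Nonempty) :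
    WP I M reduce (fun s' t => t ≤ 4000 * ((I.n + 1) * (mf + 1) * levels I.n) ∧
      Greedy I (Finset.range I.n) (centers s 0 I.n) (centers s' 0 I.n) ∧
      (centers s' 0 I.n).card = min (centers s 0 I.n).card k ∧
      s'.rvar 3 = costOn I (Finset.range I.n) (centers s' 0 I.n)) s := by
  have hl := levels_pos I.n
  rw [reduce, wp_seq]
  refine (greedy_spec hI hM h0 h8 h9 h10 hk (Nat.zero_le _) le_rfl).call ?_
  rintro s₁ t₁ hf₁ ⟨ht₁, hg, hcard, -⟩
  refine (evaluate_spec hM ((hf₁.wvar 0 rfl).trans h0) ((hf₁.wvar 18 rfl).trans h18)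
    ((hf₁.warr 4 rfl).trans hfac) hmf hlt (hg.subset.trans hZF)
    (Greedy.nonempty hZne hk hcard)).call ?_
  rintro s₂ t₂ hf₂ ⟨ht₂, hr⟩
  have hc : centers s₂ 0 I.n = centers s₁ 0 I.n :=
    centers_congr fun y _ _ => by rw [hf₂.warr 3 rfl]
  rw [hc]
  refine ⟨?_, by rwa [Finset.range_eq_Ico], hcard, hr⟩
  have h1 : (centers s 0 I.n).card ≤ mf :=
    (Finset.card_le_card hZF).trans (Finset.card_image_le.trans (by simp))
  have h2 : (I.n + 1) * ((centers s 0 I.n).card + 1) * levels I.n ≤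
      (I.n + 1) * (mf + 1) * levels I.n :=
    Nat.mul_le_mul_right _ (Nat.mul_le_mul_left _ (by omega))
  have h3 : (I.n + 1) * (mf + 1) * 1 ≤ (I.n + 1) * (mf + 1) * levels I.n :=
    Nat.mul_le_mul_left _ hl
  simp only [Nat.sub_zero] at ht₁
  omega

/-! ### Storing the best solution -/

/-- The solution stored in word array `0`. -/
def stored (I : Input) (s : State) : Finset ℕ := {y ∈ Finset.range I.n | s.warr 0 y ≠ 0}

/-- Store the flagged points in word array `0` and their cost in real variable `4`. -/
def keep : Prog :=
  .forIn 13 (.lit 0) (.var 0) (.setWArr 0 (.var 13) (.get 3 (.var 13))) ;; 4 ≔ʳ .var 3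

theorem keep_spec {I : Input} {M : ℕ} (hM : 1000 * (I.n + 2) ^ 6 ≤ M) {s : State}
    (h0 : s.wvar 0 = I.n) : WP I M keep (fun s' t => t ≤ 30 * (I.n + 1) ∧
      stored I s' = centers s 0 I.n ∧ s'.rvar 4 = s.rvar 3) s := by
  rw [keep, wp_seq]
  refine wp_for_le 0 I.n 5 (fun i s₁ => ∀ y < i, s₁.warr 0 y = s.warr 3 y) (by simp [WExp.eval])
    (Nat.zero_le _) (small_lt hM (by omega)) ?_ (by simp) ?_ ?_
  · intro i s₁ hf _
    simp only [WExp.eval, hf.wvar 0 rfl, h0]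
  · rintro x s₁ hf - hx h13 hS
    simp only [wp_setWArr, WExp.eval, h13, WExp.time]
    refine ⟨by norm_num, h13, fun y hy => ?_⟩
    simp only [State.setW_warr, State.setWArr_warr, if_true, Function.update_apply]
    split_ifs with hyx
    · rw [hyx, hf.warr 3 rfl]
    · exact hS y (by omega)
  · rintro s₁ t hf - hS ht
    simp only [wp_setR, RExp.eval, RExp.time]
    refine ⟨?_, ?_, by simp [hf.rvar 3 rfl]⟩
    · simp only [WExp.time, Nat.sub_zero] at ht ⊢
      omega
    · ext y
      rw [stored, Finset.mem_filter, mem_centers, Finset.mem_range]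
      constructor
      · rintro ⟨h1, h2⟩; exact ⟨⟨Nat.zero_le _, h1⟩, by rwa [← hS y h1]⟩
      · rintro ⟨⟨-, h1⟩, h2⟩; exact ⟨h1, by rw [State.setR_warr, hS y h1]; exact h2⟩

/-! ### Trying a geometric sequence of opening costs -/

/-- Try the multipliers `G / (56 n³) * 2 ^ j`, where `G` is in real variable `5`. -/
def search : Prog :=
  25 ≔ʷ .lit 1 ;;
  .loop (.wle (.var 25) (.lit 112 *ʷ .var 0 *ʷ .var 0 *ʷ .var 0)) (
    0 ≔ʳ (.var 5 *ʳ .ofWord (.var 25)) /ʳ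
      (.lit 56 *ʳ .ofWord (.var 0) *ʳ .ofWord (.var 0) *ʳ .ofWord (.var 0)) ;;
    primalDual ;;
    reduce ;;
    .branch (.rlt (.var 3) (.var 4)) keep .skip ;;
    25 ≔ʷ .var 25 +ʷ .var 25)

/-- From the flagged points to at most `k` of them. -/
def finish : Prog :=
  8 ≔ʷ .lit 0 ;; 9 ≔ʷ .var 0 ;; collect ;;
  18 ≔ʷ .var 11 ;;
  -- The facilities are copied because word array `2` is overwritten by the primal-dual method and
  -- by `collect`.
  .forIn 19 (.lit 0) (.var 18) (.setWArr 4 (.var 19) (.get 2 (.var 19))) ;;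
  10 ≔ʷ .var 1 ;; reduce ;; keep ;; 5 ≔ʳ .var 4 ;;
  -- A solution of cost `0` needs no search, and then `G = 0` would not give positive multipliers.
  .branch (.rlt (.lit 0) (.var 5)) search .skip

/-- The data for the choice of the multiplier. -/
structure Ready (I : Input) (mf k : ℕ) (fac : ℕ → ℕ) (s : State) : Prop where
  w0 : s.wvar 0 = I.n
  w8 : s.wvar 8 = 0
  w9 : s.wvar 9 = I.n
  w10 : s.wvar 10 = k
  w18 : s.wvar 18 = mf
  wa4 : s.warr 4 = fac
  lt : ∀ i < mf, fac i < I.n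
  inj : Set.InjOn fac (Finset.range mf)
  pos : 1 ≤ mf
  le : mf ≤ I.n
  one_le : 1 ≤ k

/-- Word array `0` stores a solution. -/
structure Best (I : Input) (k : ℕ) (s : State) : Prop where
  nonempty : (stored I s).Nonempty
  card_le : (stored I s).card ≤ k
  cost_eq : s.rvar 4 = costOn I (Finset.range I.n) (stored I s)

theorem Best.congr {I : Input} {k : ℕ} {s s' : State} (h : Best I k s)
    (ha : s'.warr 0 = s.warr 0) (hr : s'.rvar 4 = s.rvar 4) : Best I k s' := by
  have : stored I s' = stored I s := by rw [stored, stored, ha]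
  exact ⟨by rw [this]; exact h.nonempty, by rw [this]; exact h.card_le,
    by rw [this, hr]; exact h.cost_eq⟩

/-- The multiplier `f` was tried. -/
def Tried (I : Input) (F : Finset ℕ) (k : ℕ) (f r : ℝ) : Prop :=
  ∃ Z Y, (∃ α R, DualCert I F f Z α R) ∧ Z.Nonempty ∧ Greedy I (Finset.range I.n) Z Y ∧
    Y.card = min Z.card k ∧ r ≤ costOn I (Finset.range I.n) Y

/-- The second part also lets a power of two up to `112 n³` be doubled without overflow. -/
theorem cube_lt {n M : ℕ} (hM : 1000 * (n + 2) ^ 6 ≤ M) (hn : 1 ≤ n) :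
    (112 % M * n % M * n % M * n % M = 112 * n ^ 3) ∧ 225 * n ^ 3 < M := by
  have h1 : (n + 2) ^ 3 ≤ (n + 2) ^ 6 := Nat.pow_le_pow_right (by omega) (by omega)
  have h2 : n ^ 3 ≤ (n + 2) ^ 3 := Nat.pow_le_pow_left (by omega) 3
  have h3 : n ^ 1 ≤ n ^ 3 := Nat.pow_le_pow_right hn (by omega)
  have h4 : n ^ 2 ≤ n ^ 3 := Nat.pow_le_pow_right hn (by omega)
  have h5 : 0 < n ^ 3 := by positivity
  rw [pow_one] at h3
  refine ⟨?_, by omega⟩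
  rw [Nat.mod_eq_of_lt (a := 112) (by omega), Nat.mod_eq_of_lt (a := 112 * n) (by omega),
    Nat.mod_eq_of_lt (a := 112 * n * n) (by nlinarith), Nat.mod_eq_of_lt (by nlinarith)]
  ring

/-- `112 n³ = 14 * (2n)³ < 2 ^ (3 * levels n + 4)`, and `levels n` is at least `1`. -/
theorem doublings_le {n j : ℕ} (h : 2 ^ j ≤ 112 * n ^ 3) : j + 1 ≤ 7 * levels n := by
  have hl := levels_pos n
  have h1 : 2 * n < 2 ^ levels n := Nat.lt_pow_succ_log_self (by omega) _
  have h2 : (2 * n) ^ 3 < (2 ^ levels n) ^ 3 := Nat.pow_lt_pow_left h1 (by omega)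
  have h3 : 2 ^ j < 2 ^ (3 * levels n + 4) := by
    rw [pow_add, mul_comm 3, pow_mul]
    calc 2 ^ j ≤ 112 * n ^ 3 := h
      _ = (2 * n) ^ 3 * 14 := by ring
      _ < (2 ^ levels n) ^ 3 * 2 ^ 4 := by omega
  have := (Nat.pow_lt_pow_iff_right (by omega)).1 h3
  omega

/-- The stored cost never increases, so what `Tried` says about an earlier multiplier stays true of
the final cost. There are logarithmically many multipliers, which is the second factor `levels`. -/
theorem search_spec {I : Input} {M : ℕ} (hI : I.IsMetric) (hM : 1000 * (I.n + 2) ^ 6 ≤ M)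
    {s : State} {mf k : ℕ} {fac : ℕ → ℕ} {G : ℝ} (h : Ready I mf k fac s) (hB : Best I k s)
    (h5 : s.rvar 5 = G) (hG : 0 < G) (hw : 0 < ∑ j ∈ Finset.range I.n, I.w j) :
    WP I M search (fun s' t => t ≤ 110000 * ((I.n + 1) * (mf + 1) * levels I.n ^ 2) ∧
      Best I k s' ∧ s'.rvar 4 ≤ s.rvar 4 ∧ ∀ j, 2 ^ j ≤ 112 * I.n ^ 3 →
        Tried I ((Finset.range mf).image fac) k (G / (56 * I.n ^ 3) * 2 ^ j) (s'.rvar 4)) s := by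
  have hl := levels_pos I.n
  have hn : 1 ≤ I.n := h.pos.trans h.le
  have hn' : (0 : ℝ) < I.n := by exact_mod_cast hn
  have e1 : 1 % M = 1 := Nat.mod_eq_of_lt (small_lt hM (by omega))
  obtain ⟨ec, hcM⟩ := cube_lt hM hn
  set A := (I.n + 1) * (mf + 1) * levels I.n with hA
  have hA1 : I.n + 1 ≤ A := by
    calc I.n + 1 = (I.n + 1) * 1 * 1 := by ring
      _ ≤ A := Nat.mul_le_mul (Nat.mul_le_mul_left _ (by omega)) hl
  rw [search, wp_seq, wp_setW]
  simp only [WExp.eval, WExp.time, e1]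
  refine wp_loop (fun s₁ t => ∃ j, s₁.wvar 25 = 2 ^ j ∧ j ≤ 7 * levels I.n ∧ t ≤ j * (15000 * A) ∧
      Best I k s₁ ∧ s₁.rvar 4 ≤ s.rvar 4 ∧ ∀ j' < j,
        Tried I ((Finset.range mf).image fac) k (G / (56 * I.n ^ 3) * 2 ^ j') (s₁.rvar 4))
    (fun s₁ => 225 * I.n ^ 3 - s₁.wvar 25) ?_ ?_ ?_
  · exact ⟨0, by simp, by omega, by simp, hB.congr rfl rfl, le_rfl,
      fun _ h => absurd h (Nat.not_lt_zero _)⟩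
  · rintro s₁ t hf ⟨j, hj, hjl, ht, hB₁, hr₁, htried⟩ hb
    have w0 : s₁.wvar 0 = I.n := (hf.wvar 0 rfl).trans (by simp [h.w0])
    have hpow : 2 ^ j ≤ 112 * I.n ^ 3 := by
      simpa only [Test.holds_wle, WExp.eval, hj, w0, ec] using hb
    set f := G / (56 * I.n ^ 3) * 2 ^ j with hf₀
    have hf0 : 0 ≤ f := by positivity
    rw [wp_seq, wp_setR]
    have ef : RExp.eval I M s₁ ((.var 5 *ʳ .ofWord (.var 25)) /ʳ
      (.lit 56 *ʳ .ofWord (.var 0) *ʳ .ofWord (.var 0) *ʳ .ofWord (.var 0))) = f := by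
      have r5 : s₁.rvar 5 = G := (hf.rvar 5 rfl).trans h5
      simp only [RExp.eval, WExp.eval, r5, hj, w0, hf₀]
      push_cast
      field_simp
    rw [ef]
    simp only [RExp.time, WExp.time]
    rw [wp_seq]
    refine (primalDual_spec hI hM (s := s₁.setR 0 f) (mf := mf) (fac := fac) (f := f) w0
      ((hf.wvar 18 rfl).trans (by simp [h.w18])) ((hf.warr 4 rfl).trans h.wa4) h.lt h.inj h.pos h.le
      (by simp) hf0 hw).call ?_
    rintro s₂ t₂ hf₂ ⟨ht₂, hcert⟩
    obtain ⟨α, R, hcert'⟩ := id hcert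
    have hZne : (centers s₂ 0 I.n).Nonempty := by
      obtain ⟨z, hz, -⟩ := hcert'.cover 0 hn
      exact ⟨z, hz⟩
    have w0₂ : s₂.wvar 0 = I.n := (hf₂.wvar 0 rfl).trans w0
    rw [wp_seq]
    refine (reduce_spec hI hM (mf := mf) (k := k) (fac := fac) w0₂
      ((hf₂.wvar 8 rfl).trans ((hf.wvar 8 rfl).trans (by simp [h.w8])))
      ((hf₂.wvar 9 rfl).trans ((hf.wvar 9 rfl).trans (by simp [h.w9])))
      ((hf₂.wvar 10 rfl).trans ((hf.wvar 10 rfl).trans (by simp [h.w10])))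
      ((hf₂.wvar 18 rfl).trans ((hf.wvar 18 rfl).trans (by simp [h.w18])))
      ((hf₂.warr 4 rfl).trans ((hf.warr 4 rfl).trans h.wa4)) h.one_le h.le h.lt hcert'.subset
      hZne).call ?_
    rintro s₃ t₃ hf₃ ⟨ht₃, hg, hcard, hcost⟩
    have hYne := Greedy.nonempty hZne h.one_le hcard
    have w0₃ : s₃.wvar 0 = I.n := (hf₃.wvar 0 rfl).trans w0₂
    have w25₃ : s₃.wvar 25 = 2 ^ j := (hf₃.wvar 25 rfl).trans ((hf₂.wvar 25 rfl).trans hj)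
    have r4₃ : s₃.rvar 4 = s₁.rvar 4 := (hf₃.rvar 4 rfl).trans (hf₂.rvar 4 rfl)
    have a0₃ : s₃.warr 0 = s₁.warr 0 := (hf₃.warr 0 rfl).trans (hf₂.warr 0 rfl)
    have upd : WP I M (.branch (.rlt (.var 3) (.var 4)) keep .skip) (fun s' T =>
        T ≤ 30 * (I.n + 1) + 10 ∧ Best I k s' ∧ s'.rvar 4 ≤ s₁.rvar 4 ∧
        s'.rvar 4 ≤ costOn I (Finset.range I.n) (centers s₃ 0 I.n)) s₃ := by
      refine wp_branch (fun hb => ?_) (fun hb => ?_)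
      · have hb : s₃.rvar 3 < s₁.rvar 4 := by simpa [RExp.eval, r4₃] using hb
        refine (keep_spec hM w0₃).mono ?_
        rintro s₄ t₄ ⟨ht₄, hst, hr⟩
        simp only [Test.time_rlt, RExp.time]
        refine ⟨by omega, ⟨?_, ?_, ?_⟩, ?_, ?_⟩
        · rw [hst]; exact hYne
        · rw [hst, hcard]; exact min_le_right _ _
        · rw [hst, hr, hcost]
        · rw [hr]; exact hb.le
        · rw [hr, hcost]
      · have hb : s₁.rvar 4 ≤ s₃.rvar 3 := by simpa [RExp.eval, r4₃] using hb
        simp only [wp_skip, Test.time_rlt, RExp.time]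
        exact ⟨by omega, hB₁.congr a0₃ r4₃, r4₃.le, by rw [r4₃, ← hcost]; exact hb⟩
    rw [wp_seq]
    refine upd.call ?_
    rintro s₄ t₄ hf₄ ⟨ht₄, hB₄, hr₄, hc₄⟩
    have w25₄ : s₄.wvar 25 = 2 ^ j := (hf₄.wvar 25 rfl).trans w25₃
    have hpos : 0 < 2 ^ j := by positivity
    have e2 : (2 ^ j + 2 ^ j) % M = 2 ^ (j + 1) := by
      rw [Nat.mod_eq_of_lt (by omega)]; ring
    simp only [wp_setW, WExp.eval, w25₄, e2, WExp.time]
    refine ⟨⟨j + 1, by simp, doublings_le hpow, ?_, hB₄.congr rfl rfl, hr₄.trans hr₁, ?_⟩, ?_⟩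
    · simp only [Test.time, WExp.time]
      have b1 : 10000 * ((mf + 1) * ((I.n + 1) * levels I.n)) = 10000 * A := by rw [hA]; ring
      have b2 : (j + 1) * (15000 * A) = j * (15000 * A) + 15000 * A := by ring
      omega
    · intro j' hj'
      rcases Nat.lt_succ_iff_lt_or_eq.1 hj' with hj' | rfl
      · obtain ⟨Z, Y, c1, c2, c3, c4, c5⟩ := htried j' hj'
        exact ⟨Z, Y, c1, c2, c3, c4, hr₄.trans c5⟩
      · exact ⟨_, _, hcert, hZne, hg, hcard, hc₄⟩
    · simp only [State.setW_wvar, if_true, hj]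
      have : 2 ^ (j + 1) = 2 ^ j * 2 := pow_succ 2 j
      omega
  · rintro s₁ t hf ⟨j, hj, hjl, ht, hB₁, hr₁, htried⟩ hb
    have w0 : s₁.wvar 0 = I.n := (hf.wvar 0 rfl).trans (by simp [h.w0])
    have hpow : 112 * I.n ^ 3 < 2 ^ j := by
      simpa only [Test.holds_wle, WExp.eval, hj, w0, ec, not_le] using hb
    refine ⟨?_, hB₁, hr₁, fun j' hj' => htried j' ?_⟩
    · simp only [Test.time, WExp.time]
      have b1 := Nat.mul_le_mul_right (15000 * A) hjl
      have b2 : (I.n + 1) * (mf + 1) * levels I.n ^ 2 = A * levels I.n := by rw [hA]; ring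
      have b3 : 7 * levels I.n * (15000 * A) = 105000 * (A * levels I.n) := by ring
      have b4 : A * 1 ≤ A * levels I.n := Nat.mul_le_mul_left _ hl
      rw [b2]
      omega
    · exact (Nat.pow_lt_pow_iff_right (by omega)).1 (hj'.trans_lt hpow)

/-- Reverse greedy without slack. -/
theorem Greedy.cost_le_sq {I : Input} (hI : I.IsMetric) {S Y T : Finset ℕ} {k : ℕ}
    (h : Greedy I (Finset.range I.n) S Y) (hS : S ⊆ Finset.range I.n) (hY : Y.card = min S.card k)
    (hTS : T ⊆ S) (hT : T.Nonempty) (hTk : T.card ≤ k) :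
    costOn I (Finset.range I.n) Y ≤ 56 * I.n ^ 2 * costOn I (Finset.range I.n) T := by
  set O := costOn I (Finset.range I.n) T
  have hO : 0 ≤ O := costOn_nonneg hI _ _
  have hSn : S.card ≤ I.n := by simpa using Finset.card_le_card hS
  have hTc := Finset.card_le_card hTS
  have hn : 1 ≤ I.n := hT.card_pos.trans_le (hTc.trans hSn)
  have hn' : (1 : ℝ) ≤ I.n := by exact_mod_cast hn
  have hYS : Y.card ≤ S.card := by omega
  have hTY : T.card ≤ Y.card := by rw [hY]; exact le_min hTc hTk
  have hd : (S.card : ℝ) - Y.card ≤ I.n := by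
    have : (S.card : ℝ) ≤ I.n := by exact_mod_cast hSn
    have : (0 : ℝ) ≤ Y.card := by positivity
    linarith
  have hd0 : 0 ≤ (S.card : ℝ) - Y.card := by
    have : (Y.card : ℝ) ≤ S.card := by exact_mod_cast hYS
    linarith
  have hcS : costOn I (Finset.range I.n) S ≤ O := costOn_anti hI _ hTS hT
  have hTY' : (T.card : ℝ) ≤ Y.card := by exact_mod_cast hTY
  -- The slack is only `K = 1` and there may be `n` deletions; `θ = n` keeps the exponent at most
  -- `2`, at the price of a quadratic additive term. The constant is `8 * 7 = 56`.
  refine (h.cost_le hI (Finset.Subset.refl _) (hTS.trans hS) hT (K := 1) (θ := I.n) one_pos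
    (by linarith) (by linarith)).trans ?_
  have e1 : Real.exp (2 / (I.n * 1) * ((S.card : ℝ) - Y.card)) ≤ 8 := by
    have h1 : 2 / ((I.n : ℝ) * 1) * ((S.card : ℝ) - Y.card) ≤ 2 := by
      rw [mul_one, div_mul_eq_mul_div, div_le_iff₀ (by linarith)]
      linarith
    have h2 : Real.exp 2 ≤ 8 := by
      have h3 := Real.exp_one_lt_d9
      have h4 : Real.exp 2 = Real.exp 1 * Real.exp 1 := by rw [← Real.exp_add]; norm_num
      have h5 := Real.exp_pos 1
      rw [h4]; nlinarith
    exact (Real.exp_le_exp.2 h1).trans h2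
  have e2 : costOn I (Finset.range I.n) S + ((S.card : ℝ) - Y.card) *
      ((2 * I.n + 4) / 1 * O) ≤ 7 * I.n ^ 2 * O := by
    have h1 : ((S.card : ℝ) - Y.card) * ((2 * I.n + 4) / 1 * O) ≤ I.n * ((2 * I.n + 4) / 1 * O) :=
      mul_le_mul_of_nonneg_right hd (by positivity)
    have h2 : O + I.n * ((2 * I.n + 4) / 1 * O) = (1 + 2 * I.n ^ 2 + 4 * I.n) * O := by ring
    have h3 : (1 + 2 * (I.n : ℝ) ^ 2 + 4 * I.n) * O ≤ 7 * I.n ^ 2 * O :=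
      mul_le_mul_of_nonneg_right (by nlinarith) hO
    linarith
  calc _ ≤ 8 * (7 * I.n ^ 2 * O) := mul_le_mul e1 e2 (add_nonneg (costOn_nonneg hI _ _)
        (mul_nonneg hd0 (by positivity))) (by norm_num)
    _ = _ := by ring

/-- Plain reverse greedy has a cost `G` with `G ≤ 56 n² cost(T)`. If also `G > cost(T)`, the
multipliers `G / (56 n³) * 2 ^ j` start below `cost(T) / k` and end above `cost(T)`, so
`exists_good_multiplier` applies; if `G ≤ cost(T)`, the stored solution is already good enough. -/
theorem finish_spec {I : Input} {M k : ℕ} (hI : I.IsMetric) (hM : 1000 * (I.n + 2) ^ 6 ≤ M)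
    {s : State} (hk : 1 ≤ k) (h0 : s.wvar 0 = I.n) (h1 : s.wvar 1 = k)
    (hS : (centers s 0 I.n).Nonempty) {T : Finset ℕ} (hTS : T ⊆ centers s 0 I.n)
    (hT : T.Nonempty) (hTk : T.card ≤ k) :
    WP I M finish (fun s' t =>
      t ≤ 120000 * ((I.n + 1) * ((centers s 0 I.n).card + 1) * levels I.n ^ 2) ∧
      (stored I s').Nonempty ∧ (stored I s').card ≤ k ∧
      costOn I (Finset.range I.n) (stored I s') ≤ 1400 * costOn I (Finset.range I.n) T) s := by
  have hl := levels_pos I.n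
  have e0 : 0 % M = 0 := Nat.zero_mod M
  have hSn : centers s 0 I.n ⊆ Finset.range I.n := by
    rw [Finset.range_eq_Ico]; exact Finset.filter_subset _ _
  set S := centers s 0 I.n with hSdef
  have hSc : S.card ≤ I.n := by simpa using Finset.card_le_card hSn
  have hn : 1 ≤ I.n := hS.card_pos.trans_le hSc
  have hn' : (0 : ℝ) < I.n := by exact_mod_cast hn
  rw [finish, wp_seq, wp_setW, wp_seq, wp_setW, wp_seq]
  simp only [WExp.eval, WExp.time, e0, State.setW_wvar]
  norm_num only [if_true, if_false]
  rw [h0]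
  refine (collect_spec hM (s := (s.setW 8 0).setW 9 I.n) (lo := 0) (hi := I.n) (by simp) (by simp)
    (Nat.zero_le _) le_rfl).call ?_
  rintro s₁ t₁ hf₁ ⟨ht₁, h11, hinj, himg⟩
  have hc : centers ((s.setW 8 0).setW 9 I.n) 0 I.n = S := rfl
  rw [hc] at h11 hinj himg
  set mf := S.card with hmf
  rw [wp_seq, wp_setW, wp_seq]
  simp only [WExp.eval, WExp.time, h11]
  refine wp_for_le 0 mf 5 (fun i s₂ => ∀ j < i, s₂.warr 4 j = s₁.warr 2 j) (by simp [WExp.eval])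
    (Nat.zero_le _) (small_lt hM (by omega)) ?_ (by simp) ?_ ?_
  · intro i s₂ hf _
    simp only [WExp.eval, hf.wvar 18 rfl]
    simp
  · rintro i s₂ hf - hi h19 h
    simp only [wp_setWArr, WExp.eval, WExp.time, h19]
    refine ⟨by norm_num, h19, fun j hj => ?_⟩
    simp only [State.setW_warr, State.setWArr_warr, if_true, Function.update_apply]
    split_ifs with hji
    · rw [hji, hf.warr 2 rfl]; rfl
    · exact h j (by omega)
  rintro s₂ t₂ hf₂ - hcopy ht₂
  set fac := s₂.warr 4 with hfac
  have hinj' : Set.InjOn fac (Finset.range mf) := by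
    intro a ha b hb hab
    rw [hcopy a (by simpa using ha), hcopy b (by simpa using hb)] at hab
    exact hinj ha hb hab
  have himg' : (Finset.range mf).image fac = S := by
    rw [← himg]
    exact Finset.image_congr fun j hj => hcopy j (by simpa using hj)
  have hlt : ∀ i < mf, fac i < I.n := fun i hi => Finset.mem_range.1 (hSn (by
    rw [← himg']; exact Finset.mem_image_of_mem _ (Finset.mem_range.2 hi)))
  have w1 : s₂.wvar 1 = k := by
    rw [hf₂.wvar 1 rfl]; simp only [State.setW_wvar]; norm_num only [if_true, if_false]
    rw [hf₁.wvar 1 rfl]; simp [h1]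
  have w0₁ : s₁.wvar 0 = I.n := by rw [hf₁.wvar 0 rfl]; simp [h0]
  have r₂ : Ready I mf k fac (s₂.setW 10 k) := by
    refine ⟨?_, ?_, ?_, by simp, ?_, rfl, hlt, hinj', hS.card_pos, hSc, hk⟩
    · simp [hf₂.wvar 0 rfl, w0₁]
    · simp [hf₂.wvar 8 rfl, hf₁.wvar 8 rfl]
    · simp [hf₂.wvar 9 rfl, hf₁.wvar 9 rfl]
    · simp [hf₂.wvar 18 rfl]
  have hc₂ : centers (s₂.setW 10 k) 0 I.n = S := by
    refine centers_congr fun y _ _ => ?_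
    rw [State.setW_warr, hf₂.warr 3 rfl, State.setW_warr, hf₁.warr 3 rfl]; rfl
  rw [wp_seq, wp_setW, wp_seq]
  simp only [WExp.eval, WExp.time, w1]
  refine (reduce_spec hI hM r₂.w0 r₂.w8 r₂.w9 r₂.w10 r₂.w18 r₂.wa4 hk hSc hlt
    (by rw [hc₂, himg']) (by rw [hc₂]; exact hS)).call ?_
  rintro s₃ t₃ hf₃ ⟨ht₃, hg, hcard, hcost⟩
  rw [hc₂] at hg hcard
  have hYne := Greedy.nonempty hS hk hcard
  rw [wp_seq]
  refine (keep_spec hM ((hf₃.wvar 0 rfl).trans r₂.w0)).call ?_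
  rintro s₄ t₄ hf₄ ⟨ht₄, hst, hr₄⟩
  rw [wp_seq, wp_setR]
  simp only [RExp.eval, RExp.time]
  set Y := centers s₃ 0 I.n
  set G := s₄.rvar 4 with hG
  have hGY : G = costOn I (Finset.range I.n) Y := hr₄.trans hcost
  have hO : 0 ≤ costOn I (Finset.range I.n) T := costOn_nonneg hI _ _
  set A := (I.n + 1) * (mf + 1) * levels I.n with hA
  have b2 : (I.n + 1) * (mf + 1) * levels I.n ^ 2 = A * levels I.n := by rw [hA]; ring
  have b3 : A * 1 ≤ A * levels I.n := Nat.mul_le_mul_left _ hl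
  have b4 : I.n + 1 ≤ A := by
    calc I.n + 1 = (I.n + 1) * 1 * 1 := by ring
      _ ≤ A := Nat.mul_le_mul (Nat.mul_le_mul_left _ (by omega)) hl
  simp only [WExp.time, Nat.sub_zero] at ht₂ ht₁
  have hB : Best I k (s₄.setR 5 G) := by
    have : stored I (s₄.setR 5 G) = Y := hst
    refine ⟨?_, ?_, ?_⟩
    · rw [this]; exact hYne
    · rw [this, hcard]; exact min_le_right _ _
    · rw [this]; simpa using hGY
  refine wp_branch (fun hb => ?_) (fun hb => ?_)
  · have hGpos : 0 < G := by simpa [RExp.eval] using hb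
    -- A positive cost needs a client of positive weight.
    have hw : 0 < ∑ j ∈ Finset.range I.n, I.w j := by
      refine lt_of_le_of_ne (Finset.sum_nonneg fun j _ => hI.w_nonneg j) fun h => ?_
      have hz := (Finset.sum_eq_zero_iff_of_nonneg fun j _ => hI.w_nonneg j).1 h.symm
      have : costOn I (Finset.range I.n) Y = 0 := Finset.sum_eq_zero fun j hj => by
        rw [hz j hj, zero_mul]
      linarith
    have r₄ : Ready I mf k fac (s₄.setR 5 G) :=
      ⟨(hf₄.wvar 0 rfl).trans ((hf₃.wvar 0 rfl).trans r₂.w0),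
        (hf₄.wvar 8 rfl).trans ((hf₃.wvar 8 rfl).trans r₂.w8),
        (hf₄.wvar 9 rfl).trans ((hf₃.wvar 9 rfl).trans r₂.w9),
        (hf₄.wvar 10 rfl).trans ((hf₃.wvar 10 rfl).trans r₂.w10),
        (hf₄.wvar 18 rfl).trans ((hf₃.wvar 18 rfl).trans r₂.w18),
        (hf₄.warr 4 rfl).trans ((hf₃.warr 4 rfl).trans r₂.wa4), hlt, hinj', hS.card_pos, hSc, hk⟩
    refine (search_spec hI hM r₄ hB (G := G) (by simp) hGpos hw).mono ?_
    rintro s₅ t₅ ⟨ht₅, hB₅, hr₅, htried⟩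
    refine ⟨?_, hB₅.nonempty, hB₅.card_le, ?_⟩
    · simp only [Test.time_rlt, RExp.time]
      rw [b2] at ht₅ ⊢
      omega
    rw [← hB₅.cost_eq]
    have hr₅ : s₅.rvar 4 ≤ G := by simpa using hr₅
    by_cases hGO : G ≤ costOn I (Finset.range I.n) T
    · linarith
    push Not at hGO
    -- The least power of two reaching `56 n³` is below twice that number, hence among the powers
    -- that were tried.
    set J := Nat.clog 2 (56 * I.n ^ 3)
    have hn3 : 1 ≤ I.n ^ 3 := Nat.one_le_pow _ _ hn
    have hJ1 : 56 * I.n ^ 3 ≤ 2 ^ J := Nat.le_pow_clog (by omega) _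
    have hJ2 : 2 ^ (J - 1) < 56 * I.n ^ 3 := Nat.pow_pred_clog_lt_self (by omega) (by omega)
    have hJ3 : 2 ^ J ≤ 112 * I.n ^ 3 := by
      have hJp : 1 ≤ J := Nat.clog_pos (by omega) (by omega)
      have : 2 ^ J = 2 ^ (J - 1) * 2 := by rw [← pow_succ]; congr 1; omega
      omega
    have htr : ∀ j, j ≤ J → Tried I ((Finset.range mf).image fac) k
        (G / (56 * I.n ^ 3) * 2 ^ j) (s₅.rvar 4) := fun j hj =>
      htried j ((Nat.pow_le_pow_right (by omega) hj).trans hJ3)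
    choose! Z Y' c1 c2 c3 c4 c5 using htr
    have hlow : G / (56 * I.n ^ 3) * k ≤ costOn I (Finset.range I.n) T := by
      have hG2 := hg.cost_le_sq hI hSn hcard hTS hT hTk
      rw [← hGY] at hG2
      by_cases hkn : k ≤ I.n
      · have hkn' : (k : ℝ) ≤ I.n := by exact_mod_cast hkn
        rw [div_mul_eq_mul_div, div_le_iff₀ (by positivity)]
        calc G * k ≤ G * I.n := mul_le_mul_of_nonneg_left hkn' hGpos.le
          _ ≤ 56 * I.n ^ 2 * costOn I (Finset.range I.n) T * I.n :=
            mul_le_mul_of_nonneg_right hG2 hn'.le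
          _ = _ := by ring
      -- For `k > n` greedy deletes nothing, so `G = cost(S) ≤ cost(T)`.
      · exfalso
        have : Y = S := Finset.eq_of_subset_of_card_le hg.subset (by omega)
        have h2 := costOn_anti hI (Finset.range I.n) hTS hT
        rw [← this] at h2
        linarith
    have hhigh : costOn I (Finset.range I.n) T < G / (56 * I.n ^ 3) * 2 ^ J := by
      have hJ1' : (56 : ℝ) * I.n ^ 3 ≤ 2 ^ J := by exact_mod_cast hJ1
      refine hGO.trans_le ?_
      rw [div_mul_eq_mul_div, le_div_iff₀ (by positivity)]
      exact mul_le_mul_of_nonneg_left hJ1' hGpos.le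
    obtain ⟨j, hj, hle⟩ := exists_good_multiplier hI (F := (Finset.range mf).image fac) (T := T)
      (k := k) (J := J) (f₀ := G / (56 * I.n ^ 3)) (by rw [himg']; exact hSn)
      (by rw [himg']; exact hTS) hT hTk (by positivity) hlow hhigh c1 c2 c3 c4
    exact (c5 j hj).trans hle
  · have hG0 : G ≤ 0 := by simpa [RExp.eval] using hb
    simp only [wp_skip, Test.time_rlt, RExp.time]
    refine ⟨?_, hB.nonempty, hB.card_le, ?_⟩
    · rw [b2]; omega
    · rw [← hB.cost_eq]
      have : (s₄.setR 5 G).rvar 4 = G := by simp [hG]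
      rw [this]; linarith

/-! ## Weighted metric spaces as inputs -/

/-- The algorithm. -/
def kMeans : Prog := sparsify ;; finish

/-- The projection of `T` to the thinned set is the solution against which the second stage is
measured, so its constant factor applies to twice the thinning cost plus `8 cost(T)`. -/
theorem kMeans_spec {I : Input} {M k : ℕ} (hI : I.IsMetric) (hM : 1000 * (I.n + 2) ^ 6 ≤ M)
    {s : State} (hk : 1 ≤ k) (hkn : k ≤ I.n) (h0 : s.wvar 0 = I.n) (h1 : s.wvar 1 = k)
    {T : Finset ℕ} (hTn : T ⊆ Finset.range I.n) (hT : T.Nonempty) (hTk : T.card ≤ k) {θ : ℝ}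
    (hθ : 1 ≤ θ) (hθn : Real.log (I.n / k) / Real.log 2 ≤ θ) :
    WP I M kMeans (fun s' t => t ≤ 760000 * (I.n * k * levels I.n ^ 2) ∧
      (stored I s').Nonempty ∧ (stored I s').card ≤ k ∧
      costOn I (Finset.range I.n) (stored I s') ≤
        1400 * (24 * Real.exp 4 * θ ^ 2 + 8) * costOn I (Finset.range I.n) T) s := by
  rw [kMeans, wp_seq]
  refine (sparsify_spec hI hM hk hkn h0 h1 hTn hT hTk hθ hθn).call ?_
  rintro s₁ t₁ hf₁ ⟨ht₁, hne, hcard, hcost⟩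
  obtain ⟨U, hUS, hU, hUT, hUc⟩ := exists_projection_cost hI hne hT hTn
    (Finset.Subset.refl (Finset.range I.n))
  refine (finish_spec hI hM hk ((hf₁.wvar 0 rfl).trans h0) ((hf₁.wvar 1 rfl).trans h1) hne hUS hU
    (hUT.trans hTk)).mono ?_
  rintro s₂ t₂ ⟨ht₂, h2, h3, h4⟩
  refine ⟨?_, h2, h3, ?_⟩
  -- `n + 1 ≤ 2n` and `2k + 1 ≤ 3k`, so the total is `40000 + 6 * 120000 = 760000`.
  · have a1 : (I.n + 1) * ((centers s₁ 0 I.n).card + 1) ≤ (2 * I.n) * (3 * k) :=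
      Nat.mul_le_mul (by omega) (by omega)
    have a2 := Nat.mul_le_mul_right (levels I.n ^ 2) a1
    have a3 : 2 * I.n * (3 * k) * levels I.n ^ 2 = 6 * (I.n * k * levels I.n ^ 2) := by ring
    omega
  · refine h4.trans ?_
    have : 1400 * costOn I (Finset.range I.n) U ≤ 1400 * (2 * (12 * Real.exp 4 * θ ^ 2 *
        costOn I (Finset.range I.n) T) + 8 * costOn I (Finset.range I.n) T) := by linarith
    refine this.trans (le_of_eq ?_)
    ring

/-- The points whose numbers are in `A`. -/
def pointsOf {V : Type*} {n : ℕ} [Fintype V] (e : Fin n ≃ V) (A : Finset ℕ) : Finset V := {v | (e.symm v : ℕ) ∈ A}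

theorem card_pointsOf {V : Type*} {n : ℕ} [Fintype V] (e : Fin n ≃ V) {A : Finset ℕ} (hA : A ⊆ Finset.range n) :
    (pointsOf e A).card = A.card := by
  refine Finset.card_nbij (fun v => (e.symm v : ℕ)) ?_ ?_ ?_
  · intro v hv; simpa [pointsOf] using hv
  · intro v _ v' _ h
    exact e.symm.injective (Fin.ext h)
  · intro i hi
    have hin := Finset.mem_range.1 (hA hi)
    exact ⟨e ⟨i, hin⟩, by simpa [pointsOf] using hi, by simp⟩

section
variable {V : Type*} {n : ℕ} [MetricSpace V] (e : Fin n ≃ V) (w : V → ℝ≥0) (k : ℕ)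

theorem ofSpace_d (i j : Fin n) : (Input.ofSpace e w k).d i j = dist (e i) (e j) := by
  simp [Input.ofSpace]

theorem ofSpace_w (i : Fin n) : (Input.ofSpace e w k).w i = w (e i) := by
  simp [Input.ofSpace]

theorem ofSpace_isMetric : (Input.ofSpace e w k).IsMetric where
  self i := by simp [Input.ofSpace]
  nonneg i j := by
    simp only [Input.ofSpace]
    split_ifs
    · exact dist_nonneg
    · exact le_rfl
  comm i j := by
    by_cases hi : i < n <;> by_cases hj : j < n <;> simp [Input.ofSpace, hi, hj]
    exact dist_comm _ _
  tri i j l hj := by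
    have hj : j < n := hj
    simp only [Input.ofSpace, hj, true_and, and_true]
    by_cases hi : i < n <;> by_cases hl : l < n <;> simp [hi, hl, dist_triangle]
  w_nonneg j := by
    simp only [Input.ofSpace]
    split_ifs
    · exact NNReal.coe_nonneg _
    · exact le_rfl

/-- In a finite nonempty set the infimum distance is attained, which identifies it with the minimum
in `sqDist`. -/
theorem cost_pointsOf [Fintype V] {A : Finset ℕ} (hA : A ⊆ Finset.range n) (hne : A.Nonempty) :
    cost w (pointsOf e A) = costOn (Input.ofSpace e w k) (Finset.range n) A := by
  have hS : (pointsOf e A).Nonempty := by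
    rw [← Finset.card_pos, card_pointsOf e hA]; exact hne.card_pos
  rw [cost, costOn, Finset.sum_range, ← e.sum_comp]
  refine Finset.sum_congr rfl fun i _ => ?_
  rw [ofSpace_w]
  congr 1
  obtain ⟨y, hy, hyd⟩ := (pointsOf e A).finite_toSet.isCompact.exists_infDist_eq_dist
    (by exact_mod_cast hS) (e i)
  have hy' : (e.symm y : ℕ) ∈ A := by simpa [pointsOf] using hy
  have hd : dist (e i) y = (Input.ofSpace e w k).d i (e.symm y) := by
    rw [ofSpace_d, e.apply_symm_apply]
  rw [sqDist_eq hy' fun z hz => ?_, hyd, hd]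
  rw [← hd, ← hyd]
  have hzn := Finset.mem_range.1 (hA hz)
  have := ofSpace_d e w k i ⟨z, hzn⟩
  rw [this]
  refine pow_le_pow_left₀ Metric.infDist_nonneg (Metric.infDist_le_dist_of_mem ?_) 2
  simpa [pointsOf] using hz

theorem output_eq [Fintype V] (s : State) :
    output e s = pointsOf e (stored (Input.ofSpace e w k) s) := by
  ext v
  simp [output, pointsOf, stored, Input.ofSpace]

theorem exists_opt [Fintype V] (hk : 1 ≤ k) (hkn : k ≤ n) : ∃ T ⊆ Finset.range n, T.Nonempty ∧
    T.card ≤ k ∧ costOn (Input.ofSpace e w k) (Finset.range n) T = opt w k := by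
  have : Nonempty {S : Finset V // S.Nonempty ∧ S.card ≤ k} :=
    ⟨⟨{e ⟨0, by omega⟩}, Finset.singleton_nonempty _, by simpa using hk⟩⟩
  obtain ⟨⟨S, hS, hSk⟩, h⟩ := exists_eq_ciInf_of_finite
    (f := fun S : {S : Finset V // S.Nonempty ∧ S.card ≤ k} => cost w S.1)
  set T := S.image fun v => (e.symm v : ℕ) with hT
  have hTn : T ⊆ Finset.range n := by
    intro i hi
    obtain ⟨v, -, rfl⟩ := Finset.mem_image.1 hi
    exact Finset.mem_range.2 (e.symm v).isLt
  have hST : pointsOf e T = S := by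
    ext v
    simp only [pointsOf, hT, Finset.mem_filter, Finset.mem_univ, true_and, Finset.mem_image]
    constructor
    · rintro ⟨u, hu, huv⟩
      rwa [← e.symm.injective (Fin.ext huv)]
    · intro hv; exact ⟨v, hv, rfl⟩
  refine ⟨T, hTn, hS.image _, Finset.card_image_le.trans hSk, ?_⟩
  rw [← cost_pointsOf e w k hTn (hS.image _), hST, opt]
  exact h

end

/-! ### Estimates for the final constants -/

theorem one_le_aspectRatio (V : Type*) [MetricSpace V] : 1 ≤ aspectRatio V := le_max_left _ _

/-- `log₂(2n) = 1 + log n / log 2`, and `1 / log 2 ≤ 2`. -/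
theorem levels_le {n : ℕ} (hn : 1 ≤ n) : (levels n : ℝ) ≤ 2 * (1 + Real.log n) := by
  have h2 := Real.log_two_gt_d9
  have hn' : (1 : ℝ) ≤ n := by exact_mod_cast hn
  have hlog := Real.log_nonneg hn'
  have h1 : ((2 : ℝ) ^ Nat.log 2 (2 * n)) ≤ 2 * n := by
    exact_mod_cast Nat.pow_log_le_self 2 (by omega)
  have h3 := Real.log_le_log (by positivity) h1
  rw [Real.log_pow, Real.log_mul (by norm_num) (by positivity)] at h3
  rw [levels]
  push_cast
  have h4 : ((Nat.log 2 (2 * n) : ℕ) : ℝ) ≤ 1 + 2 * Real.log n := by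
    by_contra hlt
    push Not at hlt
    nlinarith
  linarith

/-- Passes from binary to natural logarithms: `1 / (log 2)² ≤ 3`. -/
theorem bound_le {x : ℝ} : (max 1 (x / Real.log 2)) ^ 2 ≤ 3 * max 1 (x ^ 2) := by
  have h2 := Real.log_two_gt_d9
  rcases max_choice 1 (x / Real.log 2) with h | h <;> rw [h]
  · have := le_max_left 1 (x ^ 2)
    linarith
  · rw [div_pow, div_le_iff₀ (by positivity)]
    have h3 := le_max_right 1 (x ^ 2)
    have h4 := le_max_left 1 (x ^ 2)
    have h5 : 1 ≤ 3 * Real.log 2 ^ 2 := by nlinarith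
    nlinarith

end KMeans
theorem mainTheorem3 :
    ∃ (P : KMeans.Prog) (b c : ℕ) (C₁ C₂ : ℝ),
      ∀ (V : Type*) [Fintype V] [MetricSpace V] (w : V → ℝ≥0) (n k : ℕ) (e : Fin n ≃ V),
        1 ≤ k → k ≤ n →
        ∃ (s : KMeans.State) (t : ℕ),
          KMeans.Run (KMeans.Input.ofSpace e w k) ((n + 2) ^ b) P
            (KMeans.start (KMeans.Input.ofSpace e w k)) s t ∧
          (t : ℝ) ≤ C₁ * (n * k) * (1 + Real.log (n * KMeans.aspectRatio V)) ^ c ∧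
          (KMeans.output e s).Nonempty ∧
          (KMeans.output e s).card ≤ k ∧
          KMeans.cost w (KMeans.output e s) ≤
            C₂ * max 1 (Real.log (n / k) ^ 2) * KMeans.opt w k := by
  -- The factor `4` comes from squaring `levels n ≤ 2(1 + log n)`, the factor `3` from `bound_le`.
  refine ⟨KMeans.kMeans, 13, 2, 760000 * 4, 1400 * (24 * Real.exp 4 * 3 + 8), ?_⟩
  intro V _ _ w n k e hk hkn
  have hn : 1 ≤ n := hk.trans hkn
  set I := KMeans.Input.ofSpace e w k with hIdef
  have hIn : I.n = n := rfl
  obtain ⟨T, hTn, hT, hTk, hTopt⟩ := KMeans.exists_opt e w k hk hkn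
  -- `(n + 2)⁷ ≥ 3⁷ = 2187` absorbs the factor `1000`.
  have hM : 1000 * (I.n + 2) ^ 6 ≤ (n + 2) ^ 13 := by
    have h7 : 3 ^ 7 ≤ (n + 2) ^ 7 := Nat.pow_le_pow_left (by omega) 7
    calc 1000 * (n + 2) ^ 6 ≤ (n + 2) ^ 7 * (n + 2) ^ 6 := Nat.mul_le_mul_right _ (by omega)
      _ = (n + 2) ^ 13 := by ring
  obtain ⟨s, t, hrun, ht, hne, hcard, hcost⟩ := KMeans.kMeans_spec
    (KMeans.ofSpace_isMetric e w k) hM (s := KMeans.start I) hk hkn rfl rfl hTn hT hTk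
    (le_max_left 1 (Real.log (n / k) / Real.log 2)) (le_max_right _ _)
  have hst : KMeans.stored I s ⊆ Finset.range n := Finset.filter_subset _ _
  have hout := KMeans.output_eq e w k s
  refine ⟨s, t, hrun, ?_, ?_, ?_, ?_⟩
  · have hn' : (1 : ℝ) ≤ n := by exact_mod_cast hn
    -- The time is bounded in terms of `log n` alone; the aspect ratio, being at least `1`, only
    -- weakens the bound.
    have h1 : (KMeans.levels n : ℝ) ≤ 2 * (1 + Real.log (n * KMeans.aspectRatio V)) := by
      refine (KMeans.levels_le hn).trans ?_
      have := Real.log_le_log (by linarith) (le_mul_of_one_le_right (by linarith : (0 : ℝ) ≤ n)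
        (KMeans.one_le_aspectRatio V))
      linarith
    have h2 : (KMeans.levels n : ℝ) ^ 2 ≤ (2 * (1 + Real.log (n * KMeans.aspectRatio V))) ^ 2 :=
      pow_le_pow_left₀ (Nat.cast_nonneg _) h1 2
    calc (t : ℝ) ≤ 760000 * (n * k * (KMeans.levels n : ℝ) ^ 2) := by exact_mod_cast ht
      _ ≤ 760000 * (n * k * (2 * (1 + Real.log (n * KMeans.aspectRatio V))) ^ 2) := by gcongr
      _ = _ := by ring
  · rw [hout, ← Finset.card_pos, KMeans.card_pointsOf e hst]
    exact hne.card_pos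
  · rw [hout, KMeans.card_pointsOf e hst]
    exact hcard
  · rw [hout, KMeans.cost_pointsOf e w k hst hne]
    refine hcost.trans ?_
    rw [← hTopt]
    refine mul_le_mul_of_nonneg_right ?_
      (KMeans.costOn_nonneg (KMeans.ofSpace_isMetric e w k) _ _)
    have hb := KMeans.bound_le (x := Real.log (n / k))
    have h1 := le_max_left 1 (Real.log (n / k) ^ 2)
    have h4 := Real.exp_pos 4
    have := mul_le_mul_of_nonneg_left hb (by positivity : 0 ≤ 24 * Real.exp 4)
    linarith
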